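/- A (rooted, binary) phylogenetic network with $n$ leaves is a finite directed acyclic graph without double edges whose nodes are: a unique root (in-degree $0$, out-degree $1$), leaves (in-degree $1$, out-degree $0$) bijectively labelled by $\{1,\dots,n\}$, tree nodes (in-degree $1$, out-degree $2$) and reticulation nodes (in-degree $2$, out-degree $1$). It is a tree-child network if every non-leaf node has a child that is not a reticulation node. A ranked tree-child network with $n\ge 2$ leaves is a tree-child network which evolves from a root followed by one branching event (a tree node with two outgoing lineages) by attaching in each of $n-2$ further steps either a branching event to one external lineage, or a reticulation event to two different external lineages (each of the two lineages ends in a new node, both new nodes are parents of a new reticulation node, and the three outgoing lineages of the event are one from each of these three nodes), together with the ranking of its $n-1$ events by the order in which they are attached; after the last step, the $n$ external lineages end in the labelled leaves. Two such networks are identified if there is a graph isomorphism between them that preserves leaf labels and ranks. A random ranked tree-child network with $n$ leaves is one picked uniformly at random from this finite set. A cherry is a branching event both of whose outgoing lineages are external (end in leaves). Let $C_n$ be the number of cherries in a random ranked tree-child network with $n$ leaves. Let $X_n$ be the number of occurrences of the following fringe pattern $P$ of height 2, with four external lineages: a branching event and a reticulation event such that one outgoing lineage of the branching event is external, the other one is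 an incoming lineage of the reticulation event, and all three outgoing lineages of the reticulation event are external. Let $Y_n$ be the number of occurrences of the following fringe pattern of height 3, with five external lineages, which consists of two overlapping patterns $P$: two different branching events and a reticulation event such that the incoming lineages of the reticulation event are one outgoing lineage of each of the two branching events, and the other outgoing lineage of each branching event as well as all three outgoing lineages of the reticulation event are external (the relative order of the two branching events is not distinguished). (a) As $n\to\infty$, $Y_n\to 0$ in $L_1$, that is, $\mathbb{E}|Y_n|\to 0$. (b) As $n\to\infty$, $(X_n,C_n)$ converges in distribution to $(X,C)$, where $X$ and $C$ are independent Poisson random variables with parameters $1/8$ and $1/4$, respectively. -/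

import Mathlib

open MeasureTheory ProbabilityTheory Filter Topology

namespace RTCN

/-! ### Directed graphs with labelled leaves and ranked nodes -/

/-- The raw data of a network: a directed graph on the set `V` of nodes, `n` nodes labelled by `Fin n` (the leaves), and
for each node the rank of the event that it belongs to (`0` for nodes which are in no event). -/
structure RankedNetwork (V : Type) (n : ℕ) where
  edge : V → V → Prop
  leaf : Fin n → V
  rank : V → ℕ

namespace RankedNetwork

variable {V W U : Type} {n : ℕ}

def children (N : RankedNetwork V n) (v : V) : Set V := {w | N.edge v w}

def parents (N : RankedNetwork V n) (v : V) : Set V := {u | N.edge u v}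

def IsRoot (N : RankedNetwork V n) (v : V) : Prop :=
  (N.parents v).encard = 0 ∧ (N.children v).encard = 1

def IsLeaf (N : RankedNetwork V n) (v : V) : Prop :=
  (N.parents v).encard = 1 ∧ (N.children v).encard = 0

def IsTreeNode (N : RankedNetwork V n) (v : V) : Prop :=
  (N.parents v).encard = 1 ∧ (N.children v).encard = 2

def IsReticulation (N : RankedNetwork V n) (v : V) : Prop :=
  (N.parents v).encard = 2 ∧ (N.children v).encard = 1

/-- Rooted binary phylogenetic networks with `n` bijectively labelled leaves. -/
structure IsPhylogenetic (N : RankedNetwork V n) : Prop where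
  finite : Finite V
  acyclic : ∀ v, ¬ Relation.TransGen N.edge v v
  root_unique : ∃! v, N.IsRoot v
  degrees : ∀ v, N.IsRoot v ∨ N.IsLeaf v ∨ N.IsTreeNode v ∨ N.IsReticulation v
  leaf_injective : Function.Injective N.leaf
  leaf_range : ∀ v, N.IsLeaf v ↔ v ∈ Set.range N.leaf

/-- Tree-child networks: phylogenetic networks in which every non-leaf node has at least one child
that is not a reticulation node. -/
def IsTreeChild (N : RankedNetwork V n) : Prop :=
  N.IsPhylogenetic ∧ ∀ v, ¬ N.IsLeaf v → ∃ w ∈ N.children v, ¬ N.IsReticulation w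

/-- Two networks are the same if some graph isomorphism preserves leaf labels and ranks. -/
def Iso (N : RankedNetwork V n) (M : RankedNetwork W n) : Prop :=
  ∃ e : V ≃ W, (∀ u v, M.edge (e u) (e v) ↔ N.edge u v) ∧
    (∀ k, e (N.leaf k) = M.leaf k) ∧ ∀ v, M.rank (e v) = N.rank v

theorem Iso.refl (N : RankedNetwork V n) : N.Iso N :=
  ⟨Equiv.refl _, by simp⟩

theorem Iso.symm {N : RankedNetwork V n} {M : RankedNetwork W n} : N.Iso M → M.Iso N := by
  rintro ⟨e, he, hl, hr⟩
  refine ⟨e.symm, fun u v => ?_, fun k => ?_, fun v => ?_⟩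
  · rw [← he]; simp
  · rw [← hl]; simp
  · rw [← hr]; simp

theorem Iso.trans {N : RankedNetwork V n} {M : RankedNetwork W n}
    {K : RankedNetwork U n} : N.Iso M → M.Iso K → N.Iso K := by
  rintro ⟨e, he, hl, hr⟩ ⟨f, hf, gl, gr⟩
  refine ⟨e.trans f, fun u v => ?_, fun k => ?_, fun v => ?_⟩
  · simp [hf, he]
  · simp [hl, gl]
  · simp [hr, gr]

/-! ### Fringe patterns -/

/-- A cherry: a node whose children are two distinct leaves. -/
def IsCherry (N : RankedNetwork V n) (u : V) : Prop :=
  ∃ k l, k ≠ l ∧ N.children u = {N.leaf k, N.leaf l}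

/-- A trident: a reticulation event, that is, a reticulation node `r` with its two parents `p` and
`q`, all three outgoing lineages of which are external (end in leaves). -/
def IsTrident (N : RankedNetwork V n) (p q r : V) : Prop :=
  p ≠ q ∧ N.parents r = {p, q} ∧
    ∃ a b c, N.children p = {N.leaf a, r} ∧ N.children q = {N.leaf b, r} ∧
      N.children r = {N.leaf c}

/-- The branching event `u` together with the reticulation event at `r` forms the pattern of
height 2 in which one of the two lineages of a cherry (the branching event `u`) has been hit by the
reticulation event: one outgoing lineage of `u` is external, the other one is an incoming lineage
of the reticulation event, whose three outgoing lineages are external. -/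
def IsHitCherry (N : RankedNetwork V n) (u r : V) : Prop :=
  ∃ p q k, N.IsTrident p q r ∧ N.children u = {N.leaf k, p}

/-- The reticulation event at `r` and two branching events form the pattern of height 3 that
consists of two overlapping patterns `IsHitCherry`: a reticulation event with external
outgoing lineages has hit two different cherries, the other lineage of each of them being
external. -/
def IsDoubleHit (N : RankedNetwork V n) (r : V) : Prop :=
  ∃ u v p q k l, u ≠ v ∧ N.IsTrident p q r ∧
    N.children u = {N.leaf k, p} ∧ N.children v = {N.leaf l, q}

/-- Number of cherries. -/
noncomputable def numCherries (N : RankedNetwork V n) : ℕ :=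
  {u | N.IsCherry u}.ncard

/-- Number of occurrences of the pattern `IsHitCherry`. -/
noncomputable def numHitCherries (N : RankedNetwork V n) : ℕ :=
  {x : V × V | N.IsHitCherry x.1 x.2}.ncard

/-- Number of occurrences of the pattern `IsDoubleHit`. -/
noncomputable def numDoubleHits (N : RankedNetwork V n) : ℕ :=
  {r | N.IsDoubleHit r}.ncard

theorem Iso.children_eq {N : RankedNetwork V n} {M : RankedNetwork W n} (e : V ≃ W)
    (he : ∀ u v, M.edge (e u) (e v) ↔ N.edge u v) (v : V) (s : Set V) :
    M.children (e v) = e '' s ↔ N.children v = s := by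
  have : M.children (e v) = e '' N.children v := by
    ext w
    obtain ⟨w, rfl⟩ := e.surjective w
    simp [children, he]
  rw [this, e.injective.image_injective.eq_iff]

theorem Iso.parents_eq {N : RankedNetwork V n} {M : RankedNetwork W n} (e : V ≃ W)
    (he : ∀ u v, M.edge (e u) (e v) ↔ N.edge u v) (v : V) (s : Set V) :
    M.parents (e v) = e '' s ↔ N.parents v = s := by
  have : M.parents (e v) = e '' N.parents v := by
    ext w
    obtain ⟨w, rfl⟩ := e.surjective w
    simp [parents, he]
  rw [this, e.injective.image_injective.eq_iff]

theorem Iso.isCherry {N : RankedNetwork V n} {M : RankedNetwork W n} (e : V ≃ W)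
    (he : ∀ u v, M.edge (e u) (e v) ↔ N.edge u v) (hl : ∀ k, e (N.leaf k) = M.leaf k)
    (u : V) : M.IsCherry (e u) ↔ N.IsCherry u := by
  simp only [IsCherry, ← children_eq e he, Set.image_pair, hl]

theorem Iso.isTrident {N : RankedNetwork V n} {M : RankedNetwork W n} (e : V ≃ W)
    (he : ∀ u v, M.edge (e u) (e v) ↔ N.edge u v) (hl : ∀ k, e (N.leaf k) = M.leaf k)
    (p q r : V) : M.IsTrident (e p) (e q) (e r) ↔ N.IsTrident p q r := by
  simp only [IsTrident, ← children_eq e he, ← parents_eq e he, Set.image_pair,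
    Set.image_singleton, hl, ne_eq, e.injective.eq_iff]

theorem Iso.isHitCherry {N : RankedNetwork V n} {M : RankedNetwork W n} (e : V ≃ W)
    (he : ∀ u v, M.edge (e u) (e v) ↔ N.edge u v) (hl : ∀ k, e (N.leaf k) = M.leaf k)
    (u r : V) : M.IsHitCherry (e u) (e r) ↔ N.IsHitCherry u r := by
  simp only [IsHitCherry, ← isTrident e he hl, ← children_eq e he,
    Set.image_pair, hl, e.symm.exists_congr_left, Equiv.symm_symm]

theorem Iso.isDoubleHit {N : RankedNetwork V n} {M : RankedNetwork W n} (e : V ≃ W)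
    (he : ∀ u v, M.edge (e u) (e v) ↔ N.edge u v) (hl : ∀ k, e (N.leaf k) = M.leaf k)
    (r : V) : M.IsDoubleHit (e r) ↔ N.IsDoubleHit r := by
  simp only [IsDoubleHit, ← isTrident e he hl, ← children_eq e he,
    Set.image_pair, hl, e.symm.exists_congr_left, Equiv.symm_symm, ne_eq, e.injective.eq_iff]

theorem Iso.numCherries_eq {N : RankedNetwork V n} {M : RankedNetwork W n} : N.Iso M → N.numCherries = M.numCherries := by
  rintro ⟨e, he, hl, -⟩
  refine Set.ncard_congr' (e.subtypeEquiv fun u => ?_)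
  exact (isCherry e he hl u).symm

theorem Iso.numHitCherries_eq {N : RankedNetwork V n} {M : RankedNetwork W n} :
    N.Iso M → N.numHitCherries = M.numHitCherries := by
  rintro ⟨e, he, hl, -⟩
  refine Set.ncard_congr' ((e.prodCongr e).subtypeEquiv fun x => ?_)
  exact (isHitCherry e he hl x.1 x.2).symm

theorem Iso.numDoubleHits_eq {N : RankedNetwork V n} {M : RankedNetwork W n} :
    N.Iso M → N.numDoubleHits = M.numDoubleHits := by
  rintro ⟨e, he, hl, -⟩
  refine Set.ncard_congr' (e.subtypeEquiv fun r => ?_)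
  exact (isDoubleHit e he hl r).symm

end RankedNetwork

/-! ### The evolution of ranked networks -/

/-- A network under construction: a directed graph with ranked nodes and `n` external lineages
which hang at the nodes `source 0, …, source (n - 1)` and have no lower end yet. -/
structure Stage (V : Type) (n : ℕ) where
  edge : V → V → Prop
  rank : V → ℕ
  source : Fin n → V

/-- The three nodes of a reticulation event: two parents and the reticulation node. -/
inductive RetNode
  | left
  | right
  | hybrid

namespace Stage

variable {V : Type} {n : ℕ}

/-- The root (`false`) and below it one branching event (`true`), of rank `1`. -/
def start : Stage Bool 2 where
  edge u v := u = false ∧ v = true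
  rank v := if v then 1 else 0
  source _ := true

/-- Attach a branching event `none` to the external lineage `i`: its two outgoing lineages are the
new lineages `i` and `n`. With `n` lineages there have been `n - 1` events; so the rank is `n`. -/
def branch (S : Stage V n) (i : Fin n) : Stage (Option V) (n + 1) where
  edge
    | some u, some v => S.edge u v
    | some u, none => u = S.source i
    | none, _ => False
  rank
    | some u => S.rank u
    | none => n
  source := Fin.snoc (α := fun _ => Option V)
    (fun k => if k = i then none else some (S.source k)) none

/-- Attach a reticulation event to the external lineages `i` and `j`: the new lineages `i` and `j`
start at the two parents of the reticulation node, the new lineage `n` at the reticulation node. -/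
def reticulate (S : Stage V n) (i j : Fin n) : Stage (V ⊕ RetNode) (n + 1) where
  edge
    | .inl u, .inl v => S.edge u v
    | .inl u, .inr .left => u = S.source i
    | .inl u, .inr .right => u = S.source j
    | .inr .left, .inr .hybrid => True
    | .inr .right, .inr .hybrid => True
    | _, _ => False
  rank
    | .inl u => S.rank u
    | .inr _ => n
  source := Fin.snoc (α := fun _ => V ⊕ RetNode)
    (fun k => if k = i then .inr .left else if k = j then .inr .right else .inl (S.source k))
    (.inr .hybrid)

/-- Stop, and let the external lineage `σ k` end in the leaf with label `k`. -/
def toNetwork (S : Stage V n) (σ : Equiv.Perm (Fin n)) : RankedNetwork (V ⊕ Fin n) n where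
  edge
    | .inl u, .inl v => S.edge u v
    | .inl u, .inr k => u = S.source (σ k)
    | .inr _, _ => False
  leaf := .inr
  rank
    | .inl u => S.rank u
    | .inr _ => 0

end Stage

/-- The ways to evolve from a branching event to `n` external lineages by attaching in each step
either a branching event to a lineage or a reticulation event to two different lineages. -/
inductive Evolution : ℕ → Type
  | start : Evolution 2
  | branch {n : ℕ} (h : Evolution n) (i : Fin n) : Evolution (n + 1)
  | reticulate {n : ℕ} (h : Evolution n) (i j : Fin n) (hij : i ≠ j) : Evolution (n + 1)

namespace Evolution

/-- The nodes that an evolution has created. -/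
def Node : {n : ℕ} → Evolution n → Type
  | _, start => Bool
  | _, branch h _ => Option h.Node
  | _, reticulate h _ _ _ => h.Node ⊕ RetNode

/-- The outcome of an evolution. -/
def stage : {n : ℕ} → (h : Evolution n) → Stage h.Node n
  | _, start => Stage.start
  | _, branch h i => h.stage.branch i
  | _, reticulate h i j _ => h.stage.reticulate i j

/-- The outcome of an evolution, the lineage `σ k` ending in the leaf with label `k`. -/
def network {n : ℕ} (h : Evolution n) (σ : Equiv.Perm (Fin n)) :
    RankedNetwork (h.Node ⊕ Fin n) n :=
  h.stage.toNetwork σ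

theorem two_le : {n : ℕ} → Evolution n → 2 ≤ n
  | _, start => le_rfl
  | _, branch h _ => h.two_le.trans (Nat.le_succ _)
  | _, reticulate h _ _ _ => h.two_le.trans (Nat.le_succ _)

instance instNonempty : (n : ℕ) → Nonempty (Evolution (n + 2))
  | 0 => ⟨start⟩
  | n + 1 => (instNonempty n).map fun h => h.branch 0

/-- The last event of an evolution and the evolution before it. -/
def unfold : {n : ℕ} → Evolution (n + 1) → Option (Evolution n × Fin n × Fin n)
  | _, start => none
  | _, branch h i => some (h, i, i)
  | _, reticulate h i j _ => some (h, i, j)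

theorem unfold_injective {n : ℕ} : Function.Injective (unfold (n := n)) := by
  intro a b hab
  cases a <;> cases b <;> simp_all [unfold] <;> grind

instance instFinite : (n : ℕ) → Finite (Evolution n)
  | 0 => by
    have : IsEmpty (Evolution 0) := ⟨fun h => by simpa using h.two_le⟩
    infer_instance
  | n + 1 => by
    have := instFinite n
    exact Finite.of_injective _ unfold_injective

end Evolution

/-! ### The outcome of an evolution is a tree-child network -/

namespace Stage

variable {V : Type} {n : ℕ}

def parents (S : Stage V n) (v : V) : Set V := {u | S.edge u v}

/-- Children and external lineages of a node. -/
def out (S : Stage V n) (v : V) : Set (V ⊕ Fin n) :=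
  {x | Sum.elim (fun w => S.edge v w) (fun k => v = S.source k) x}

/-- The properties of a tree-child network, for a network under construction. -/
structure Good (S : Stage V n) : Prop where
  finite : Finite V
  height : ∃ f : V → ℕ, ∀ u v, S.edge u v → f u < f v
  root : ∃ ρ, ∀ v, (S.parents v).encard = 0 ↔ v = ρ
  degrees : ∀ v, ((S.parents v).encard = 0 ∧ (S.out v).encard = 1) ∨
    ((S.parents v).encard = 1 ∧ (S.out v).encard = 2) ∨
    ((S.parents v).encard = 2 ∧ (S.out v).encard = 1)
  child : ∀ v, ∃ x ∈ S.out v, ∀ w, x = .inl w → (S.parents w).encard = 1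

theorem good_start : start.Good where
  finite := inferInstance
  height := ⟨fun v => v.toNat, by simp [start]⟩
  root := ⟨false, by
    rintro (_ | _) <;> simp [start, parents]⟩
  degrees := by
    have h1 : start.parents true = {false} := by ext (_ | _) <;> simp [start, parents]
    have h2 : start.parents false = ∅ := by ext (_ | _) <;> simp [start, parents]
    have h3 : start.out true = {.inr 0, .inr 1} := by
      ext ((_ | _) | k) <;> simp [start, out]
      omega
    have h4 : start.out false = {.inl true} := by
      ext ((_ | _) | k) <;> simp [start, out]
    rintro (_ | _)
    · simp [h2, h4]
    · rw [h1, h3, Set.encard_pair (by simp)]; simp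
  child := by
    have h1 : start.parents true = {false} := by ext (_ | _) <;> simp [start, parents]
    rintro (_ | _)
    · exact ⟨.inl true, by simp [start, out], by rintro w ⟨⟩; simp [h1]⟩
    · exact ⟨.inr 0, by simp [start, out], by simp⟩

theorem Good.branch {S : Stage V n} (h : S.Good) (i : Fin n) : (S.branch i).Good := by
  have := h.finite
  have hc : ∀ a b : Fin n, a.castSucc = b.castSucc → a = b := fun _ _ h => Fin.castSucc_injective n h
  let φ : V ⊕ Fin n → Option V ⊕ Fin (n + 1) :=
    Sum.elim (fun w => .inl (some w)) (fun k => if k = i then .inl none else .inr k.castSucc)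
  have hφ : φ.Injective := by
    rintro (a | a) (b | b) <;> simp only [φ, Sum.elim_inl, Sum.elim_inr] <;> grind
  have p1 (v) : (S.branch i).parents (some v) = some '' S.parents v := by
    ext (_ | u) <;> simp [parents, Stage.branch]
  have p2 : (S.branch i).parents none = {some (S.source i)} := by
    ext (_ | u) <;> simp [parents, Stage.branch]
  have o1 (v) : (S.branch i).out (some v) = φ '' S.out v := by
    ext ((_ | u) | k)
    · simp [out, Stage.branch, φ]
    · simp [out, Stage.branch, φ]
      grind
    · induction k using Fin.lastCases <;> simp [out, Stage.branch, φ] <;> grind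
  have o2 : (S.branch i).out none = {.inr i.castSucc, .inr (Fin.last n)} := by
    ext ((_ | u) | k)
    · simp [out, Stage.branch]
    · simp [out, Stage.branch]
    · induction k using Fin.lastCases <;> simp [out, Stage.branch]
  have e1 (v) : ((S.branch i).parents (some v)).encard = (S.parents v).encard := by
    rw [p1, (Option.some_injective _).encard_image]
  have e2 (v) : ((S.branch i).out (some v)).encard = (S.out v).encard := by
    rw [o1, hφ.encard_image]
  refine ⟨inferInstance, ?_, ?_, ?_, ?_⟩
  · obtain ⟨f, hf⟩ := h.height
    obtain ⟨B, hB⟩ := (Set.finite_range f).bddAbove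
    refine ⟨fun v => v.elim (B + 1) f, ?_⟩
    rintro (_ | u) (_ | v) <;> simp [Stage.branch]
    · rintro rfl
      exact hB ⟨_, rfl⟩
    · exact hf u v
  · obtain ⟨ρ, hρ⟩ := h.root
    refine ⟨some ρ, ?_⟩
    rintro (_ | v)
    · simp [p2]
    · rw [e1, hρ]; simp
  · rintro (_ | v)
    · rw [p2, o2, Set.encard_pair (by simp [Fin.castSucc_ne_last])]; simp
    · rw [e1, e2]; exact h.degrees v
  · rintro (_ | v)
    · exact ⟨.inr i.castSucc, by simp [o2], by simp⟩
    · obtain ⟨x, hx, hx'⟩ := h.child v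
      refine ⟨φ x, by rw [o1]; exact ⟨x, hx, rfl⟩, ?_⟩
      rintro (_ | w) hw
      · simp [p2]
      · rw [e1]
        exact hx' w (hφ hw)

theorem Good.reticulate {S : Stage V n} (h : S.Good) (i j : Fin n) (hij : i ≠ j) :
    (S.reticulate i j).Good := by
  have := h.finite
  have : Finite RetNode := Finite.of_injective (fun x => RetNode.casesOn x 0 1 2 : RetNode → Fin 3)
    (by rintro (_ | _ | _) (_ | _ | _) <;> simp)
  have hc : ∀ a b : Fin n, a.castSucc = b.castSucc → a = b := fun _ _ h => Fin.castSucc_injective n h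
  let φ : V ⊕ Fin n → (V ⊕ RetNode) ⊕ Fin (n + 1) :=
    Sum.elim (fun w => .inl (.inl w)) (fun k => if k = i then .inl (.inr .left) else
      if k = j then .inl (.inr .right) else .inr k.castSucc)
  have hφ : φ.Injective := by
    rintro (a | a) (b | b) <;> simp only [φ, Sum.elim_inl, Sum.elim_inr] <;> grind
  have p1 (v) : (S.reticulate i j).parents (.inl v) = .inl '' S.parents v := by
    ext (u | _ | _ | _) <;> simp [parents, Stage.reticulate]
  have p2 : (S.reticulate i j).parents (.inr .left) = {.inl (S.source i)} := by
    ext (u | _ | _ | _) <;> simp [parents, Stage.reticulate]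
  have p3 : (S.reticulate i j).parents (.inr .right) = {.inl (S.source j)} := by
    ext (u | _ | _ | _) <;> simp [parents, Stage.reticulate]
  have p4 : (S.reticulate i j).parents (.inr .hybrid) = {.inr .left, .inr .right} := by
    ext (u | _ | _ | _) <;> simp [parents, Stage.reticulate]
  have o1 (v) : (S.reticulate i j).out (.inl v) = φ '' S.out v := by
    ext ((u | _ | _ | _) | k)
    · simp [out, Stage.reticulate, φ]
      grind
    · simp [out, Stage.reticulate, φ]
      grind
    · simp [out, Stage.reticulate, φ]
      grind
    · simp [out, Stage.reticulate, φ]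
      grind
    · induction k using Fin.lastCases <;> simp [out, Stage.reticulate, φ] <;> grind
  have o2 : (S.reticulate i j).out (.inr .left) = {.inl (.inr .hybrid), .inr i.castSucc} := by
    ext ((u | _ | _ | _) | k)
    iterate 4 simp [out, Stage.reticulate]
    induction k using Fin.lastCases <;> simp [out, Stage.reticulate] <;> grind
  have o3 : (S.reticulate i j).out (.inr .right) = {.inl (.inr .hybrid), .inr j.castSucc} := by
    ext ((u | _ | _ | _) | k)
    iterate 4 simp [out, Stage.reticulate]
    induction k using Fin.lastCases <;> simp [out, Stage.reticulate] <;> grind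
  have o4 : (S.reticulate i j).out (.inr .hybrid) = {.inr (Fin.last n)} := by
    ext ((u | _ | _ | _) | k)
    iterate 4 simp [out, Stage.reticulate]
    induction k using Fin.lastCases <;> simp [out, Stage.reticulate] <;> grind
  have e1 (v) : ((S.reticulate i j).parents (.inl v)).encard = (S.parents v).encard := by
    rw [p1, Sum.inl_injective.encard_image]
  have e2 (v) : ((S.reticulate i j).out (.inl v)).encard = (S.out v).encard := by
    rw [o1, hφ.encard_image]
  refine ⟨inferInstance, ?_, ?_, ?_, ?_⟩
  · obtain ⟨f, hf⟩ := h.height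
    obtain ⟨B, hB⟩ := (Set.finite_range f).bddAbove
    have hB' (v) : f v < B + 1 := Nat.lt_succ_of_le (hB ⟨v, rfl⟩)
    refine ⟨Sum.elim f fun x => RetNode.casesOn x (B + 1) (B + 1) (B + 2), ?_⟩
    rintro (u | _ | _ | _) (v | _ | _ | _) <;> simp [Stage.reticulate]
    · exact hf u v
    · rintro rfl; exact Nat.lt_succ_iff.1 (hB' _)
    · rintro rfl; exact Nat.lt_succ_iff.1 (hB' _)
  · obtain ⟨ρ, hρ⟩ := h.root
    refine ⟨.inl ρ, ?_⟩
    rintro (v | _ | _ | _)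
    · rw [e1, hρ]; simp
    · simp [p2]
    · simp [p3]
    · rw [p4, Set.encard_pair (by simp)]; simp
  · rintro (v | _ | _ | _)
    · rw [e1, e2]; exact h.degrees v
    · rw [p2, o2, Set.encard_pair (by simp)]; simp
    · rw [p3, o3, Set.encard_pair (by simp)]; simp
    · rw [p4, o4, Set.encard_pair (by simp)]; simp
  · rintro (v | _ | _ | _)
    · obtain ⟨x, hx, hx'⟩ := h.child v
      refine ⟨φ x, by rw [o1]; exact ⟨x, hx, rfl⟩, ?_⟩
      rintro (w | _ | _ | _) hw
      · rw [e1]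
        exact hx' w (hφ hw)
      · simp [p2]
      · simp [p3]
      · rcases x with x | k <;> simp only [φ, Sum.elim_inl, Sum.elim_inr] at hw <;> grind
    · exact ⟨.inr i.castSucc, by simp [o2], by simp⟩
    · exact ⟨.inr j.castSucc, by simp [o3], by simp⟩
    · exact ⟨.inr (Fin.last n), by simp [o4], by simp⟩

theorem Good.isTreeChild {S : Stage V n} (h : S.Good) (σ : Equiv.Perm (Fin n)) :
    (S.toNetwork σ).IsTreeChild := by
  have := h.finite
  let φ : V ⊕ Fin n → V ⊕ Fin n := Sum.map id σ.symm
  have hφ : φ.Injective := Function.injective_id.sumMap σ.symm.injective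
  have p1 (v) : (S.toNetwork σ).parents (.inl v) = .inl '' S.parents v := by
    ext (u | _) <;> simp [parents, RankedNetwork.parents, toNetwork]
  have p2 (k) : (S.toNetwork σ).parents (.inr k) = {.inl (S.source (σ k))} := by
    ext (u | _) <;> simp [RankedNetwork.parents, toNetwork]
  have o1 (v) : (S.toNetwork σ).children (.inl v) = φ '' S.out v := by
    ext (u | k)
    · simp [out, RankedNetwork.children, toNetwork, φ]
    · simp [out, RankedNetwork.children, toNetwork, φ, Equiv.symm_apply_eq]
  have o2 (k) : (S.toNetwork σ).children (.inr k) = ∅ := by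
    ext (u | _) <;> simp [RankedNetwork.children, toNetwork]
  have e1 (v) : ((S.toNetwork σ).parents (.inl v)).encard = (S.parents v).encard := by
    rw [p1, Sum.inl_injective.encard_image]
  have e2 (v) : ((S.toNetwork σ).children (.inl v)).encard = (S.out v).encard := by
    rw [o1, hφ.encard_image]
  have l1 (v) : ¬ (S.toNetwork σ).IsLeaf (.inl v) := by
    rw [RankedNetwork.IsLeaf, e1, e2]
    rintro ⟨h1, h2⟩
    rcases h.degrees v with h | h | h <;> simp [h2] at h
  have l2 (k) : (S.toNetwork σ).IsLeaf (.inr k) := by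
    simp [RankedNetwork.IsLeaf, p2, o2]
  refine ⟨⟨inferInstance, ?_, ?_, ?_, Sum.inr_injective, ?_⟩, ?_⟩
  · obtain ⟨f, hf⟩ := h.height
    obtain ⟨B, hB⟩ := (Set.finite_range f).bddAbove
    have hB' (v) : f v < B + 1 := Nat.lt_succ_of_le (hB ⟨v, rfl⟩)
    let g : V ⊕ Fin n → ℕ := Sum.elim f fun _ => B + 1
    have hg : ∀ u v, (S.toNetwork σ).edge u v → g u < g v := by
      rintro (u | _) (v | _) <;> simp [toNetwork, g]
      · exact hf u v
      · rintro rfl; exact Nat.lt_succ_iff.1 (hB' _)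
    have hg' : ∀ u v, Relation.TransGen (S.toNetwork σ).edge u v → g u < g v := by
      intro u v huv
      induction huv with
      | single h => exact hg _ _ h
      | tail _ h ih => exact ih.trans (hg _ _ h)
    exact fun v hv => (hg' v v hv).false
  · obtain ⟨ρ, hρ⟩ := h.root
    refine ⟨.inl ρ, ?_, ?_⟩
    · have h0 := (hρ ρ).2 rfl
      refine ⟨by rw [e1, h0], ?_⟩
      rw [e2]
      rcases h.degrees ρ with h | h | h
      · exact h.2
      · simp [h0] at h
      · simp [h0] at h
    · rintro (v | k) hv
      · rw [(hρ v).1 (by rw [← e1]; exact hv.1)]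
      · have := hv.1
        simp [p2] at this
  · rintro (v | k)
    · simp only [RankedNetwork.IsRoot, RankedNetwork.IsTreeNode, RankedNetwork.IsReticulation,
        e1, e2]
      have := h.degrees v
      tauto
    · exact .inr (.inl (l2 k))
  · rintro (v | k)
    · simpa [toNetwork] using l1 v
    · simpa [toNetwork] using l2 k
  · rintro (v | k) hv
    · obtain ⟨x, hx, hx'⟩ := h.child v
      refine ⟨φ x, by rw [o1]; exact ⟨x, hx, rfl⟩, ?_⟩
      rintro ⟨hr, -⟩
      rcases x with w | k
      · have := e1 w
        rw [hx' w rfl] at this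
        change ((S.toNetwork σ).parents (.inl w)).encard = 2 at hr
        simp [this] at hr
      · change ((S.toNetwork σ).parents (.inr _)).encard = 2 at hr
        simp [p2] at hr
    · exact absurd (l2 k) hv

end Stage

theorem Evolution.good : {n : ℕ} → (h : Evolution n) → h.stage.Good
  | _, start => Stage.good_start
  | _, branch h i => h.good.branch i
  | _, reticulate h i j hij => h.good.reticulate i j hij

/-- Everything that has evolved is a tree-child network. -/
theorem Evolution.isTreeChild {n : ℕ} (h : Evolution n) (σ : Equiv.Perm (Fin n)) :
    (h.network σ).IsTreeChild :=
  h.good.isTreeChild σ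

/-! ### Random ranked tree-child networks -/

/-- Two evolutions with labelled ends are equivalent if they lead to the same network. -/
def evolutionSetoid (n : ℕ) : Setoid (Evolution n × Equiv.Perm (Fin n)) where
  r x y := (x.1.network x.2).Iso (y.1.network y.2)
  iseqv := ⟨fun _ => .refl _, .symm, .trans⟩

/-- The set of ranked tree-child networks with `n` labelled leaves, that is, of the ranked networks
with `n` labelled leaves which have evolved from a branching event, up to isomorphism. -/
def RankedTreeChildNetwork (n : ℕ) : Type :=
  Quotient (evolutionSetoid n)

namespace RankedTreeChildNetwork

variable {n : ℕ}

instance : Finite (RankedTreeChildNetwork n) :=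
  inferInstanceAs (Finite (Quotient (evolutionSetoid n)))

instance : Nonempty (RankedTreeChildNetwork (n + 2)) :=
  (Evolution.instNonempty n).map fun h => Quotient.mk (evolutionSetoid (n + 2)) (h, 1)

instance : MeasurableSpace (RankedTreeChildNetwork n) := ⊤

instance : DiscreteMeasurableSpace (RankedTreeChildNetwork n) := ⟨fun _ => trivial⟩

/-- Number of cherries in a ranked tree-child network. -/
noncomputable def numCherries : RankedTreeChildNetwork n → ℕ :=
  Quotient.lift (fun x => (x.1.network x.2).numCherries) fun _ _ h =>
    RankedNetwork.Iso.numCherries_eq h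

/-- Number of occurrences in a ranked tree-child network of the pattern of height 2 in which a
reticulation event has hit a cherry. -/
noncomputable def numHitCherries : RankedTreeChildNetwork n → ℕ :=
  Quotient.lift (fun x => (x.1.network x.2).numHitCherries) fun _ _ h =>
    RankedNetwork.Iso.numHitCherries_eq h

/-- Number of occurrences in a ranked tree-child network of the pattern of height 3 in which a
reticulation event has hit two cherries. -/
noncomputable def numDoubleHits : RankedTreeChildNetwork n → ℕ :=
  Quotient.lift (fun x => (x.1.network x.2).numDoubleHits) fun _ _ h =>
    RankedNetwork.Iso.numDoubleHits_eq h

/-- The uniform distribution on the ranked tree-child networks with `n` leaves. -/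
noncomputable def uniform (n : ℕ) : Measure (RankedTreeChildNetwork n) :=
  uniformOn Set.univ

instance : IsProbabilityMeasure (uniform (n + 2)) :=
  inferInstanceAs (IsProbabilityMeasure (uniformOn Set.univ))

end RankedTreeChildNetwork

end RTCN

/-! Counting by evolutions. Given n lineages, the next event is encoded by an ordered pair (i, j):
branching at i if i = j, reticulation otherwise. A uniformly random evolution is therefore a Markov
chain that draws a uniform pair among n² in each step (`mean_succ`). Every network comes from
exactly 2^(n-1) evolutions with labelled ends, because each event can be recorded in two ways:
exchange the two lineages of a branching event, or the two parents of a reticulation node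
(`card_isos`). Hence uniform networks have the same pattern counts as uniform evolutions
(`integral_uniform`).

Heuristics. Only pairs that meet a lineage of a pattern, or the diagonal, change (X, C). Up to
second order in 1/n, the chain adds a cherry with probability 1/n, turns one of the C cherries (2
lineages each, two orders of the pair) into a hit cherry with probability 4C/n, and destroys one of
the X hit cherries (4 lineages each) with probability 8X/n. This is a tandem of infinite-server
queues with arrival rate 1 and service rates 4 and 8 per individual, whose stationary law is a
product of Poisson laws with parameters 1/4 for C and 1/8 for X.

Proof. On the monomial s^x t^c the `generator` acts as a first-order differential operator. So the
joint generating function at n + 1 is, up to a summable error, (1 + (t-1)/n) times the one at n with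
arguments moved towards (1, 1) (`norm_genFun_succ_sub_le`). The Poisson generating function
satisfies the same recursion up to a summable error. Both equal 1 at (1, 1), and the moves contract
the distance to (1, 1) by 1 - 4/n; hence the difference tends to 0 (`tendsto_zero_of_contraction`).
Lévy's continuity theorem yields convergence in distribution.

Errors. Pattern lineages number at most 8B, where B is the number of branching events. B grows by 1
with probability 1/n, so the mean of (3/2)^B is O(√n), and the events that meet two pattern lineages
cost O(√n/n²). When hit patterns overlap, the count of 4X lineages fails; this requires a double
hit, and these have weighted mean O(1/√n), because creating one takes two cherry lineages at once
(`mean_doubleCount_le`). The same bound gives part (a). -/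

namespace RTCN

/-! ### The number of evolutions of a network -/

/-- A bijection that preserves the two parts of a disjoint union is a sum of two bijections. -/
theorem exists_sumCongr {A B C D : Type} (e : A ⊕ B ≃ C ⊕ D)
    (h : ∀ x, (e x).isLeft = x.isLeft) :
    ∃ (f : A ≃ C) (g : B ≃ D), e = f.sumCongr g := by
  have hs : ∀ y, (e.symm y).isLeft = y.isLeft := fun y => by rw [← h, e.apply_symm_apply]
  have h1 : ∀ a, ∃ c, e (.inl a) = .inl c := fun a => Sum.isLeft_iff.1 (h (.inl a))
  have h2 : ∀ b, ∃ d, e (.inr b) = .inr d := fun b =>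
    Sum.isRight_iff.1 (by rw [← Bool.not_eq_false, Sum.isRight_eq_false, h]; simp)
  have h3 : ∀ c, ∃ a, e.symm (.inl c) = .inl a := fun a => Sum.isLeft_iff.1 (hs (.inl a))
  have h4 : ∀ d, ∃ b, e.symm (.inr d) = .inr b := fun b =>
    Sum.isRight_iff.1 (by rw [← Bool.not_eq_false, Sum.isRight_eq_false, hs]; simp)
  choose f hf using h1
  choose g hg using h2
  choose f' hf' using h3
  choose g' hg' using h4
  refine ⟨⟨f, f', fun a => ?_, fun c => ?_⟩, ⟨g, g', fun b => ?_, fun d => ?_⟩, ?_⟩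
  · have := hf' (f a)
    rw [← hf, e.symm_apply_apply] at this
    exact (Sum.inl_injective this).symm
  · have := hf (f' c)
    rw [← hf', e.apply_symm_apply] at this
    exact (Sum.inl_injective this).symm
  · have := hg' (g b)
    rw [← hg, e.symm_apply_apply] at this
    exact (Sum.inr_injective this).symm
  · have := hg (g' d)
    rw [← hg', e.apply_symm_apply] at this
    exact (Sum.inr_injective this).symm
  · ext (a | b)
    · simp [hf]
    · simp [hg]

/-- A bijection of types with one additional element that preserves this element. -/
theorem exists_optionCongr {A C : Type} (e : Option A ≃ Option C) (h : e none = none) :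
    ∃ f : A ≃ C, e = f.optionCongr := by
  refine ⟨e.removeNone, ?_⟩
  ext1 (_ | a)
  · simp [h]
  · have : ∃ c, e (some a) = some c := by
      rw [← Option.ne_none_iff_exists']
      intro h'
      have := e.injective (h'.trans h.symm)
      simp at this
    simpa using (Equiv.removeNone_some e this).symm

/-- Exchange the two parents of a reticulation node. -/
def RetNode.swap : RetNode → RetNode
  | .left => .right
  | .right => .left
  | .hybrid => .hybrid

/-- `RetNode.swap` as a bijection. -/
def RetNode.swapEquiv : RetNode ≃ RetNode where
  toFun := RetNode.swap
  invFun := RetNode.swap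
  left_inv := by rintro (_ | _ | _) <;> rfl
  right_inv := by rintro (_ | _ | _) <;> rfl

namespace Stage

variable {V W : Type} {n : ℕ}

/-- `e` is an isomorphism of networks under construction which maps the external lineage `k` to
the external lineage `τ k`. -/
structure IsIso (S : Stage V n) (T : Stage W n) (e : V ≃ W) (τ : Equiv.Perm (Fin n)) : Prop where
  edge : ∀ u v, T.edge (e u) (e v) ↔ S.edge u v
  rank : ∀ v, T.rank (e v) = S.rank v
  source : ∀ k, T.source (τ k) = e (S.source k)

/-- Leaves keep their labels, so a network isomorphism is the identity on leaves and restricts to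
the inner nodes. The label k sits on lineage `σ k` in one network and on `τ k` in the other, whence
the permutation `τ * σ⁻¹`. -/
theorem toNetwork_iso_iff (S : Stage V n) (T : Stage W n) (σ τ : Equiv.Perm (Fin n)) :
    (S.toNetwork σ).Iso (T.toNetwork τ) ↔ ∃ e, S.IsIso T e (τ * σ⁻¹) := by
  constructor
  · rintro ⟨E, hE, hl, hr⟩
    have hl' : ∀ k, E (.inr k) = .inr k := hl
    have : ∀ x, (E x).isLeft = x.isLeft := by
      rintro (v | k)
      · by_contra h
        obtain ⟨k, hk⟩ := Sum.isRight_iff.1 (show (E (.inl v)).isRight = true by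
          rcases hv : E (.inl v) with w | k <;> simp_all)
        rw [← hl' k] at hk
        simpa using E.injective hk
      · rw [hl']; rfl
    obtain ⟨e, g, rfl⟩ := exists_sumCongr E this
    obtain rfl : g = Equiv.refl _ := by
      ext1 k
      exact Sum.inr_injective (hl' k)
    refine ⟨e, fun u v => hE (.inl u) (.inl v), fun v => hr (.inl v), fun k => ?_⟩
    exact ((hE (.inl (S.source k)) (.inr (σ⁻¹ k))).2 (by simp [toNetwork])).symm
  · rintro ⟨e, h⟩
    have hs : ∀ k, T.source (τ k) = e (S.source (σ k)) := fun k => by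
      simpa using h.source (σ k)
    refine ⟨e.sumCongr (Equiv.refl _), ?_, fun _ => rfl, ?_⟩
    · rintro (u | k) (v | l)
      · exact h.edge u v
      · change e u = T.source (τ l) ↔ u = S.source (σ l)
        rw [hs, e.injective.eq_iff]
      · exact Iff.rfl
      · exact Iff.rfl
    · rintro (v | k)
      · exact h.rank v
      · rfl

end Stage

/-- Extend a permutation of `Fin n` to `Fin (n + 1)` by fixing the last element. -/
def extendPerm {n : ℕ} (τ : Equiv.Perm (Fin n)) : Equiv.Perm (Fin (n + 1)) :=
  finSuccEquivLast.symm.permCongr τ.optionCongr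

@[simp] theorem extendPerm_castSucc {n : ℕ} (τ : Equiv.Perm (Fin n)) (k : Fin n) :
    extendPerm τ k.castSucc = (τ k).castSucc := by
  simp [extendPerm]

@[simp] theorem extendPerm_last {n : ℕ} (τ : Equiv.Perm (Fin n)) :
    extendPerm τ (Fin.last n) = Fin.last n := by
  simp [extendPerm]

theorem extendPerm_injective {n : ℕ} : Function.Injective (extendPerm (n := n)) := by
  intro σ τ h
  ext1 k
  have := congrArg (fun ρ => ρ k.castSucc) h
  simpa using this

theorem exists_extendPerm {n : ℕ} (ρ : Equiv.Perm (Fin (n + 1))) (h : ρ (Fin.last n) = Fin.last n) :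
    ∃ τ, ρ = extendPerm τ := by
  obtain ⟨τ, hτ⟩ := exists_optionCongr (finSuccEquivLast.permCongr ρ) (by simp [h])
  refine ⟨τ, ?_⟩
  rw [extendPerm, ← hτ]
  ext1 k
  simp

namespace Evolution

/-- In the next stage precisely the new nodes have rank n. Isomorphisms, which preserve ranks, thus
map the last event to the last event. -/
theorem rank_lt {n : ℕ} (h : Evolution n) : ∀ v : h.Node, h.stage.rank v < n := by
  induction h with
  | start =>
    rintro (_ | _)
    · exact Nat.zero_lt_two
    · exact Nat.one_lt_two
  | branch h _ ih =>
    rintro (_ | v)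
    · exact Nat.lt_succ_self _
    · exact (ih v).trans (Nat.lt_succ_self _)
  | reticulate h _ _ _ ih =>
    rintro (v | _)
    · exact (ih v).trans (Nat.lt_succ_self _)
    · exact Nat.lt_succ_self _

/-- The evolutions isomorphic to `h` together with the permutation of the external lineages. -/
def Isos {n : ℕ} (h : Evolution n) : Type :=
  {x : Evolution n × Equiv.Perm (Fin n) // ∃ e, h.stage.IsIso x.1.stage e x.2}

end Evolution

namespace Stage

variable {V W : Type} {n : ℕ}

theorem IsIso.branch {S : Stage V n} {T : Stage W n} {e : V ≃ W} {τ : Equiv.Perm (Fin n)}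
    (h : S.IsIso T e τ) (i : Fin n) :
    (S.branch i).IsIso (T.branch (τ i)) e.optionCongr (extendPerm τ) where
  edge := by
    rintro (_ | u) (_ | v)
    · exact Iff.rfl
    · exact Iff.rfl
    · change e u = T.source (τ i) ↔ u = S.source i
      rw [h.source, e.injective.eq_iff]
    · exact h.edge u v
  rank := by
    rintro (_ | v)
    · rfl
    · exact h.rank v
  source k := by
    induction k using Fin.lastCases with
    | last => simp [Stage.branch]
    | cast k =>
      simp only [Stage.branch, extendPerm_castSucc, Fin.snoc_castSucc, h.source,
        τ.injective.eq_iff]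
      split_ifs <;> rfl

theorem branch_source_swap (S : Stage V n) (i : Fin n) (k : Fin (n + 1)) :
    (S.branch i).source (Equiv.swap i.castSucc (Fin.last n) k) = (S.branch i).source k := by
  induction k using Fin.lastCases with
  | last => simp [Stage.branch]
  | cast k =>
    by_cases hk : k = i
    · subst hk; simp [Stage.branch]
    · rw [Equiv.swap_apply_of_ne_of_ne (by simpa using hk) (Fin.castSucc_ne_last k)]

/-- The two lineages below the new tree node are interchangeable: this is the second way to record a
branching event, and it shows up in the permutation. -/
theorem IsIso.branch_swap {S : Stage V n} {T : Stage W n} {e : V ≃ W} {τ : Equiv.Perm (Fin n)}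
    (h : S.IsIso T e τ) (i : Fin n) :
    (S.branch i).IsIso (T.branch (τ i)) e.optionCongr
      (Equiv.swap (τ i).castSucc (Fin.last n) * extendPerm τ) where
  edge := (h.branch i).edge
  rank := (h.branch i).rank
  source k := by
    rw [Equiv.Perm.mul_apply, branch_source_swap]
    exact (h.branch i).source k

theorem IsIso.reticulate {S : Stage V n} {T : Stage W n} {e : V ≃ W} {τ : Equiv.Perm (Fin n)}
    (h : S.IsIso T e τ) (i j : Fin n) :
    (S.reticulate i j).IsIso (T.reticulate (τ i) (τ j)) (e.sumCongr (Equiv.refl _))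
      (extendPerm τ) where
  edge := by
    rintro (u | _ | _ | _) (v | _ | _ | _)
    · exact h.edge u v
    · change e u = T.source (τ i) ↔ u = S.source i
      rw [h.source, e.injective.eq_iff]
    · change e u = T.source (τ j) ↔ u = S.source j
      rw [h.source, e.injective.eq_iff]
    all_goals exact Iff.rfl
  rank := by
    rintro (v | _)
    · exact h.rank v
    · rfl
  source k := by
    induction k using Fin.lastCases with
    | last => simp [Stage.reticulate]
    | cast k =>
      simp only [Stage.reticulate, extendPerm_castSucc, Fin.snoc_castSucc, h.source,
        τ.injective.eq_iff]
      split_ifs <;> rfl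

/-- The two parents of the new reticulation node are interchangeable. This time the second record of
the event shows up in the evolution, as `(j, i)` instead of `(i, j)`, while the permutation stays
the same. -/
theorem IsIso.reticulate_swap {S : Stage V n} {T : Stage W n} {e : V ≃ W} {τ : Equiv.Perm (Fin n)}
    (h : S.IsIso T e τ) (i j : Fin n) (hij : i ≠ j) :
    (S.reticulate i j).IsIso (T.reticulate (τ j) (τ i)) (e.sumCongr RetNode.swapEquiv)
      (extendPerm τ) where
  edge := by
    rintro (u | _ | _ | _) (v | _ | _ | _)
    · exact h.edge u v
    · change e u = T.source (τ i) ↔ u = S.source i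
      rw [h.source, e.injective.eq_iff]
    · change e u = T.source (τ j) ↔ u = S.source j
      rw [h.source, e.injective.eq_iff]
    all_goals exact Iff.rfl
  rank := by
    rintro (v | _)
    · exact h.rank v
    · rfl
  source k := by
    induction k using Fin.lastCases with
    | last => simp [Stage.reticulate, RetNode.swapEquiv, RetNode.swap]
    | cast k =>
      simp only [Stage.reticulate, extendPerm_castSucc, Fin.snoc_castSucc, h.source,
        τ.injective.eq_iff]
      split_ifs with h1 h2 h2
      · exact absurd (h2.symm.trans h1) hij
      all_goals rfl

end Stage
end RTCN

/-! ### Peeling the last event off an isomorphism; every network has 2^(n-1) evolutions -/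

namespace RTCN
namespace Stage

variable {V W : Type} {n : ℕ}

/-- By ranks the new node goes to the new node, and so its parent to its parent. The permutation
preserves the pair of lineages below the new node; it either fixes `Fin.last n` or does so after
composition with a transposition. -/
theorem IsIso.of_branch {S : Stage V n} {T : Stage W n} (hT : ∀ v, T.rank v < n)
    {i i' : Fin n} {E : Option V ≃ Option W} {ρ : Equiv.Perm (Fin (n + 1))}
    (h : (S.branch i).IsIso (T.branch i') E ρ) :
    ∃ e τ, S.IsIso T e τ ∧ i' = τ i ∧
      (ρ = extendPerm τ ∨ ρ = Equiv.swap (τ i).castSucc (Fin.last n) * extendPerm τ) := by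
  have hE : E none = none := by
    have := h.rank none
    rcases hw : E none with _ | w
    · rfl
    · rw [hw] at this
      exact absurd this (hT w).ne
  obtain ⟨e, rfl⟩ := exists_optionCongr E hE
  have hi : T.source i' = e (S.source i) := ((h.edge (some (S.source i)) none).2 rfl).symm
  have key : ∀ τ : Equiv.Perm (Fin n), τ i = i' →
      (∀ k, (T.branch i').source ((extendPerm τ) k) = e.optionCongr ((S.branch i).source k)) →
      S.IsIso T e τ := by
    intro τ hτ hs
    refine ⟨fun u v => h.edge (some u) (some v), fun v => h.rank (some v), fun k => ?_⟩
    by_cases hk : k = i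
    · rw [hk, hτ, hi]
    · have := hs k.castSucc
      have hk' : τ k ≠ i' := by rw [← hτ]; simpa using hk
      simp only [Stage.branch, extendPerm_castSucc, Fin.snoc_castSucc, hk, hk', if_false] at this
      exact Option.some_injective _ this
  have hlast : ∀ k : Fin (n + 1), (T.branch i').source k = none ↔ k = i'.castSucc ∨ k = Fin.last n := by
    intro k
    induction k using Fin.lastCases with
    | last => simp [Stage.branch]
    | cast k => simp [Stage.branch, Fin.castSucc_ne_last]
  have h1 := (hlast (ρ (Fin.last n))).1 (by rw [h.source]; simp [Stage.branch])
  have h2 := (hlast (ρ i.castSucc)).1 (by rw [h.source]; simp [Stage.branch])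
  by_cases hl : ρ (Fin.last n) = Fin.last n
  · obtain ⟨τ, rfl⟩ := exists_extendPerm ρ hl
    have hτ : τ i = i' := by
      simpa [Fin.castSucc_ne_last] using h2
    exact ⟨e, τ, key τ hτ h.source, hτ.symm, .inl rfl⟩
  · have h1 := h1.resolve_right hl
    have h2 : ρ i.castSucc = Fin.last n := h2.resolve_left fun h' =>
      (Fin.castSucc_ne_last i) (ρ.injective (h'.trans h1.symm))
    obtain ⟨τ, hτ⟩ := exists_extendPerm (Equiv.swap i'.castSucc (Fin.last n) * ρ)
      (by simp [h1])
    have hi' : τ i = i' := by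
      have := congrArg (fun p => p i.castSucc) hτ
      simpa [h2] using this.symm
    refine ⟨e, τ, key τ hi' fun k => ?_, hi'.symm, .inr ?_⟩
    · rw [← hτ, Equiv.Perm.mul_apply, branch_source_swap, h.source]
    · rw [hi', ← hτ, Equiv.swap_mul_self_mul]

theorem IsIso.symm {S : Stage V n} {T : Stage W n} {e : V ≃ W} {τ : Equiv.Perm (Fin n)}
    (h : S.IsIso T e τ) : T.IsIso S e.symm τ⁻¹ where
  edge u v := by rw [← h.edge]; simp
  rank v := by rw [← h.rank]; simp
  source k := by
    have := h.source (τ⁻¹ k)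
    rw [show τ (τ⁻¹ k) = k from τ.apply_symm_apply k] at this
    rw [this, e.symm_apply_apply]

/-- A branching event has one node of rank n, a reticulation event three. -/
theorem not_isIso_branch_reticulate {S : Stage V n} {T : Stage W n} (hS : ∀ v, S.rank v < n)
    {i i' j' : Fin n} {E : Option V ≃ W ⊕ RetNode} {ρ : Equiv.Perm (Fin (n + 1))}
    (h : (S.branch i).IsIso (T.reticulate i' j') E ρ) : False := by
  have : ∀ x : RetNode, E.symm (.inr x) = none := by
    intro x
    have := h.rank (E.symm (.inr x))
    rw [E.apply_symm_apply] at this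
    rcases hv : E.symm (.inr x) with _ | v
    · rfl
    · rw [hv] at this
      exact absurd this.symm (hS v).ne
  have := E.symm.injective ((this .left).trans (this .right).symm)
  simp at this

/-- By ranks the isomorphism splits into one of the old nodes and one of the three new nodes. The
latter fixes the reticulation node and may only exchange its parents. -/
theorem IsIso.of_reticulate {S : Stage V n} {T : Stage W n} (hS : ∀ v, S.rank v < n)
    (hT : ∀ v, T.rank v < n)
    {i j i' j' : Fin n} (hij : i ≠ j) (hij' : i' ≠ j')
    {E : V ⊕ RetNode ≃ W ⊕ RetNode} {ρ : Equiv.Perm (Fin (n + 1))}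
    (h : (S.reticulate i j).IsIso (T.reticulate i' j') E ρ) :
    ∃ e τ, S.IsIso T e τ ∧ ρ = extendPerm τ ∧ (i' = τ i ∧ j' = τ j ∨ i' = τ j ∧ j' = τ i) := by
  have hE : ∀ x, (E x).isLeft = x.isLeft := by
    rintro (v | x)
    · have := h.rank (.inl v)
      rcases hw : E (.inl v) with w | x
      · rfl
      · rw [hw] at this
        exact absurd this.symm (hS v).ne
    · have := h.rank (.inr x)
      rcases hw : E (.inr x) with w | x
      · rw [hw] at this
        exact absurd this (hT w).ne
      · rfl
  obtain ⟨e, g, rfl⟩ := exists_sumCongr E hE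
  -- The reticulation node is the only new node that is entered from a new node.
  have hy : g .hybrid = .hybrid := by
    have : (T.reticulate i' j').edge (.inr (g .left)) (.inr (g .hybrid)) :=
      (h.edge (.inr .left) (.inr .hybrid)).2 trivial
    rcases h1 : g .left <;> rcases h2 : g .hybrid <;> rw [h1, h2] at this <;>
      first | rfl | exact this.elim
  have hr : ∀ (k : Fin (n + 1)) (x : RetNode), (T.reticulate i' j').source k = .inr x ↔
      k = i'.castSucc ∧ x = .left ∨ k = j'.castSucc ∧ x = .right ∨ k = Fin.last n ∧ x = .hybrid := by
    intro k x
    induction k using Fin.lastCases with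
    | last => simp [Stage.reticulate, eq_comm]
    | cast k => simp [Stage.reticulate]; grind
  have hl : ρ (Fin.last n) = Fin.last n := by
    have : (T.reticulate i' j').source (ρ (Fin.last n)) = .inr .hybrid := by
      rw [h.source, ← hy]; simp [Stage.reticulate]
    simpa [hr] using this
  obtain ⟨τ, rfl⟩ := exists_extendPerm ρ hl
  have hi1 : (T.reticulate i' j').source (τ i).castSucc = .inr (g .left) := by
    rw [← extendPerm_castSucc, h.source]; simp [Stage.reticulate]
  have hj1 : (T.reticulate i' j').source (τ j).castSucc = .inr (g .right) := by
    rw [← extendPerm_castSucc, h.source]; simp [Stage.reticulate, hij.symm]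
  rw [hr] at hi1 hj1
  simp only [Fin.castSucc_inj, Fin.castSucc_ne_last, false_and, or_false] at hi1 hj1
  have hi2 : e (S.source i) = T.source (τ i) := by
    have : (T.reticulate i' j').edge (.inl (e (S.source i))) (.inr (g .left)) :=
      (h.edge (.inl (S.source i)) (.inr .left)).2 rfl
    rcases hi1 with ⟨h1, h2⟩ | ⟨h1, h2⟩ <;> rw [h2] at this <;> rw [h1] <;> exact this
  have hj2 : e (S.source j) = T.source (τ j) := by
    have : (T.reticulate i' j').edge (.inl (e (S.source j))) (.inr (g .right)) :=
      (h.edge (.inl (S.source j)) (.inr .right)).2 rfl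
    rcases hj1 with ⟨h1, h2⟩ | ⟨h1, h2⟩ <;> rw [h2] at this <;> rw [h1] <;> exact this
  have hor : i' = τ i ∧ j' = τ j ∨ i' = τ j ∧ j' = τ i := by
    have hgg : g .left ≠ g .right := by simp
    have : τ i ≠ τ j := by simpa using hij
    grind
  refine ⟨e, τ, ⟨fun u v => h.edge (.inl u) (.inl v), fun v => h.rank (.inl v), fun k => ?_⟩,
    rfl, hor⟩
  by_cases hki : k = i
  · rw [hki, hi2]
  by_cases hkj : k = j
  · rw [hkj, hj2]
  have := h.source k.castSucc
  have hi' : τ k ≠ τ i := by simpa using hki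
  have hj' : τ k ≠ τ j := by simpa using hkj
  rcases hor with ⟨rfl, rfl⟩ | ⟨rfl, rfl⟩ <;>
  · simp only [Stage.reticulate, extendPerm_castSucc, Fin.snoc_castSucc, hki, hkj, hi', hj',
      if_false] at this
    exact Sum.inl_injective this

end Stage

namespace Evolution

theorem exists_isIso_branch {n : ℕ} (h : Evolution n) (i : Fin n) (x : (h.branch i).Isos) :
    ∃ (y : h.Isos), x.1.1 = y.1.1.branch (y.1.2 i) ∧ (x.1.2 = extendPerm y.1.2 ∨
      x.1.2 = Equiv.swap (y.1.2 i).castSucc (Fin.last n) * extendPerm y.1.2) := by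
  obtain ⟨⟨H, ρ⟩, E, hE⟩ := x
  cases H with
  | start => exact absurd h.two_le (by norm_num)
  | branch h' i' =>
    obtain ⟨e, τ, hτ, rfl, hρ⟩ := Stage.IsIso.of_branch h'.rank_lt hE
    exact ⟨⟨(h', τ), e, hτ⟩, rfl, hρ⟩
  | reticulate h' i' j' hij' => exact (Stage.not_isIso_branch_reticulate h.rank_lt hE).elim

theorem exists_isIso_reticulate {n : ℕ} (h : Evolution n) (i j : Fin n) (hij : i ≠ j)
    (x : (h.reticulate i j hij).Isos) :
    ∃ (y : h.Isos), x.1.2 = extendPerm y.1.2 ∧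
      (x.1.1 = y.1.1.reticulate (y.1.2 i) (y.1.2 j) (by simpa using hij) ∨
        x.1.1 = y.1.1.reticulate (y.1.2 j) (y.1.2 i) (by simpa using hij.symm)) := by
  obtain ⟨⟨H, ρ⟩, E, hE⟩ := x
  cases H with
  | start => exact absurd h.two_le (by norm_num)
  | branch h' i' => exact (Stage.not_isIso_branch_reticulate h'.rank_lt hE.symm).elim
  | reticulate h' i' j' hij' =>
    obtain ⟨e, τ, hτ, rfl, hρ⟩ := Stage.IsIso.of_reticulate h.rank_lt h'.rank_lt hij hij' hE
    refine ⟨⟨(h', τ), e, hτ⟩, rfl, ?_⟩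
    rcases hρ with ⟨rfl, rfl⟩ | ⟨rfl, rfl⟩
    · exact .inl rfl
    · exact .inr rfl

theorem card_isos_branch {n : ℕ} (h : Evolution n) (i : Fin n) :
    Nat.card (h.branch i).Isos = 2 * Nat.card h.Isos := by
  let f : Bool × h.Isos → (h.branch i).Isos := fun y =>
    ⟨(y.2.1.1.branch (y.2.1.2 i), if y.1 then extendPerm y.2.1.2 else
      Equiv.swap (y.2.1.2 i).castSucc (Fin.last n) * extendPerm y.2.1.2), by
      obtain ⟨b, ⟨h', τ⟩, e, he⟩ := y
      cases b
      · exact ⟨_, he.branch_swap i⟩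
      · exact ⟨_, he.branch i⟩⟩
  have hf : f.Bijective := by
    constructor
    · rintro ⟨b, ⟨⟨h₁, τ₁⟩, e₁⟩⟩ ⟨c, ⟨⟨h₂, τ₂⟩, e₂⟩⟩ he
      replace he := congrArg Subtype.val he
      simp only [f, Prod.mk.injEq, branch.injEq] at he
      obtain ⟨⟨rfl, hτ⟩, he⟩ := he
      have hb : b = c := by
        have := congrArg (fun p => p (Fin.last n)) he
        cases b <;> cases c <;> simp [Fin.castSucc_ne_last, (Fin.castSucc_ne_last _).symm] at this ⊢
      subst hb
      rw [← hτ] at he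
      have : τ₁ = τ₂ := by
        apply extendPerm_injective
        cases b <;> simpa using he
      subst this
      rfl
    · intro x
      obtain ⟨y, h1, h2 | h2⟩ := exists_isIso_branch h i x
      · exact ⟨(true, y), Subtype.ext (Prod.ext h1.symm (by simp [f, h2]))⟩
      · exact ⟨(false, y), Subtype.ext (Prod.ext h1.symm (by simp [f, h2]))⟩
  rw [← Nat.card_eq_of_bijective f hf, Nat.card_prod]
  simp

theorem card_isos_reticulate {n : ℕ} (h : Evolution n) (i j : Fin n) (hij : i ≠ j) :
    Nat.card (h.reticulate i j hij).Isos = 2 * Nat.card h.Isos := by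
  let f : Bool × h.Isos → (h.reticulate i j hij).Isos := fun y =>
    ⟨(if y.1 then y.2.1.1.reticulate (y.2.1.2 i) (y.2.1.2 j) (by simpa using hij) else
      y.2.1.1.reticulate (y.2.1.2 j) (y.2.1.2 i) (by simpa using hij.symm), extendPerm y.2.1.2), by
      obtain ⟨b, ⟨h', τ⟩, e, he⟩ := y
      cases b
      · exact ⟨_, he.reticulate_swap i j hij⟩
      · exact ⟨_, he.reticulate i j⟩⟩
  have hf : f.Bijective := by
    constructor
    · rintro ⟨b, ⟨⟨h₁, τ₁⟩, e₁⟩⟩ ⟨c, ⟨⟨h₂, τ₂⟩, e₂⟩⟩ he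
      replace he := congrArg Subtype.val he
      simp only [f, Prod.mk.injEq] at he
      obtain ⟨he, hτ⟩ := he
      obtain rfl := extendPerm_injective hτ
      have h1 : τ₁ i ≠ τ₁ j := by simpa using hij
      cases b <;> cases c <;> simp [h1, h1.symm] at he ⊢ <;> simp [he]
    · intro x
      obtain ⟨y, h1, h2 | h2⟩ := exists_isIso_reticulate h i j hij x
      · exact ⟨(true, y), Subtype.ext (Prod.ext (by simp [f, h2]) h1.symm)⟩
      · exact ⟨(false, y), Subtype.ext (Prod.ext (by simp [f, h2]) h1.symm)⟩
  rw [← Nat.card_eq_of_bijective f hf, Nat.card_prod]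
  simp

theorem eq_start (h : Evolution 2) : h = start := by
  cases h with
  | start => rfl
  | branch h _ => exact absurd h.two_le (by norm_num)
  | reticulate h _ _ _ => exact absurd h.two_le (by norm_num)

theorem card_isos_start : Nat.card start.Isos = 2 := by
  let f : Equiv.Perm (Fin 2) → start.Isos := fun τ =>
    ⟨(start, τ), Equiv.refl _, fun _ _ => Iff.rfl, fun _ => rfl, fun _ => rfl⟩
  have hf : f.Bijective := by
    constructor
    · intro σ τ h
      exact congrArg (fun x => x.1.2) h
    · rintro ⟨⟨h, τ⟩, hτ⟩
      exact ⟨τ, Subtype.ext (Prod.ext (eq_start h).symm rfl)⟩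
  rw [← Nat.card_eq_of_bijective f hf, Nat.card_eq_fintype_card, Fintype.card_perm]
  simp

/-- Each of the n - 1 events, the initial one included, contributes a factor 2. The extra factor on
the left avoids the exponent n - 1. -/
theorem card_isos {n : ℕ} (h : Evolution n) : 2 * Nat.card h.Isos = 2 ^ n := by
  induction h with
  | start => rw [card_isos_start]; norm_num
  | branch h i ih => rw [card_isos_branch, pow_succ, ih]; ring
  | reticulate h i j hij ih => rw [card_isos_reticulate, pow_succ, ih]; ring

/-- Every network evolves in the same number of ways. -/
theorem card_network_iso {n : ℕ} (h : Evolution n) (σ : Equiv.Perm (Fin n)) :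
    2 * Nat.card {x : Evolution n × Equiv.Perm (Fin n) // (h.network σ).Iso (x.1.network x.2)} =
      2 ^ n := by
  rw [← h.card_isos]
  congr 1
  -- Right multiplication by `σ⁻¹` removes the dependence on the labelling.
  refine Nat.card_congr (Equiv.subtypeEquiv
    ((Equiv.refl _).prodCongr (Equiv.mulRight σ⁻¹)) fun x => ?_)
  exact Stage.toNetwork_iso_iff _ _ _ _

end Evolution
end RTCN

/-! ### Means over evolutions and means over networks -/

namespace RTCN

namespace Evolution

variable {n : ℕ} {E : Type*}

noncomputable instance : Fintype (Evolution n) := Fintype.ofFinite _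

/-- Attach a branching event to `i` if `i = j`, and a reticulation event to `i` and `j` otherwise. -/
def step (h : Evolution n) (i j : Fin n) : Evolution (n + 1) :=
  if hij : i = j then h.branch i else h.reticulate i j hij

theorem step_self (h : Evolution n) (i : Fin n) : h.step i i = h.branch i := dif_pos rfl

theorem step_of_ne (h : Evolution n) {i j : Fin n} (hij : i ≠ j) :
    h.step i j = h.reticulate i j hij := dif_neg hij

/-- Since `unfold` records a branching event as a diagonal pair, it inverts `step`; injectivity of
`step` follows. -/
theorem unfold_step (h : Evolution n) (i j : Fin n) : (h.step i j).unfold = some (h, i, j) := by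
  by_cases hij : i = j
  · subst hij; rw [step_self, unfold]
  · rw [step_of_ne h hij, unfold]

theorem step_bijective (hn : 2 ≤ n) :
    Function.Bijective fun x : Evolution n × Fin n × Fin n => x.1.step x.2.1 x.2.2 := by
  constructor
  · rintro ⟨h, i, j⟩ ⟨h', i', j'⟩ he
    simpa [unfold_step] using congrArg unfold he
  · intro H
    cases H with
    | start => norm_num at hn
    | branch h i => exact ⟨(h, i, i), step_self h i⟩
    | reticulate h i j hij => exact ⟨(h, i, j), step_of_ne h hij⟩

/-- The mean of a function on the set of evolutions. -/
noncomputable def mean [AddCommGroup E] [Module ℝ E] (F : Evolution n → E) : E :=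
  (Fintype.card (Evolution n) : ℝ)⁻¹ • ∑ h, F h

section

variable [AddCommGroup E] [Module ℝ E]

theorem mean_sub (F G : Evolution n → E) : mean (fun h => F h - G h) = mean F - mean G := by
  simp [mean, Finset.sum_sub_distrib, smul_sub]

theorem mean_add (F G : Evolution n → E) : mean (fun h => F h + G h) = mean F + mean G := by
  simp [mean, Finset.sum_add_distrib, smul_add]

theorem mean_const (hn : 2 ≤ n) (c : E) : mean (fun _ : Evolution n => c) = c := by
  obtain ⟨n, rfl⟩ := Nat.exists_eq_add_of_le' hn
  have := instNonempty n
  have : (Fintype.card (Evolution (n + 2)) : ℝ) ≠ 0 := by exact_mod_cast Fintype.card_ne_zero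
  rw [mean, Finset.sum_const, Finset.card_univ, ← Nat.cast_smul_eq_nsmul ℝ, smul_smul,
    inv_mul_cancel₀ this, one_smul]

/-- The Markov property: a uniform evolution with n + 1 lineages is a uniform evolution with n
lineages followed by an independent uniform pair. -/
theorem mean_succ (hn : 2 ≤ n) (F : Evolution (n + 1) → E) :
    mean F = mean fun h : Evolution n => ((n : ℝ) ^ 2)⁻¹ • ∑ i, ∑ j, F (h.step i j) := by
  have hb := step_bijective hn
  have h1 : Fintype.card (Evolution (n + 1)) = Fintype.card (Evolution n) * n ^ 2 := by
    rw [← Fintype.card_of_bijective hb]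
    simp [sq]
  have h2 : ∑ h, F h = ∑ h : Evolution n, ∑ i, ∑ j, F (h.step i j) := by
    rw [← hb.sum_comp F, Fintype.sum_prod_type]
    exact Finset.sum_congr rfl fun h _ => Fintype.sum_prod_type _
  rw [mean, mean, h1, h2, ← Finset.smul_sum, smul_smul]
  push_cast
  rw [mul_inv]

end

theorem mean_mul (F : Evolution n → ℝ) (c : ℝ) : mean (fun h => c * F h) = c * mean F := by
  simp only [mean, smul_eq_mul, ← Finset.mul_sum]
  ring

theorem mean_mul_complex (F : Evolution n → ℂ) (c : ℂ) :
    mean (fun h => c * F h) = c * mean F := by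
  simp only [mean, Complex.real_smul, ← Finset.mul_sum]
  ring

theorem mean_mono {F G : Evolution n → ℝ} (hFG : ∀ x, F x ≤ G x) : mean F ≤ mean G := by
  simp only [mean, smul_eq_mul]
  gcongr
  exact hFG _

theorem mean_nonneg {F : Evolution n → ℝ} (h : ∀ x, 0 ≤ F x) : 0 ≤ mean F := by
  simp only [mean, smul_eq_mul]
  have := Finset.sum_nonneg fun x (_ : x ∈ Finset.univ) => h x
  positivity

theorem norm_mean_le [NormedAddCommGroup E] [NormedSpace ℝ E] (F : Evolution n → E) :
    ‖mean F‖ ≤ mean fun h => ‖F h‖ := by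
  simp only [mean, smul_eq_mul, norm_smul, norm_inv, Real.norm_natCast]
  gcongr
  exact norm_sum_le _ _

theorem mean_two [AddCommGroup E] [Module ℝ E] (F : Evolution 2 → E) : mean F = F start := by
  have : F = fun _ => F start := funext fun h => by rw [eq_start h]
  rw [this, mean_const le_rfl]

end Evolution

namespace RankedTreeChildNetwork

variable {n : ℕ}

noncomputable instance : Fintype (RankedTreeChildNetwork n) := Fintype.ofFinite _

theorem card_fiber (N : RankedTreeChildNetwork n) :
    2 * Nat.card {x : Evolution n × Equiv.Perm (Fin n) //
      (Quotient.mk (evolutionSetoid n) x : RankedTreeChildNetwork n) = N} = 2 ^ n := by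
  obtain ⟨⟨h, σ⟩, rfl⟩ := Quotient.exists_rep N
  rw [← h.card_network_iso σ]
  congr 1
  refine Nat.card_congr (Equiv.subtypeEquivRight fun x => ?_)
  rw [eq_comm]
  exact Quotient.eq (r := evolutionSetoid n)

/-- The network in which an evolution with labelled ends results. -/
def ofEvolution (x : Evolution n × Equiv.Perm (Fin n)) : RankedTreeChildNetwork n :=
  Quotient.mk (evolutionSetoid n) x

/-- All fibres of `ofEvolution` have the same cardinality, by `card_fiber`. -/
theorem sum_ofEvolution {E : Type*} [AddCommMonoid E] (F : RankedTreeChildNetwork n → E) :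
    2 • ∑ x, F (ofEvolution x) = 2 ^ n • ∑ N, F N := by
  classical
  rw [← Finset.sum_fiberwise' Finset.univ ofEvolution F, Finset.smul_sum, Finset.smul_sum]
  refine Finset.sum_congr rfl fun N _ => ?_
  rw [Finset.sum_const, smul_smul, ← card_fiber N, Nat.card_eq_fintype_card, Fintype.card_subtype]
  rfl

/-- Means over networks are means over evolutions. -/
theorem integral_uniform {E : Type*} [NormedAddCommGroup E] [NormedSpace ℝ E] [CompleteSpace E]
    (F : RankedTreeChildNetwork n → E) (G : Evolution n → E)
    (h : ∀ x, F (ofEvolution x) = G x.1) :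
    ∫ N, F N ∂uniform n = Evolution.mean G := by
  have h1 := sum_ofEvolution F
  -- The constant function yields the relation between the two cardinalities, which normalises the
  -- sums.
  have h2 := sum_ofEvolution (fun _ : RankedTreeChildNetwork n => 1)
  simp only [h, Fintype.sum_prod_type, Finset.sum_const, Finset.card_univ, Fintype.card_perm,
    Fintype.card_fin, ← Finset.smul_sum, smul_smul] at h1
  simp only [Finset.sum_const, Finset.card_univ, Fintype.card_prod, Fintype.card_perm,
    Fintype.card_fin, smul_eq_mul, mul_one] at h2
  have h3 : ∫ N, F N ∂uniform n =
      (Fintype.card (RankedTreeChildNetwork n) : ℝ)⁻¹ • ∑ N, F N := by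
    rw [uniform, uniformOn, ProbabilityTheory.cond, integral_smul_measure, Measure.restrict_univ, integral_count]
    simp [Measure.count_univ, ENat.card_eq_coe_fintype_card]
  rw [h3, Evolution.mean]
  have h4 : (2 * n.factorial : ℝ) • ∑ x, G x = (2 ^ n : ℝ) • ∑ N, F N := by
    rw [← Nat.cast_smul_eq_nsmul ℝ, ← Nat.cast_smul_eq_nsmul ℝ] at h1
    exact_mod_cast h1
  have h5 : (2 * n.factorial : ℝ) * Fintype.card (Evolution n) =
      2 ^ n * Fintype.card (RankedTreeChildNetwork n) := by
    rw [mul_assoc, mul_comm (n.factorial : ℝ)]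
    exact_mod_cast h2
  have hf : (2 * n.factorial : ℝ) ≠ 0 := by positivity
  have h2n : (2 ^ n : ℝ) ≠ 0 := by positivity
  calc (Fintype.card (RankedTreeChildNetwork n) : ℝ)⁻¹ • ∑ N, F N
      = (2 ^ n * Fintype.card (RankedTreeChildNetwork n) : ℝ)⁻¹ • (2 ^ n : ℝ) • ∑ N, F N := by
        rw [smul_smul]; congr 1; field_simp
    _ = (Fintype.card (Evolution n) : ℝ)⁻¹ • ∑ x, G x := by
        rw [← h5, ← h4, smul_smul]; congr 1; field_simp

end RankedTreeChildNetwork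
end RTCN

namespace RTCN
namespace Stage

variable {V : Type} {n : ℕ}

/-! ### Patterns as tuples of external lineages -/

/-- Degree bounds in terms of lineages and edges. -/
structure Binary (S : Stage V n) : Prop where
  source_three : ∀ {a b c}, S.source a = S.source b → S.source a = S.source c →
    a = b ∨ a = c ∨ b = c
  source_edge : ∀ {a b w}, S.edge (S.source a) w → S.source a = S.source b → a = b
  edge_edge : ∀ {a w w'}, S.edge (S.source a) w → S.edge (S.source a) w' → w = w'
  parent_three : ∀ {u u' u'' w}, S.edge u w → S.edge u' w → S.edge u'' w →
    u = u' ∨ u = u'' ∨ u' = u''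
  hybrid_edge : ∀ {u u' a w}, S.edge u (S.source a) → S.edge u' (S.source a) → u ≠ u' →
    ¬ S.edge (S.source a) w
  hybrid_source : ∀ {u u' a b}, S.edge u (S.source a) → S.edge u' (S.source a) → u ≠ u' →
    S.source a = S.source b → a = b

theorem encard_le_two_elim {α : Type*} {s : Set α} (h : s.encard ≤ 2) {x y z : α} (hx : x ∈ s)
    (hy : y ∈ s) (hz : z ∈ s) : x = y ∨ x = z ∨ y = z := by
  by_contra! hne
  have h3 : ({x, y, z} : Set α).encard = 3 :=
    Set.encard_eq_three.2 ⟨x, y, z, hne.1, hne.2.1, hne.2.2, rfl⟩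
  have : ({x, y, z} : Set α) ⊆ s := by
    rintro w (rfl | rfl | rfl) <;> assumption
  have := h3 ▸ (Set.encard_le_encard this).trans h
  norm_num at this

/-- Children and external lineages of a node number at most two together, and just one if the node
has two parents. -/
theorem Good.binary {S : Stage V n} (h : S.Good) : S.Binary := by
  have ho : ∀ v, (S.out v).encard ≤ 2 := fun v => by
    rcases h.degrees v with h | h | h <;> rw [h.2] <;> norm_num
  have hp : ∀ v, (S.parents v).encard ≤ 2 := fun v => by
    rcases h.degrees v with h | h | h <;> rw [h.1] <;> norm_num
  have hh : ∀ {u u' v x y}, S.edge u v → S.edge u' v → u ≠ u' → x ∈ S.out v → y ∈ S.out v →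
      x = y := by
    intro u u' v x y hu hu' hne hx hy
    have h1 : 1 < (S.parents v).encard := Set.one_lt_encard_iff.2 ⟨u, u', hu, hu', hne⟩
    have h2 : (S.out v).encard ≤ 1 := by
      rcases h.degrees v with h | h | h
      · rw [h.1] at h1; norm_num at h1
      · rw [h.1] at h1; norm_num at h1
      · exact h.2.le
    exact Set.encard_le_one_iff.1 h2 x y hx hy
  refine ⟨fun {a b c} h1 h2 => ?_, fun {a b w} h1 h2 => ?_, fun {a w w'} h1 h2 => ?_,
    fun h1 h2 h3 => encard_le_two_elim (hp _) h1 h2 h3, fun {u u' a w} h1 h2 hne h3 => ?_,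
    fun {u u' a b} h1 h2 hne h3 => ?_⟩
  · simpa using encard_le_two_elim (ho (S.source a)) (x := .inr a) (y := .inr b) (z := .inr c)
      rfl h1 h2
  · simpa using encard_le_two_elim (ho (S.source a)) (x := .inr a) (y := .inr b) (z := .inl w)
      rfl h2 h1
  · simpa using encard_le_two_elim (ho (S.source a)) (x := .inr a) (y := .inl w) (z := .inl w')
      rfl h1 h2
  · simpa using hh (x := .inr a) (y := .inl w) h1 h2 hne rfl h3
  · simpa using hh (x := .inr a) (y := .inr b) h1 h2 hne rfl h3

open Classical in
/-- The pairs of external lineages that form a cherry. -/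
noncomputable def cherries (S : Stage V n) : Finset (Fin n × Fin n) :=
  {p | p.1 < p.2 ∧ S.source p.1 = S.source p.2}

/-- The external lineages `q 0`, …, `q 3` form the pattern of a cherry that has been hit by a
reticulation event: `q 0` belongs to the branching event, `q 1` and `q 2` to the parents of the
reticulation node, and `q 3` to the reticulation node. -/
def IsHit (S : Stage V n) (q : Fin 4 → Fin n) : Prop :=
  S.edge (S.source (q 0)) (S.source (q 1)) ∧ S.edge (S.source (q 1)) (S.source (q 3)) ∧
    S.edge (S.source (q 2)) (S.source (q 3)) ∧ S.source (q 1) ≠ S.source (q 2)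

/-- The external lineages `q 0`, …, `q 4` form the pattern of two cherries that have been hit by the
same reticulation event: `q 0` and `q 4` belong to the branching events. -/
def IsDouble (S : Stage V n) (q : Fin 5 → Fin n) : Prop :=
  S.edge (S.source (q 0)) (S.source (q 1)) ∧ S.edge (S.source (q 1)) (S.source (q 3)) ∧
    S.edge (S.source (q 2)) (S.source (q 3)) ∧ S.source (q 1) ≠ S.source (q 2) ∧
    S.edge (S.source (q 4)) (S.source (q 2)) ∧ S.source (q 0) ≠ S.source (q 4)

open Classical in
/-- The patterns `IsHit`. -/
noncomputable def hits (S : Stage V n) : Finset (Fin 4 → Fin n) := {q | S.IsHit q}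

open Classical in
/-- The patterns `IsDouble`. -/
noncomputable def doubles (S : Stage V n) : Finset (Fin 5 → Fin n) := {q | S.IsDouble q}

open Classical in
/-- The lineages other than `j` that form a cherry with `i`. -/
noncomputable def mates (S : Stage V n) (i j : Fin n) : Finset (Fin n) :=
  {k | k ≠ i ∧ k ≠ j ∧ S.source k = S.source i}

@[simp] theorem mem_cherries {S : Stage V n} {p : Fin n × Fin n} :
    p ∈ S.cherries ↔ p.1 < p.2 ∧ S.source p.1 = S.source p.2 := by simp [cherries]

@[simp] theorem mem_hits {S : Stage V n} {q : Fin 4 → Fin n} : q ∈ S.hits ↔ S.IsHit q := by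
  simp [hits]

@[simp] theorem mem_doubles {S : Stage V n} {q : Fin 5 → Fin n} :
    q ∈ S.doubles ↔ S.IsDouble q := by
  simp [doubles]

@[simp] theorem mem_mates {S : Stage V n} {i j k : Fin n} :
    k ∈ S.mates i j ↔ k ≠ i ∧ k ≠ j ∧ S.source k = S.source i := by
  simp [mates]

/-! ### The effect of a branching event -/

theorem branch_source_eq_some {S : Stage V n} {i : Fin n} {x : Fin (n + 1)} {v : V} :
    (S.branch i).source x = some v ↔ ∃ k, k ≠ i ∧ x = k.castSucc ∧ S.source k = v := by
  induction x using Fin.lastCases with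
  | last => simp [Stage.branch, (Fin.castSucc_ne_last _).symm]
  | cast k => simp [Stage.branch]

theorem branch_source_eq_none {S : Stage V n} {i : Fin n} {x : Fin (n + 1)} :
    (S.branch i).source x = none ↔ x = i.castSucc ∨ x = Fin.last n := by
  induction x using Fin.lastCases with
  | last => simp [Stage.branch]
  | cast k => simp [Stage.branch, Fin.castSucc_ne_last]

theorem branch_source_castSucc (S : Stage V n) {i k : Fin n} (h : k ≠ i) :
    (S.branch i).source k.castSucc = some (S.source k) :=
  branch_source_eq_some.2 ⟨k, h, rfl, rfl⟩

theorem branch_edge_some {S : Stage V n} {i : Fin n} {u v : V} :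
    (S.branch i).edge (some u) (some v) ↔ S.edge u v := Iff.rfl

theorem branch_edge_none {S : Stage V n} {i : Fin n} {u : V} :
    (S.branch i).edge (some u) none ↔ u = S.source i := Iff.rfl

theorem exists_of_branch_edge {S : Stage V n} {i : Fin n} {x : Fin (n + 1)} {w : Option V}
    (h : (S.branch i).edge ((S.branch i).source x) w) :
    ∃ k, k ≠ i ∧ x = k.castSucc ∧ (S.branch i).source x = some (S.source k) := by
  rcases hx : (S.branch i).source x with _ | v
  · rw [hx] at h; exact h.elim
  · obtain ⟨k, hk, rfl, rfl⟩ := branch_source_eq_some.1 hx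
    exact ⟨k, hk, rfl, rfl⟩

theorem castSucc_comp_injective {r : ℕ} :
    Function.Injective fun q : Fin r → Fin n => Fin.castSucc ∘ q :=
  (Fin.castSucc_injective n).comp_left

/-- The new node carries exactly the lineages i and n, which form a new cherry; an old cherry
survives unless it contains i. -/
theorem cherries_branch (S : Stage V n) (i : Fin n) :
    (S.branch i).cherries = insert (i.castSucc, Fin.last n)
      ((S.cherries.filter fun p => p.1 ≠ i ∧ p.2 ≠ i).image
        (Prod.map Fin.castSucc Fin.castSucc)) := by
  ext ⟨a, b⟩
  simp only [mem_cherries, Finset.mem_insert, Finset.mem_image, Finset.mem_filter, Prod.exists,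
    Prod.map, Prod.mk.injEq]
  constructor
  · rintro ⟨hab, hs⟩
    rcases hb : (S.branch i).source b with _ | v
    · rw [hb, branch_source_eq_none] at hs
      rw [branch_source_eq_none] at hb
      rcases hs with rfl | rfl
      · rcases hb with rfl | rfl
        · exact absurd hab (lt_irrefl _)
        · exact .inl ⟨rfl, rfl⟩
      · exact absurd (Fin.le_last b) hab.not_ge
    · rw [hb, branch_source_eq_some] at hs
      rw [branch_source_eq_some] at hb
      obtain ⟨k, hk, rfl, rfl⟩ := hb
      obtain ⟨l, hl, rfl, h⟩ := hs
      exact .inr ⟨l, k, ⟨⟨by simpa using hab, h⟩, hl, hk⟩, rfl, rfl⟩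
  · rintro (⟨rfl, rfl⟩ | ⟨a, b, ⟨⟨hab, hs⟩, ha, hb⟩, rfl, rfl⟩)
    · exact ⟨Fin.castSucc_lt_last i, by simp [Stage.branch]⟩
    · exact ⟨by simpa using hab,
        by rw [branch_source_castSucc S ha, branch_source_castSucc S hb, hs]⟩

theorem card_cherries_branch (S : Stage V n) (i : Fin n) :
    (S.branch i).cherries.card = (S.cherries.filter fun p => p.1 ≠ i ∧ p.2 ≠ i).card + 1 := by
  rw [cherries_branch, Finset.card_insert_of_notMem, Finset.card_image_of_injective]
  · exact (Fin.castSucc_injective n).prodMap (Fin.castSucc_injective n)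
  · simp [Fin.castSucc_ne_last]

/-- Nothing new arises: the new node has no children, so it could only be the reticulation node of a
pattern, but it has a single parent. -/
theorem hits_branch (S : Stage V n) (i : Fin n) :
    (S.branch i).hits = (S.hits.filter fun q => ∀ t, q t ≠ i).image (Fin.castSucc ∘ ·) := by
  ext q
  simp only [mem_hits, Finset.mem_image, Finset.mem_filter]
  constructor
  · intro h
    obtain ⟨h01, h13, h23, hne⟩ := h
    obtain ⟨k, hk, hk', hks⟩ := exists_of_branch_edge h01
    obtain ⟨a, ha, ha', has⟩ := exists_of_branch_edge h13
    obtain ⟨b, hb, hb', hbs⟩ := exists_of_branch_edge h23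
    rw [has] at h01 h13 hne
    rw [hbs] at h23 hne
    rw [hks] at h01
    -- If `q 3` hung at the new node, both parents in the pattern would be the node `S.source i`,
    -- contrary to `hne`.
    obtain ⟨c, hc, hc', hcs⟩ : ∃ c, c ≠ i ∧ q 3 = c.castSucc ∧
        (S.branch i).source (q 3) = some (S.source c) := by
      rcases hx : (S.branch i).source (q 3) with _ | v
      · rw [hx, branch_edge_none] at h13 h23
        rw [h13, h23] at hne
        exact absurd rfl hne
      · obtain ⟨c, hc, h, rfl⟩ := branch_source_eq_some.1 hx
        exact ⟨c, hc, h, rfl⟩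
    rw [hcs] at h13 h23
    refine ⟨![k, a, b, c], ⟨⟨h01, h13, h23, ?_⟩, ?_⟩, ?_⟩
    · exact fun h => hne (congrArg some h)
    · intro t; fin_cases t <;> assumption
    · funext t; fin_cases t <;> simp [hk', ha', hb', hc']
  · rintro ⟨q, ⟨⟨h01, h13, h23, hne⟩, hq⟩, rfl⟩
    simp only [IsHit, Function.comp, branch_source_castSucc S (hq _), branch_edge_some]
    exact ⟨h01, h13, h23, fun h => hne (Option.some_injective _ h)⟩

theorem card_hits_branch (S : Stage V n) (i : Fin n) :
    (S.branch i).hits.card = (S.hits.filter fun q => ∀ t, q t ≠ i).card := by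
  rw [hits_branch, Finset.card_image_of_injective _ castSucc_comp_injective]

theorem card_doubles_branch_le (S : Stage V n) (i : Fin n) :
    (S.branch i).doubles.card ≤ (S.doubles.filter fun q => ∀ t, q t ≠ i).card := by
  refine (Finset.card_le_card (t := (S.doubles.filter fun q => ∀ t, q t ≠ i).image
    (Fin.castSucc ∘ ·)) fun q => ?_).trans Finset.card_image_le
  simp only [mem_doubles, Finset.mem_image, Finset.mem_filter]
  rintro ⟨h01, h13, h23, hne, h42, hne'⟩
  obtain ⟨k, hk, hk', hks⟩ := exists_of_branch_edge h01
  obtain ⟨a, ha, ha', has⟩ := exists_of_branch_edge h13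
  obtain ⟨b, hb, hb', hbs⟩ := exists_of_branch_edge h23
  obtain ⟨l, hl, hl', hls⟩ := exists_of_branch_edge h42
  rw [has] at h01 h13 hne
  rw [hbs] at h23 hne h42
  rw [hks] at h01 hne'
  rw [hls] at h42 hne'
  obtain ⟨c, hc, hc', hcs⟩ : ∃ c, c ≠ i ∧ q 3 = c.castSucc ∧
      (S.branch i).source (q 3) = some (S.source c) := by
    rcases hx : (S.branch i).source (q 3) with _ | v
    · rw [hx, branch_edge_none] at h13 h23
      rw [h13, h23] at hne
      exact absurd rfl hne
    · obtain ⟨c, hc, h, rfl⟩ := branch_source_eq_some.1 hx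
      exact ⟨c, hc, h, rfl⟩
  rw [hcs] at h13 h23
  refine ⟨![k, a, b, c, l], ⟨⟨h01, h13, h23, ?_, h42, ?_⟩, ?_⟩, ?_⟩
  · exact fun h => hne (congrArg some h)
  · exact fun h => hne' (congrArg some h)
  · intro t; fin_cases t <;> assumption
  · funext t; fin_cases t <;> simp [hk', ha', hb', hc', hl']

end Stage
end RTCN

namespace RTCN
namespace Stage

variable {V : Type} {n : ℕ}

/-! ### The effect of a reticulation event -/

theorem reticulate_source_castSucc (S : Stage V n) {i j k : Fin n} (hi : k ≠ i) (hj : k ≠ j) :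
    (S.reticulate i j).source k.castSucc = .inl (S.source k) := by
  simp [Stage.reticulate, hi, hj]

theorem reticulate_source_left (S : Stage V n) (i j : Fin n) :
    (S.reticulate i j).source i.castSucc = .inr .left := by
  simp [Stage.reticulate]

theorem reticulate_source_right (S : Stage V n) {i j : Fin n} (hij : i ≠ j) :
    (S.reticulate i j).source j.castSucc = .inr .right := by
  simp [Stage.reticulate, hij.symm]

theorem reticulate_source_last (S : Stage V n) (i j : Fin n) :
    (S.reticulate i j).source (Fin.last n) = .inr .hybrid := by
  simp [Stage.reticulate]

theorem reticulate_source_cases (S : Stage V n) {i j : Fin n} (hij : i ≠ j) (x : Fin (n + 1)) :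
    (∃ k, k ≠ i ∧ k ≠ j ∧ x = k.castSucc ∧ (S.reticulate i j).source x = .inl (S.source k)) ∨
    (x = i.castSucc ∧ (S.reticulate i j).source x = .inr .left) ∨
    (x = j.castSucc ∧ (S.reticulate i j).source x = .inr .right) ∨
    (x = Fin.last n ∧ (S.reticulate i j).source x = .inr .hybrid) := by
  induction x using Fin.lastCases with
  | last => exact .inr (.inr (.inr ⟨rfl, reticulate_source_last S i j⟩))
  | cast k =>
    by_cases hi : k = i
    · subst hi; exact .inr (.inl ⟨rfl, reticulate_source_left S k j⟩)
    by_cases hj : k = j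
    · subst hj; exact .inr (.inr (.inl ⟨rfl, reticulate_source_right S hij⟩))
    exact .inl ⟨k, hi, hj, rfl, reticulate_source_castSucc S hi hj⟩

section

variable {S : Stage V n} {i j : Fin n}

theorem reticulate_edge_inl {u v : V} :
    (S.reticulate i j).edge (.inl u) (.inl v) ↔ S.edge u v := Iff.rfl

theorem reticulate_edge_left {u : V} :
    (S.reticulate i j).edge (.inl u) (.inr .left) ↔ u = S.source i := Iff.rfl

theorem reticulate_edge_right {u : V} :
    (S.reticulate i j).edge (.inl u) (.inr .right) ↔ u = S.source j := Iff.rfl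

theorem not_reticulate_edge_inl_hybrid {u : V} :
    ¬ (S.reticulate i j).edge (.inl u) (.inr .hybrid) := id

theorem not_reticulate_edge_inr_inl {x : RetNode} {v : V} :
    ¬ (S.reticulate i j).edge (.inr x) (.inl v) := by cases x <;> exact id

theorem not_reticulate_edge_hybrid {w : V ⊕ RetNode} :
    ¬ (S.reticulate i j).edge (.inr .hybrid) w := by rcases w with _ | _ | _ <;> exact id

theorem not_reticulate_edge_inr_left {x : RetNode} :
    ¬ (S.reticulate i j).edge (.inr x) (.inr .left) := by cases x <;> exact id

theorem not_reticulate_edge_inr_right {x : RetNode} :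
    ¬ (S.reticulate i j).edge (.inr x) (.inr .right) := by cases x <;> exact id

end

/-- Each of the three new nodes has only one external lineage, so no cherry is created. -/
theorem cherries_reticulate (S : Stage V n) {i j : Fin n} (hij : i ≠ j) :
    (S.reticulate i j).cherries =
      (S.cherries.filter fun p => (p.1 ≠ i ∧ p.1 ≠ j) ∧ p.2 ≠ i ∧ p.2 ≠ j).image
        (Prod.map Fin.castSucc Fin.castSucc) := by
  ext ⟨a, b⟩
  simp only [mem_cherries, Finset.mem_image, Finset.mem_filter, Prod.exists, Prod.map,
    Prod.mk.injEq]
  constructor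
  · rintro ⟨hab, hs⟩
    rcases reticulate_source_cases S hij a with ⟨k, hki, hkj, rfl, hk⟩ | ⟨rfl, hk⟩ | ⟨rfl, hk⟩ |
        ⟨rfl, hk⟩ <;>
      rcases reticulate_source_cases S hij b with ⟨l, hli, hlj, rfl, hl⟩ | ⟨rfl, hl⟩ | ⟨rfl, hl⟩ |
        ⟨rfl, hl⟩ <;> rw [hk] at hs <;> try rw [hl] at hs
    · exact ⟨k, l, ⟨⟨by simpa using hab, Sum.inl_injective hs⟩, ⟨hki, hkj⟩, hli, hlj⟩, rfl, rfl⟩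
    all_goals first | exact absurd hab (lt_irrefl _) | cases hs
  · rintro ⟨a, b, ⟨⟨hab, hs⟩, ⟨hai, haj⟩, hbi, hbj⟩, rfl, rfl⟩
    exact ⟨by simpa using hab, by
      rw [reticulate_source_castSucc S hai haj, reticulate_source_castSucc S hbi hbj, hs]⟩

theorem card_cherries_reticulate (S : Stage V n) {i j : Fin n} (hij : i ≠ j) :
    (S.reticulate i j).cherries.card =
      (S.cherries.filter fun p => (p.1 ≠ i ∧ p.1 ≠ j) ∧ p.2 ≠ i ∧ p.2 ≠ j).card := by
  rw [cherries_reticulate S hij, Finset.card_image_of_injective]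
  exact (Fin.castSucc_injective n).prodMap (Fin.castSucc_injective n)

/-- No edge leads from a new node to an old one, and the new reticulation node has only new parents.
A pattern is therefore either entirely old or has the new event as its reticulation event; in the
latter case the branching node carried i or j, and its remaining external lineage is a mate of it.
The two orders of the parents give two cases. -/
theorem isHit_reticulate_iff (S : Stage V n) {i j : Fin n} (hij : i ≠ j)
    (q : Fin 4 → Fin (n + 1)) : (S.reticulate i j).IsHit q ↔
      (∃ q', S.IsHit q' ∧ (∀ t, q' t ≠ i ∧ q' t ≠ j) ∧ Fin.castSucc ∘ q' = q) ∨
      (∃ k ∈ S.mates i j, ![k.castSucc, i.castSucc, j.castSucc, Fin.last n] = q) ∨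
      (∃ k ∈ S.mates j i, ![k.castSucc, j.castSucc, i.castSucc, Fin.last n] = q) := by
  constructor
  · rintro ⟨h01, h13, h23, hne⟩
    have h0 := reticulate_source_cases S hij (q 0)
    have h1 := reticulate_source_cases S hij (q 1)
    have h2 := reticulate_source_cases S hij (q 2)
    have h3 := reticulate_source_cases S hij (q 3)
    rcases h0 with ⟨k, hki, hkj, h0, e0⟩ | ⟨h0, e0⟩ | ⟨h0, e0⟩ | ⟨h0, e0⟩
    · rw [e0] at h01
      rcases h1 with ⟨a, hai, haj, h1, e1⟩ | ⟨h1, e1⟩ | ⟨h1, e1⟩ | ⟨h1, e1⟩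
      · rw [e1] at h01 h13 hne
        rcases h2 with ⟨b, hbi, hbj, h2, e2⟩ | ⟨h2, e2⟩ | ⟨h2, e2⟩ | ⟨h2, e2⟩
        · rw [e2] at h23 hne
          rcases h3 with ⟨c, hci, hcj, h3, e3⟩ | ⟨h3, e3⟩ | ⟨h3, e3⟩ | ⟨h3, e3⟩
          · rw [e3] at h13 h23
            refine .inl ⟨![k, a, b, c], ⟨h01, h13, h23, fun h => hne (congrArg _ h)⟩, ?_, ?_⟩
            · intro t; fin_cases t <;> constructor <;> assumption
            · funext t; fin_cases t <;> simp [h0, h1, h2, h3]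
          · rw [e3, reticulate_edge_left] at h13 h23
            exact absurd (h13.trans h23.symm) (fun h => hne (congrArg _ h))
          · rw [e3, reticulate_edge_right] at h13 h23
            exact absurd (h13.trans h23.symm) (fun h => hne (congrArg _ h))
          · rw [e3] at h13
            exact (not_reticulate_edge_inl_hybrid h13).elim
        all_goals
          rw [e2] at h23
          rcases h3 with ⟨c, hci, hcj, h3, e3⟩ | ⟨h3, e3⟩ | ⟨h3, e3⟩ | ⟨h3, e3⟩ <;>
            rw [e3] at h13 h23
          · exact (not_reticulate_edge_inr_inl h23).elim
          · exact (not_reticulate_edge_inr_left h23).elim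
          · exact (not_reticulate_edge_inr_right h23).elim
          · exact (not_reticulate_edge_inl_hybrid h13).elim
      · rw [e1] at h01 h13 hne
        rcases h3 with ⟨c, hci, hcj, h3, e3⟩ | ⟨h3, e3⟩ | ⟨h3, e3⟩ | ⟨h3, e3⟩ <;>
          rw [e3] at h13 h23
        · exact (not_reticulate_edge_inr_inl h13).elim
        · exact (not_reticulate_edge_inr_left h13).elim
        · exact (not_reticulate_edge_inr_right h13).elim
        · rcases h2 with ⟨b, hbi, hbj, h2, e2⟩ | ⟨h2, e2⟩ | ⟨h2, e2⟩ | ⟨h2, e2⟩ <;>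
            rw [e2] at h23 hne
          · exact (not_reticulate_edge_inl_hybrid h23).elim
          · exact absurd rfl hne
          · refine .inr (.inl ⟨k, mem_mates.2 ⟨hki, hkj, h01⟩, ?_⟩)
            funext t; fin_cases t <;> simp [h0, h1, h2, h3]
          · exact (not_reticulate_edge_hybrid h23).elim
      · rw [e1] at h01 h13 hne
        rcases h3 with ⟨c, hci, hcj, h3, e3⟩ | ⟨h3, e3⟩ | ⟨h3, e3⟩ | ⟨h3, e3⟩ <;>
          rw [e3] at h13 h23
        · exact (not_reticulate_edge_inr_inl h13).elim
        · exact (not_reticulate_edge_inr_left h13).elim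
        · exact (not_reticulate_edge_inr_right h13).elim
        · rcases h2 with ⟨b, hbi, hbj, h2, e2⟩ | ⟨h2, e2⟩ | ⟨h2, e2⟩ | ⟨h2, e2⟩ <;>
            rw [e2] at h23 hne
          · exact (not_reticulate_edge_inl_hybrid h23).elim
          · refine .inr (.inr ⟨k, mem_mates.2 ⟨hkj, hki, h01⟩, ?_⟩)
            funext t; fin_cases t <;> simp [h0, h1, h2, h3]
          · exact absurd rfl hne
          · exact (not_reticulate_edge_hybrid h23).elim
      · rw [e1] at h13
        exact (not_reticulate_edge_hybrid h13).elim
    all_goals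
      rw [e0] at h01
      rcases h1 with ⟨c, hci, hcj, h1, e1⟩ | ⟨h1, e1⟩ | ⟨h1, e1⟩ | ⟨h1, e1⟩ <;>
        rw [e1] at h01 h13
      · exact (not_reticulate_edge_inr_inl h01).elim
      · exact (not_reticulate_edge_inr_left h01).elim
      · exact (not_reticulate_edge_inr_right h01).elim
      · exact (not_reticulate_edge_hybrid h13).elim
  · rintro (⟨q, ⟨h01, h13, h23, hne⟩, hq, rfl⟩ | ⟨k, hk, rfl⟩ | ⟨k, hk, rfl⟩)
    · simp only [IsHit, Function.comp, reticulate_source_castSucc S (hq _).1 (hq _).2,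
        reticulate_edge_inl]
      exact ⟨h01, h13, h23, fun h => hne (Sum.inl_injective h)⟩
    · obtain ⟨hki, hkj, hs⟩ := mem_mates.1 hk
      refine ⟨?_, ?_, ?_, ?_⟩
      · change (S.reticulate i j).edge ((S.reticulate i j).source k.castSucc)
          ((S.reticulate i j).source i.castSucc)
        rw [reticulate_source_castSucc S hki hkj, reticulate_source_left, reticulate_edge_left, hs]
      · change (S.reticulate i j).edge ((S.reticulate i j).source i.castSucc)
          ((S.reticulate i j).source (Fin.last n))
        rw [reticulate_source_last, reticulate_source_left]; trivial
      · change (S.reticulate i j).edge ((S.reticulate i j).source j.castSucc)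
          ((S.reticulate i j).source (Fin.last n))
        rw [reticulate_source_last, reticulate_source_right S hij]; trivial
      · change (S.reticulate i j).source i.castSucc ≠ (S.reticulate i j).source j.castSucc
        rw [reticulate_source_left, reticulate_source_right S hij]; simp
    · obtain ⟨hkj, hki, hs⟩ := mem_mates.1 hk
      refine ⟨?_, ?_, ?_, ?_⟩
      · change (S.reticulate i j).edge ((S.reticulate i j).source k.castSucc)
          ((S.reticulate i j).source j.castSucc)
        rw [reticulate_source_castSucc S hki hkj, reticulate_source_right S hij,
          reticulate_edge_right, hs]
      · change (S.reticulate i j).edge ((S.reticulate i j).source j.castSucc)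
          ((S.reticulate i j).source (Fin.last n))
        rw [reticulate_source_last, reticulate_source_right S hij]; trivial
      · change (S.reticulate i j).edge ((S.reticulate i j).source i.castSucc)
          ((S.reticulate i j).source (Fin.last n))
        rw [reticulate_source_last, reticulate_source_left]; trivial
      · change (S.reticulate i j).source j.castSucc ≠ (S.reticulate i j).source i.castSucc
        rw [reticulate_source_left, reticulate_source_right S hij]; simp

theorem card_hits_reticulate (S : Stage V n) {i j : Fin n} (hij : i ≠ j) :
    (S.reticulate i j).hits.card = (S.hits.filter fun q => ∀ t, q t ≠ i ∧ q t ≠ j).card +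
      ((S.mates i j).card + (S.mates j i).card) := by
  have h : (S.reticulate i j).hits =
      (S.hits.filter fun q => ∀ t, q t ≠ i ∧ q t ≠ j).image (Fin.castSucc ∘ ·) ∪
      ((S.mates i j).image (fun k => ![k.castSucc, i.castSucc, j.castSucc, Fin.last n]) ∪
      (S.mates j i).image (fun k => ![k.castSucc, j.castSucc, i.castSucc, Fin.last n])) := by
    ext q
    simp only [mem_hits, isHit_reticulate_iff S hij, Finset.mem_union, Finset.mem_image,
      Finset.mem_filter, and_assoc]
  have hinj : ∀ a b : Fin n, Function.Injective fun k : Fin n =>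
      ![k.castSucc, a.castSucc, b.castSucc, Fin.last n] := fun a b k l hkl => by
    simpa using congrFun hkl 0
  -- Coordinate 3 separates old from new patterns, and coordinate 1 the two kinds of new ones.
  rw [h, Finset.card_union_of_disjoint, Finset.card_union_of_disjoint,
    Finset.card_image_of_injective _ castSucc_comp_injective,
    Finset.card_image_of_injective _ (hinj _ _), Finset.card_image_of_injective _ (hinj _ _)]
  · rw [Finset.disjoint_left]
    simp only [Finset.mem_image]
    rintro _ ⟨k, -, rfl⟩ ⟨l, -, h⟩
    have := congrFun h 1
    simp [hij.symm] at this
  · rw [Finset.disjoint_left]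
    simp only [Finset.mem_image, Finset.mem_union]
    rintro _ ⟨q, -, rfl⟩ (⟨l, -, h⟩ | ⟨l, -, h⟩)
    all_goals
      have := congrFun h 3
      simp [(Fin.castSucc_ne_last _).symm] at this

theorem IsDouble.isHit {S : Stage V n} {q : Fin 5 → Fin n} (h : S.IsDouble q) :
    S.IsHit ![q 0, q 1, q 2, q 3] := ⟨h.1, h.2.1, h.2.2.1, h.2.2.2.1⟩

theorem IsDouble.isHit' {S : Stage V n} {q : Fin 5 → Fin n} (h : S.IsDouble q) :
    S.IsHit ![q 4, q 2, q 1, q 3] := ⟨h.2.2.2.2.1, h.2.2.1, h.2.1, h.2.2.2.1.symm⟩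

/-- A double pattern consists of two patterns `IsHit` with the same reticulation event, so the
classification of those applies twice. Either both are old, or both are new with one on each side,
which requires a mate of i and a mate of j. The factor 2 counts the two orders of the branching
events. -/
theorem card_doubles_reticulate_le (S : Stage V n) {i j : Fin n} (hij : i ≠ j) :
    (S.reticulate i j).doubles.card ≤ (S.doubles.filter fun q => ∀ t, q t ≠ i ∧ q t ≠ j).card +
      2 * ((S.mates i j).card * (S.mates j i).card) := by
  classical
  let A := (S.doubles.filter fun q => ∀ t, q t ≠ i ∧ q t ≠ j).image (Fin.castSucc ∘ ·)
  let B := (S.mates i j ×ˢ S.mates j i).image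
    (fun p => ![p.1.castSucc, i.castSucc, j.castSucc, Fin.last n, p.2.castSucc])
  let C := (S.mates i j ×ˢ S.mates j i).image
    (fun p => ![p.2.castSucc, j.castSucc, i.castSucc, Fin.last n, p.1.castSucc])
  have hsub : (S.reticulate i j).doubles ⊆ A ∪ (B ∪ C) := by
    intro q hq
    rw [mem_doubles] at hq
    have h1 := (isHit_reticulate_iff S hij _).1 hq.isHit
    have h2 := (isHit_reticulate_iff S hij _).1 hq.isHit'
    have hne := hq.2.2.2.2.2
    simp only [A, B, C, Finset.mem_union, Finset.mem_image, Finset.mem_filter, mem_doubles,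
      Finset.mem_product, Prod.exists]
    rcases h1 with ⟨q₁, h₁, hq₁, e₁⟩ | ⟨k, hk, e₁⟩ | ⟨k, hk, e₁⟩ <;>
      rcases h2 with ⟨q₂, h₂, hq₂, e₂⟩ | ⟨l, hl, e₂⟩ | ⟨l, hl, e₂⟩
    all_goals
      have a0 := congrFun e₁ 0
      have a1 := congrFun e₁ 1
      have a2 := congrFun e₁ 2
      have a3 := congrFun e₁ 3
      have b0 := congrFun e₂ 0
      have b1 := congrFun e₂ 1
      have b2 := congrFun e₂ 2
      have b3 := congrFun e₂ 3
      simp at a0 a1 a2 a3 b0 b1 b2 b3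
    · left
      have c1 : q₂ 1 = q₁ 2 := Fin.castSucc_injective n (b1.trans a2.symm)
      refine ⟨![q₁ 0, q₁ 1, q₁ 2, q₁ 3, q₂ 0], ⟨⟨h₁.1, h₁.2.1, h₁.2.2.1, h₁.2.2.2, ?_, ?_⟩, ?_⟩, ?_⟩
      · have := h₂.1
        rwa [c1] at this
      · rw [← a0, ← b0, reticulate_source_castSucc S (hq₁ 0).1 (hq₁ 0).2,
          reticulate_source_castSucc S (hq₂ 0).1 (hq₂ 0).2] at hne
        exact fun h => hne (congrArg _ h)
      · intro t; fin_cases t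
        exacts [hq₁ 0, hq₁ 1, hq₁ 2, hq₁ 3, hq₂ 0]
      · funext t; fin_cases t <;> simp [a0, a1, a2, a3, b0]
    · exact absurd (a3.trans b3.symm) (Fin.castSucc_ne_last _)
    · exact absurd (a3.trans b3.symm) (Fin.castSucc_ne_last _)
    · exact absurd (b3.trans a3.symm) (Fin.castSucc_ne_last _)
    · rw [← a1] at b2
      exact absurd (Fin.castSucc_injective n b2) hij.symm
    · refine .inr (.inl ⟨k, l, ⟨hk, hl⟩, ?_⟩)
      funext t; fin_cases t <;> simp [a0, a1, a2, a3, b0]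
    · exact absurd (b3.trans a3.symm) (Fin.castSucc_ne_last _)
    · refine .inr (.inr ⟨l, k, ⟨hl, hk⟩, ?_⟩)
      funext t; fin_cases t <;> simp [a0, a1, a2, a3, b0]
    · rw [← a1] at b2
      exact absurd (Fin.castSucc_injective n b2) hij
  refine (Finset.card_le_card hsub).trans ((Finset.card_union_le _ _).trans ?_)
  have hA : A.card ≤ _ := Finset.card_image_le
  have hB : B.card ≤ _ := Finset.card_image_le
  have hC : C.card ≤ _ := Finset.card_image_le
  rw [Finset.card_product] at hB hC
  have := Finset.card_union_le B C
  omega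

end Stage
end RTCN

namespace RTCN
namespace Stage

variable {V : Type} {n : ℕ}

/-! ### Lineages in patterns -/

open Classical in
/-- The lineages that belong to a cherry. -/
noncomputable def cherryLineages (S : Stage V n) : Finset (Fin n) :=
  {i | ∃ k, k ≠ i ∧ S.source k = S.source i}

open Classical in
/-- The lineages that belong to a pattern `IsHit`. -/
noncomputable def hitLineages (S : Stage V n) : Finset (Fin n) :=
  {i | ∃ q, S.IsHit q ∧ ∃ t, q t = i}

theorem mem_cherryLineages {S : Stage V n} {i : Fin n} :
    i ∈ S.cherryLineages ↔ ∃ k, k ≠ i ∧ S.source k = S.source i := by simp [cherryLineages]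

theorem mem_hitLineages {S : Stage V n} {i : Fin n} :
    i ∈ S.hitLineages ↔ ∃ q, S.IsHit q ∧ ∃ t, q t = i := by simp [hitLineages]

/-- A node has at most two external lineages, and the pairs in `cherries` are ordered. -/
theorem Binary.cherry_unique {S : Stage V n} (hS : S.Binary) {p p' : Fin n × Fin n}
    (hp : p ∈ S.cherries) (hp' : p' ∈ S.cherries) {i : Fin n} (hi : p.1 = i ∨ p.2 = i)
    (hi' : p'.1 = i ∨ p'.2 = i) : p = p' := by
  obtain ⟨a, b⟩ := p
  obtain ⟨a', b'⟩ := p'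
  rw [mem_cherries] at hp hp'
  obtain ⟨h1, h2⟩ := hp
  obtain ⟨h3, h4⟩ := hp'
  simp only at h1 h2 h3 h4 hi hi'
  have e1 := @Binary.source_three _ _ _ hS a b a'
  have e2 := @Binary.source_three _ _ _ hS a b b'
  rcases hi with rfl | rfl <;> rcases hi' with rfl | rfl <;> grind

theorem exists_cherry_iff {S : Stage V n} {i : Fin n} :
    (∃ p ∈ S.cherries, p.1 = i ∨ p.2 = i) ↔ i ∈ S.cherryLineages := by
  rw [mem_cherryLineages]
  constructor
  · rintro ⟨p, hp, rfl | rfl⟩ <;> rw [mem_cherries] at hp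
    · exact ⟨p.2, hp.1.ne', hp.2.symm⟩
    · exact ⟨p.1, hp.1.ne, hp.2⟩
  · rintro ⟨k, hk, hs⟩
    rcases lt_or_gt_of_ne hk with h | h
    · exact ⟨(k, i), mem_cherries.2 ⟨h, hs⟩, .inr rfl⟩
    · exact ⟨(i, k), mem_cherries.2 ⟨h, hs.symm⟩, .inl rfl⟩

theorem Binary.card_cherryLineages {S : Stage V n} (hS : S.Binary) :
    S.cherryLineages.card = 2 * S.cherries.card := by
  have h : S.cherryLineages = S.cherries.image Prod.fst ∪ S.cherries.image Prod.snd := by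
    ext i
    rw [← exists_cherry_iff]
    simp only [Finset.mem_union, Finset.mem_image]
    grind
  rw [h, Finset.card_union_of_disjoint, Finset.card_image_of_injOn, Finset.card_image_of_injOn]
  · ring
  · exact fun p hp p' hp' he => hS.cherry_unique hp hp' (.inr he) (.inr rfl)
  · exact fun p hp p' hp' he => hS.cherry_unique hp hp' (.inl he) (.inl rfl)
  · rw [Finset.disjoint_left]
    simp only [Finset.mem_image]
    rintro _ ⟨p, hp, rfl⟩ ⟨p', hp', h⟩
    obtain rfl := hS.cherry_unique hp hp' (.inl rfl) (.inr h)
    exact (mem_cherries.1 hp).1.ne' h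

/-- Each node of the pattern has exactly one external lineage: three of them also have a child, and
the fourth is a reticulation node. -/
theorem Binary.notMem_cherryLineages_of_isHit {S : Stage V n} (hS : S.Binary)
    {q : Fin 4 → Fin n} (hq : S.IsHit q) (t : Fin 4) : q t ∉ S.cherryLineages := by
  rw [mem_cherryLineages]
  rintro ⟨k, hk, hs⟩
  obtain ⟨h01, h13, h23, hne⟩ := hq
  fin_cases t
  · exact hk (hS.source_edge h01 hs.symm).symm
  · exact hk (hS.source_edge h13 hs.symm).symm
  · exact hk (hS.source_edge h23 hs.symm).symm
  · exact hk (hS.hybrid_source h13 h23 hne hs.symm).symm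

theorem Binary.disjoint_lineages {S : Stage V n} (hS : S.Binary) :
    Disjoint S.cherryLineages S.hitLineages := by
  rw [Finset.disjoint_right]
  intro i hi
  obtain ⟨q, hq, t, rfl⟩ := mem_hitLineages.1 hi
  exact hS.notMem_cherryLineages_of_isHit hq t

theorem card_hitLineages_le (S : Stage V n) : S.hitLineages.card ≤ 4 * S.hits.card := by
  have h : S.hitLineages = (S.hits ×ˢ Finset.univ).image fun x => x.1 x.2 := by
    ext i
    simp [mem_hitLineages]
  rw [h]
  refine Finset.card_image_le.trans ?_
  rw [Finset.card_product, Finset.card_univ, Fintype.card_fin, mul_comm]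

/-- In the absence of `IsDouble`, the patterns `IsHit` do not overlap. -/
theorem Binary.hit_unique {S : Stage V n} (hS : S.Binary) (hd : ∀ q, ¬ S.IsDouble q)
    {q q' : Fin 4 → Fin n} (hq : S.IsHit q) (hq' : S.IsHit q') {t t' : Fin 4}
    (h : q t = q' t') : q = q' ∧ t = t' := by
  obtain ⟨h01, h13, h23, hne⟩ := hq
  obtain ⟨h01', h13', h23', hne'⟩ := hq'
  -- Patterns with the same reticulation node and the same first parent coincide.
  have key : q 3 = q' 3 → q 1 = q' 1 → q = q' := by
    intro e3 e1
    have hs0 : S.source (q 0) = S.source (q' 0) := by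
      by_contra hs0
      rw [← e1] at h01'
      exact hS.hybrid_edge h01 h01' hs0 h13
    have e0 := hS.source_edge h01 hs0
    have e2 : q 2 = q' 2 := by
      rw [← e3] at h23' h13'
      rw [← e1] at hne' h13'
      have := hS.parent_three h13 h23 h23'
      exact hS.source_edge h23 (by tauto)
    funext s
    fin_cases s <;> assumption
  -- The parents cannot be exchanged.
  have cross : q 3 = q' 3 → q 1 ≠ q' 2 := by
    intro e3 e1
    have hs1 : S.source (q 2) = S.source (q' 1) := by
      rw [← e3] at h23' h13'
      rw [← e1] at hne' h23'
      have := hS.parent_three h13 h23 h13'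
      tauto
    have e2 := hS.source_edge h23 hs1
    refine hd ![q 0, q 1, q 2, q 3, q' 0] ⟨h01, h13, h23, hne, ?_, ?_⟩
    · change S.edge (S.source (q' 0)) (S.source (q 2))
      rwa [hs1]
    · intro h0
      change S.source (q 0) = S.source (q' 0) at h0
      rw [h0] at h01
      exact hne ((hS.edge_edge h01 h01').trans hs1.symm)
  have cross' : q 3 = q' 3 → q 2 ≠ q' 1 := by
    intro e3 e1
    refine cross e3 (hS.source_edge h13 ?_)
    rw [← e3] at h23' h13'
    rw [← e1] at hne' h13'
    have := hS.parent_three h13 h23 h23'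
    tauto
  have same3 : q 3 = q' 3 → q 1 = q' 1 := by
    intro e3
    rw [← e3] at h13' h23'
    rcases hS.parent_three h13 h13' h23' with h | h | h
    · exact hS.source_edge h13 h
    · exact absurd (hS.source_edge h13 h) (cross e3)
    · exact absurd h hne'
  -- A reticulation node of a pattern has no child, whereas the other three nodes have one.
  have c3 : ∀ {r r' : Fin 4 → Fin n}, S.IsHit r → S.IsHit r' →
      r 3 ≠ r' 0 ∧ r 3 ≠ r' 1 ∧ r 3 ≠ r' 2 := by
    rintro r r' ⟨-, h13, h23, hne⟩ ⟨k01, k13, k23, -⟩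
    refine ⟨fun e => ?_, fun e => ?_, fun e => ?_⟩
    · rw [← e] at k01; exact hS.hybrid_edge h13 h23 hne k01
    · rw [← e] at k13; exact hS.hybrid_edge h13 h23 hne k13
    · rw [← e] at k23; exact hS.hybrid_edge h13 h23 hne k23
  -- If the branching node of one pattern were a parent in the other, its child would have a child
  -- as the first says, yet be a childless reticulation node by the second.
  have c0 : ∀ {r r' : Fin 4 → Fin n}, S.IsHit r → S.IsHit r' → r 0 ≠ r' 1 ∧ r 0 ≠ r' 2 := by
    rintro r r' ⟨h01, h13, -, -⟩ ⟨-, k13, k23, kne⟩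
    refine ⟨fun e => ?_, fun e => ?_⟩
    · have k := k13
      rw [← e] at k
      have e' := hS.edge_edge h01 k
      rw [e'] at h13
      exact hS.hybrid_edge k13 k23 kne h13
    · have k := k23
      rw [← e] at k
      have e' := hS.edge_edge h01 k
      rw [e'] at h13
      exact hS.hybrid_edge k13 k23 kne h13
  -- Lineages of parents determine that of the reticulation node.
  have H : S.IsHit q := ⟨h01, h13, h23, hne⟩
  have H' : S.IsHit q' := ⟨h01', h13', h23', hne'⟩
  have d3' : ∀ {a b : Fin n}, S.edge (S.source a) (S.source (q 3)) →
      S.edge (S.source b) (S.source (q' 3)) → a = b → q 3 = q' 3 := by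
    rintro a b ha hb rfl
    exact hS.hybrid_source h13 h23 hne (hS.edge_edge ha hb)
  have z1 := c3 H H'
  have z2 := c3 H' H
  have z3 := c0 H H'
  have z4 := c0 H' H
  fin_cases t <;> fin_cases t' <;> simp only at h
  · refine ⟨?_, rfl⟩
    have hs : S.source (q 1) = S.source (q' 1) := by
      change q 0 = q' 0 at h
      rw [← h] at h01'
      exact hS.edge_edge h01 h01'
    have e1 := hS.source_edge h13 hs
    exact key (d3' h13 h13' e1) e1
  · exact absurd h z3.1
  · exact absurd h z3.2
  · exact absurd h.symm z2.1
  · exact absurd h.symm z4.1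
  · exact ⟨key (d3' h13 h13' h) h, rfl⟩
  · exact absurd h (cross (d3' h13 h23' h))
  · exact absurd h.symm z2.2.1
  · exact absurd h.symm z4.2
  · exact absurd h (cross' (d3' h23 h13' h))
  · have e3 := d3' h23 h23' h
    exact ⟨key e3 (same3 e3), rfl⟩
  · exact absurd h.symm z2.2.2
  · exact absurd h z1.1
  · exact absurd h z1.2.1
  · exact absurd h z1.2.2
  · exact ⟨key h (same3 h), rfl⟩

theorem Binary.card_hitLineages {S : Stage V n} (hS : S.Binary) (hd : S.doubles = ∅) :
    S.hitLineages.card = 4 * S.hits.card := by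
  have hd' : ∀ q, ¬ S.IsDouble q := fun q hq => by
    rw [← mem_doubles, hd] at hq
    simp at hq
  have h : S.hitLineages = (S.hits ×ˢ Finset.univ).image fun x => x.1 x.2 := by
    ext i
    simp [mem_hitLineages]
  rw [h, Finset.card_image_of_injOn, Finset.card_product, Finset.card_univ, Fintype.card_fin,
    mul_comm]
  rintro ⟨q, t⟩ hq ⟨q', t'⟩ hq' he
  have hq : S.IsHit q := by simpa using hq
  have hq' : S.IsHit q' := by simpa using hq'
  obtain ⟨rfl, rfl⟩ := hS.hit_unique hd' hq hq' he
  rfl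

theorem Binary.card_mates_le {S : Stage V n} (hS : S.Binary) (i j : Fin n) :
    (S.mates i j).card ≤ 1 := by
  rw [Finset.card_le_one]
  intro a ha b hb
  obtain ⟨ha, -, ha'⟩ := mem_mates.1 ha
  obtain ⟨hb, -, hb'⟩ := mem_mates.1 hb
  have := hS.source_three ha' (ha'.trans hb'.symm)
  tauto

theorem mates_eq_empty {S : Stage V n} {i : Fin n} (hi : i ∉ S.cherryLineages) (j : Fin n) :
    S.mates i j = ∅ := by
  ext k
  rw [mem_cherryLineages] at hi
  simp only [mem_mates, Finset.notMem_empty, iff_false]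
  exact fun h => hi ⟨k, h.1, h.2.2⟩

/-- The condition on j excludes that i and j form the same cherry; in that case the partner of i is
used up by the event. -/
theorem Binary.card_mates {S : Stage V n} (hS : S.Binary) {i j : Fin n}
    (hi : i ∈ S.cherryLineages) (hj : j ∉ S.cherryLineages) : (S.mates i j).card = 1 := by
  refine (hS.card_mates_le i j).antisymm (Finset.card_pos.2 ?_)
  obtain ⟨k, hk, hs⟩ := mem_cherryLineages.1 hi
  refine ⟨k, mem_mates.2 ⟨hk, ?_, hs⟩⟩
  rintro rfl
  exact hj (mem_cherryLineages.2 ⟨i, hk.symm, hs.symm⟩)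

theorem filter_cherries_eq {S : Stage V n} {i j : Fin n} (hi : i ∉ S.cherryLineages)
    (hj : j ∉ S.cherryLineages) :
    (S.cherries.filter fun p => (p.1 ≠ i ∧ p.1 ≠ j) ∧ p.2 ≠ i ∧ p.2 ≠ j) = S.cherries := by
  rw [← exists_cherry_iff] at hi hj
  refine Finset.filter_true_of_mem fun p hp => ?_
  grind

theorem Binary.card_filter_cherries {S : Stage V n} (hS : S.Binary) {i j : Fin n}
    (hi : i ∈ S.cherryLineages) (hj : j ∉ S.cherryLineages) :
    (S.cherries.filter fun p => (p.1 ≠ i ∧ p.1 ≠ j) ∧ p.2 ≠ i ∧ p.2 ≠ j).card + 1 =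
      S.cherries.card := by
  rw [← exists_cherry_iff] at hi hj
  obtain ⟨p, hp, hpi⟩ := hi
  have : (S.cherries.filter fun p => (p.1 ≠ i ∧ p.1 ≠ j) ∧ p.2 ≠ i ∧ p.2 ≠ j) =
      S.cherries.erase p := by
    ext p'
    rw [Finset.mem_filter, Finset.mem_erase, and_comm]
    refine and_congr_left fun hp' => ?_
    have := @Binary.cherry_unique _ _ _ hS p p' hp hp' i hpi
    grind
  rw [this, Finset.card_erase_add_one hp]

theorem filter_hits_eq {S : Stage V n} {i j : Fin n} (hi : i ∉ S.hitLineages)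
    (hj : j ∉ S.hitLineages) : (S.hits.filter fun q => ∀ t, q t ≠ i ∧ q t ≠ j) = S.hits := by
  rw [mem_hitLineages] at hi hj
  refine Finset.filter_true_of_mem fun q hq => ?_
  rw [mem_hits] at hq
  exact fun t => ⟨fun h => hi ⟨q, hq, t, h⟩, fun h => hj ⟨q, hq, t, h⟩⟩

theorem Binary.card_filter_hits {S : Stage V n} (hS : S.Binary) (hd : S.doubles = ∅) {i j : Fin n}
    (hi : i ∈ S.hitLineages) (hj : j ∉ S.hitLineages) :
    (S.hits.filter fun q => ∀ t, q t ≠ i ∧ q t ≠ j).card + 1 = S.hits.card := by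
  have hd' : ∀ q, ¬ S.IsDouble q := fun q hq => by
    rw [← mem_doubles, hd] at hq
    simp at hq
  rw [mem_hitLineages] at hi hj
  obtain ⟨q, hq, t, rfl⟩ := hi
  have : (S.hits.filter fun q' => ∀ t', q' t' ≠ q t ∧ q' t' ≠ j) = S.hits.erase q := by
    ext q'
    rw [Finset.mem_filter, Finset.mem_erase, and_comm]
    refine and_congr_left fun hq' => ?_
    rw [mem_hits] at hq'
    constructor
    · rintro h rfl
      exact (h t).1 rfl
    · exact fun h t' => ⟨fun he => h (hS.hit_unique hd' hq' hq he).1,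
        fun he => hj ⟨q', hq', t', he⟩⟩
  rw [this, Finset.card_erase_add_one (mem_hits.2 hq)]

end Stage
end RTCN

namespace RTCN
namespace Stage

variable {V : Type} {n : ℕ}

/-! ### Patterns in networks and in networks under construction -/

section

variable {S : Stage V n} {σ : Equiv.Perm (Fin n)}

theorem inl_mem_children {v w : V} :
    Sum.inl w ∈ (S.toNetwork σ).children (.inl v) ↔ S.edge v w := Iff.rfl

theorem inr_mem_children {v : V} {k : Fin n} :
    Sum.inr k ∈ (S.toNetwork σ).children (.inl v) ↔ v = S.source (σ k) := Iff.rfl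

theorem children_inr (k : Fin n) : (S.toNetwork σ).children (.inr k) = ∅ := by
  ext (w | l) <;> exact Iff.rfl

theorem toNetwork_leaf (k : Fin n) : (S.toNetwork σ).leaf k = .inr k := rfl

theorem exists_inl_of_mem_children {x y : V ⊕ Fin n} (h : y ∈ (S.toNetwork σ).children x) :
    ∃ v, x = .inl v := by
  rcases x with v | k
  · exact ⟨v, rfl⟩
  · rw [children_inr] at h; exact h.elim

theorem Binary.children_eq (hS : S.Binary) {a : Fin n} {w : V} (h : S.edge (S.source a) w) :
    (S.toNetwork σ).children (.inl (S.source a)) = {.inr (σ⁻¹ a), .inl w} := by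
  ext (v | k)
  · rw [inl_mem_children]
    simp only [Set.mem_insert_iff, Set.mem_singleton_iff, reduceCtorEq, false_or, Sum.inl.injEq]
    exact ⟨fun h' => hS.edge_edge h' h, fun h' => h' ▸ h⟩
  · rw [inr_mem_children]
    simp only [Set.mem_insert_iff, Set.mem_singleton_iff, reduceCtorEq, or_false, Sum.inr.injEq,
      Equiv.Perm.eq_inv_iff_eq]
    exact ⟨fun h' => (hS.source_edge h h').symm, fun h' => h' ▸ rfl⟩

theorem Binary.setOf_isCherry (hS : S.Binary) :
    {u | (S.toNetwork σ).IsCherry u} = 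
      (fun p => .inl (S.source p.1)) '' (S.cherries : Set (Fin n × Fin n)) := by
  ext u
  simp only [Set.mem_ofPred_eq, Set.mem_image, Finset.mem_coe, RankedNetwork.IsCherry,
    toNetwork_leaf]
  constructor
  · rintro ⟨k, l, hkl, h⟩
    obtain ⟨v, rfl⟩ := exists_inl_of_mem_children (h ▸ Set.mem_insert _ _ : Sum.inr k ∈ _)
    have hk : v = S.source (σ k) := inr_mem_children.1 (h ▸ by simp)
    have hl : v = S.source (σ l) := inr_mem_children.1 (h ▸ by simp)
    rcases lt_or_gt_of_ne (σ.injective.ne hkl) with h' | h'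
    · exact ⟨(σ k, σ l), mem_cherries.2 ⟨h', hk.symm.trans hl⟩, congrArg _ hk.symm⟩
    · exact ⟨(σ l, σ k), mem_cherries.2 ⟨h', hl.symm.trans hk⟩, congrArg _ hl.symm⟩
  · rintro ⟨⟨a, b⟩, hp, rfl⟩
    obtain ⟨hab, hs⟩ := mem_cherries.1 hp
    refine ⟨σ⁻¹ a, σ⁻¹ b, by simpa using hab.ne, ?_⟩
    ext (v | k)
    · rw [inl_mem_children]
      simp only [Set.mem_insert_iff, Set.mem_singleton_iff, reduceCtorEq, or_self, iff_false]
      exact fun h => hab.ne (hS.source_edge h hs)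
    · rw [inr_mem_children]
      simp only [Set.mem_insert_iff, Set.mem_singleton_iff, Sum.inr.injEq,
        Equiv.Perm.eq_inv_iff_eq]
      constructor
      · intro h
        have h1 : a ≠ b := hab.ne
        have := hS.source_three hs h
        tauto
      · rintro (h | h)
        · rw [h]
        · rw [h]; exact hs

theorem Binary.numCherries_eq (hS : S.Binary) :
    (S.toNetwork σ).numCherries = S.cherries.card := by
  rw [RankedNetwork.numCherries, hS.setOf_isCherry, Set.InjOn.ncard_image,
    Set.ncard_coe_finset]
  intro p hp p' hp' h
  obtain ⟨h1, h2⟩ := mem_cherries.1 hp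
  obtain ⟨h3, h4⟩ := mem_cherries.1 hp'
  have h : S.source p.1 = S.source p'.1 := Sum.inl_injective h
  refine hS.cherry_unique hp hp' (i := p.1) (.inl rfl) ?_
  have e1 := hS.source_three h2 h
  have e2 := hS.source_three h2 (h.trans h4)
  grind

theorem Binary.isTrident (hS : S.Binary) {q : Fin 4 → Fin n} (hq : S.IsHit q) :
    (S.toNetwork σ).IsTrident (.inl (S.source (q 1))) (.inl (S.source (q 2)))
      (.inl (S.source (q 3))) := by
  obtain ⟨h01, h13, h23, hne⟩ := hq
  refine ⟨fun h => hne (Sum.inl_injective h), ?_, σ⁻¹ (q 1), σ⁻¹ (q 2), σ⁻¹ (q 3),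
    hS.children_eq h13, hS.children_eq h23, ?_⟩
  · ext (v | k)
    · change S.edge v _ ↔ _
      simp only [Set.mem_insert_iff, Set.mem_singleton_iff, Sum.inl.injEq]
      constructor
      · intro h
        have := hS.parent_three h13 h23 h
        tauto
      · rintro (rfl | rfl) <;> assumption
    · change False ↔ _
      simp
  · ext (v | k)
    · rw [inl_mem_children]
      simp only [toNetwork_leaf, Set.mem_singleton_iff, reduceCtorEq, iff_false]
      exact hS.hybrid_edge h13 h23 hne
    · rw [inr_mem_children]
      simp only [toNetwork_leaf, Set.mem_singleton_iff, Sum.inr.injEq, Equiv.Perm.eq_inv_iff_eq]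
      exact ⟨fun h => (hS.hybrid_source h13 h23 hne h).symm, fun h => h ▸ rfl⟩

theorem exists_of_children {u : V ⊕ Fin n} {k : Fin n} {s : Set (V ⊕ Fin n)}
    (h : (S.toNetwork σ).children u = insert ((S.toNetwork σ).leaf k) s) :
    u = .inl (S.source (σ k)) := by
  have hk : Sum.inr k ∈ (S.toNetwork σ).children u := h ▸ Set.mem_insert _ _
  obtain ⟨v, rfl⟩ := exists_inl_of_mem_children hk
  exact congrArg _ (inr_mem_children.1 hk)

theorem edge_of_children {v w : V} {x : V ⊕ Fin n}
    (h : (S.toNetwork σ).children (.inl v) = {x, .inl w}) : S.edge v w :=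
  inl_mem_children.1 (by rw [h]; exact Set.mem_insert_of_mem _ rfl)

theorem exists_isHit {u r : V ⊕ Fin n} {p p' : V ⊕ Fin n} {k : Fin n}
    (ht : (S.toNetwork σ).IsTrident p p' r)
    (hu : (S.toNetwork σ).children u = {(S.toNetwork σ).leaf k, p}) :
    ∃ q, S.IsHit q ∧ u = .inl (S.source (q 0)) ∧ p = .inl (S.source (q 1)) ∧
      p' = .inl (S.source (q 2)) ∧ r = .inl (S.source (q 3)) := by
  obtain ⟨hne, -, a, b, c, ha, hb, hc⟩ := ht
  obtain rfl := exists_of_children hu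
  obtain rfl := exists_of_children ha
  obtain rfl := exists_of_children hb
  obtain rfl := exists_of_children (s := ∅) (by simpa using hc)
  exact ⟨![σ k, σ a, σ b, σ c], ⟨edge_of_children hu, edge_of_children ha,
    edge_of_children hb, fun h => hne (congrArg _ h)⟩, rfl, rfl, rfl, rfl⟩

/-- An occurrence is a pair of nodes, an element of `hits` a tuple of lineages. They correspond
because each node of the pattern has just one external lineage, and the branching node and the
reticulation node determine the two parents in between. -/
theorem Binary.numHitCherries_eq (hS : S.Binary) :
    (S.toNetwork σ).numHitCherries = S.hits.card := by
  have h : {x : (V ⊕ Fin n) × (V ⊕ Fin n) | (S.toNetwork σ).IsHitCherry x.1 x.2} =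
      (fun q => (.inl (S.source (q 0)), .inl (S.source (q 3)))) '' 
        (S.hits : Set (Fin 4 → Fin n)) := by
    ext ⟨u, r⟩
    simp only [Set.mem_ofPred_eq, Set.mem_image, Finset.mem_coe, mem_hits, Prod.mk.injEq]
    constructor
    · rintro ⟨p, p', k, ht, hu⟩
      obtain ⟨q, hq, h0, -, -, h3⟩ := exists_isHit ht hu
      exact ⟨q, hq, h0.symm, h3.symm⟩
    · rintro ⟨q, hq, rfl, rfl⟩
      exact ⟨_, _, σ⁻¹ (q 0), hS.isTrident hq, hS.children_eq hq.1⟩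
  rw [RankedNetwork.numHitCherries, h, Set.InjOn.ncard_image, Set.ncard_coe_finset]
  intro q hq q' hq' he
  obtain ⟨h01, h13, h23, hne⟩ := mem_hits.1 hq
  obtain ⟨h01', h13', h23', hne'⟩ := mem_hits.1 hq'
  simp only [Prod.mk.injEq, Sum.inl.injEq] at he
  have e0 : q 0 = q' 0 := hS.source_edge h01 he.1
  have e3 : q 3 = q' 3 := hS.hybrid_source h13 h23 hne he.2
  have e1 : q 1 = q' 1 := by
    rw [← e0] at h01'
    exact hS.source_edge h13 (hS.edge_edge h01 h01')
  have e2 : q 2 = q' 2 := by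
    rw [← e3] at h23'
    rw [← e1] at hne'
    have := hS.parent_three h13 h23 h23'
    exact hS.source_edge h23 (by tauto)
  funext t
  fin_cases t <;> assumption

/-- Exchanging the two branching events gives another tuple in `doubles` but the same occurrence; so
the occurrences are the image of `doubles`, not `doubles` itself. -/
theorem Binary.numDoubleHits_eq (hS : S.Binary) : (S.toNetwork σ).numDoubleHits =
    ((fun q => (.inl (S.source (q 3)) : V ⊕ Fin n)) '' (S.doubles : Set (Fin 5 → Fin n))).ncard := by
  rw [RankedNetwork.numDoubleHits]
  congr 1
  ext r
  constructor
  · rintro ⟨u, v, p, p', k, l, huv, ht, hu, hv⟩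
    obtain ⟨q, hq, rfl, rfl, rfl, rfl⟩ := exists_isHit ht hu
    obtain rfl := exists_of_children hv
    refine ⟨![q 0, q 1, q 2, q 3, σ l], ?_, rfl⟩
    rw [Finset.mem_coe, mem_doubles]
    exact ⟨hq.1, hq.2.1, hq.2.2.1, hq.2.2.2, edge_of_children hv,
      fun h => huv (congrArg _ h)⟩
  · rintro ⟨q, hq, rfl⟩
    have hq := mem_doubles.1 hq
    exact ⟨_, _, _, _, σ⁻¹ (q 0), σ⁻¹ (q 4), fun h => hq.2.2.2.2.2 (Sum.inl_injective h),
      hS.isTrident hq.isHit, hS.children_eq hq.1, hS.children_eq hq.2.2.2.2.1⟩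

theorem ncard_image_doubles_le :
    ((fun q => (.inl (S.source (q 3)) : V ⊕ Fin n)) ''
      (S.doubles : Set (Fin 5 → Fin n))).ncard ≤ S.doubles.card :=
  (Set.ncard_image_le (Finset.finite_toSet _)).trans (Set.ncard_coe_finset _).le

end

end Stage

namespace RankedTreeChildNetwork

variable {n : ℕ}

theorem numCherries_ofEvolution (x : Evolution n × Equiv.Perm (Fin n)) :
    (ofEvolution x).numCherries = x.1.stage.cherries.card :=
  x.1.good.binary.numCherries_eq

theorem numHitCherries_ofEvolution (x : Evolution n × Equiv.Perm (Fin n)) :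
    (ofEvolution x).numHitCherries = x.1.stage.hits.card :=
  x.1.good.binary.numHitCherries_eq

theorem numDoubleHits_ofEvolution (x : Evolution n × Equiv.Perm (Fin n)) :
    (ofEvolution x).numDoubleHits = ((fun q => (.inl (x.1.stage.source (q 3)) : x.1.Node ⊕ Fin n)) ''
      (x.1.stage.doubles : Set (Fin 5 → Fin n))).ncard :=
  x.1.good.binary.numDoubleHits_eq

end RankedTreeChildNetwork
end RTCN

namespace RTCN
namespace Evolution

variable {n : ℕ}

/-! ### The effect of a random event -/

/-- The number of cherries after an evolution. -/
noncomputable def cherryCount (h : Evolution n) : ℕ := h.stage.cherries.card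

/-- The number of patterns `IsHit` after an evolution. -/
noncomputable def hitCount (h : Evolution n) : ℕ := h.stage.hits.card

/-- The number of patterns `IsDouble` after an evolution. -/
noncomputable def doubleCount (h : Evolution n) : ℕ := h.stage.doubles.card

/-- The number of branching events of an evolution. -/
def branchCount : {n : ℕ} → Evolution n → ℕ
  | _, start => 1
  | _, branch h _ => h.branchCount + 1
  | _, reticulate h _ _ _ => h.branchCount

/-- The lineages that belong to a cherry or to a pattern `IsHit`. -/
noncomputable def specials (h : Evolution n) : Finset (Fin n) :=
  h.stage.cherryLineages ∪ h.stage.hitLineages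

theorem binary (h : Evolution n) : h.stage.Binary := h.good.binary

theorem cherryCount_step_self (h : Evolution n) (i : Fin n) :
    (h.step i i).cherryCount = (h.stage.cherries.filter fun p => p.1 ≠ i ∧ p.2 ≠ i).card + 1 := by
  rw [step_self]
  exact Stage.card_cherries_branch h.stage i

theorem hitCount_step_self (h : Evolution n) (i : Fin n) :
    (h.step i i).hitCount = (h.stage.hits.filter fun q => ∀ t, q t ≠ i).card := by
  rw [step_self]
  exact Stage.card_hits_branch h.stage i

theorem cherryCount_step_of_ne (h : Evolution n) {i j : Fin n} (hij : i ≠ j) :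
    (h.step i j).cherryCount =
      (h.stage.cherries.filter fun p => (p.1 ≠ i ∧ p.1 ≠ j) ∧ p.2 ≠ i ∧ p.2 ≠ j).card := by
  rw [step_of_ne h hij]
  exact Stage.card_cherries_reticulate h.stage hij

theorem hitCount_step_of_ne (h : Evolution n) {i j : Fin n} (hij : i ≠ j) :
    (h.step i j).hitCount = (h.stage.hits.filter fun q => ∀ t, q t ≠ i ∧ q t ≠ j).card +
      ((h.stage.mates i j).card + (h.stage.mates j i).card) := by
  rw [step_of_ne h hij]
  exact Stage.card_hits_reticulate h.stage hij

theorem doubleCount_step_le (h : Evolution n) (i j : Fin n) :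
    (h.step i j).doubleCount ≤ (h.stage.doubles.filter fun q => ∀ t, q t ≠ i ∧ q t ≠ j).card +
      2 * ((h.stage.mates i j).card * (h.stage.mates j i).card) := by
  by_cases hij : i = j
  · subst hij
    rw [step_self]
    simp only [and_self]
    exact (Stage.card_doubles_branch_le h.stage i).trans (Nat.le_add_right _ _)
  · rw [step_of_ne h hij]
    exact Stage.card_doubles_reticulate_le h.stage hij

theorem branchCount_step (h : Evolution n) (i j : Fin n) :
    (h.step i j).branchCount = h.branchCount + if i = j then 1 else 0 := by
  by_cases hij : i = j
  · subst hij; rw [step_self, if_pos rfl]; rfl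
  · rw [step_of_ne h hij, if_neg hij]; rfl

theorem cherryCount_step_comm (h : Evolution n) (i j : Fin n) :
    (h.step i j).cherryCount = (h.step j i).cherryCount := by
  by_cases hij : i = j
  · rw [hij]
  · rw [cherryCount_step_of_ne h hij, cherryCount_step_of_ne h (Ne.symm hij)]
    congr 1
    refine Finset.filter_congr fun p _ => ?_
    tauto

theorem hitCount_step_comm (h : Evolution n) (i j : Fin n) :
    (h.step i j).hitCount = (h.step j i).hitCount := by
  by_cases hij : i = j
  · rw [hij]
  · rw [hitCount_step_of_ne h hij, hitCount_step_of_ne h (Ne.symm hij), add_comm (Finset.card _)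
      (Finset.card (h.stage.mates j i))]
    congr 2
    refine Finset.filter_congr fun q _ => ?_
    simp only [and_comm]

section

variable {h : Evolution n} {i j : Fin n}

theorem notMem_specials : i ∉ h.specials ↔
    i ∉ h.stage.cherryLineages ∧ i ∉ h.stage.hitLineages := by
  simp only [specials, Finset.mem_union, not_or]

theorem step_self_of_notMem (hi : i ∉ h.specials) :
    (h.step i i).hitCount = h.hitCount ∧ (h.step i i).cherryCount = h.cherryCount + 1 := by
  rw [notMem_specials] at hi
  have h1 := Stage.filter_cherries_eq hi.1 hi.1
  have h2 := Stage.filter_hits_eq hi.2 hi.2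
  simp only [and_self] at h1 h2
  rw [hitCount_step_self, cherryCount_step_self, h1, h2]
  exact ⟨rfl, rfl⟩

theorem step_of_notMem (hij : i ≠ j) (hi : i ∉ h.specials) (hj : j ∉ h.specials) :
    (h.step i j).hitCount = h.hitCount ∧ (h.step i j).cherryCount = h.cherryCount := by
  rw [notMem_specials] at hi hj
  rw [hitCount_step_of_ne h hij, cherryCount_step_of_ne h hij, Stage.filter_cherries_eq hi.1 hj.1,
    Stage.filter_hits_eq hi.2 hj.2, Stage.mates_eq_empty hi.1, Stage.mates_eq_empty hj.1]
  exact ⟨rfl, rfl⟩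

theorem step_of_mem_cherryLineages (hi : i ∈ h.stage.cherryLineages) (hj : j ∉ h.specials) :
    (h.step i j).hitCount = h.hitCount + 1 ∧ (h.step i j).cherryCount = h.cherryCount - 1 := by
  rw [notMem_specials] at hj
  have hij : i ≠ j := fun e => hj.1 (e ▸ hi)
  have h1 := h.binary.card_filter_cherries hi hj.1
  rw [hitCount_step_of_ne h hij, cherryCount_step_of_ne h hij,
    Stage.filter_hits_eq (Finset.disjoint_left.1 h.binary.disjoint_lineages hi) hj.2,
    Stage.mates_eq_empty hj.1, h.binary.card_mates hi hj.1]
  exact ⟨rfl, by rw [cherryCount, ← h1, Nat.add_sub_cancel]⟩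

/-- Without double patterns the lineage i lies in one pattern `IsHit` only, so just this one is
destroyed. -/
theorem step_of_mem_hitLineages (hd : h.doubleCount = 0) (hi : i ∈ h.stage.hitLineages)
    (hj : j ∉ h.specials) :
    (h.step i j).hitCount = h.hitCount - 1 ∧ (h.step i j).cherryCount = h.cherryCount := by
  rw [notMem_specials] at hj
  have hij : i ≠ j := fun e => hj.2 (e ▸ hi)
  have hi' := Finset.disjoint_right.1 h.binary.disjoint_lineages hi
  have h1 := h.binary.card_filter_hits (Finset.card_eq_zero.1 hd) hi hj.2
  rw [hitCount_step_of_ne h hij, cherryCount_step_of_ne h hij,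
    Stage.filter_cherries_eq hi' hj.1, Stage.mates_eq_empty hj.1, Stage.mates_eq_empty hi']
  exact ⟨by rw [hitCount, ← h1]; simp, rfl⟩

end

theorem card_specials_le (h : Evolution n) :
    h.specials.card ≤ 2 * h.cherryCount + 4 * h.hitCount := by
  refine (Finset.card_union_le _ _).trans ?_
  rw [h.binary.card_cherryLineages]
  exact Nat.add_le_add_left (Stage.card_hitLineages_le h.stage) _

/-- A branching event adds at most one cherry. A reticulation event creates at most two hit
patterns, and if it creates any, then it destroys at least one cherry. This bounds all patterns by
the number of branching events, whose law is explicit. -/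
theorem two_mul_cherryCount_add_hitCount_le (h : Evolution n) :
    2 * h.cherryCount + h.hitCount ≤ 2 * h.branchCount := by
  induction h with
  | start =>
    have h1 : cherryCount start ≤ 1 := by
      have : start.stage.cherries ⊆ {(0, 1)} := by
        rintro ⟨a, b⟩ hab
        have := (Stage.mem_cherries.1 hab).1
        simp only [Finset.mem_singleton, Prod.mk.injEq]
        have h1 : a < b := this
        omega
      exact Finset.card_le_card this
    have h2 : hitCount start = 0 := by
      refine Finset.card_eq_zero.2 (Finset.eq_empty_of_forall_notMem fun q hq => ?_)
      have : true = false := (Stage.mem_hits.1 hq).1.1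
      simp at this
    rw [h2]
    change 2 * cherryCount start + 0 ≤ 2 * 1
    omega
  | @branch n h i ih =>
    have h1 := cherryCount_step_self h i
    have h2 := hitCount_step_self h i
    have h3 := branchCount_step h i i
    rw [step_self] at h1 h2 h3
    rw [h1, h2, h3, if_pos rfl]
    have h4 := Finset.card_filter_le h.stage.cherries fun p => p.1 ≠ i ∧ p.2 ≠ i
    have h5 := Finset.card_filter_le h.stage.hits fun q => ∀ t, q t ≠ i
    rw [cherryCount, hitCount] at ih
    omega
  | @reticulate n h i j hij ih =>
    have h1 := cherryCount_step_of_ne h hij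
    have h2 := hitCount_step_of_ne h hij
    have h3 := branchCount_step h i j
    rw [step_of_ne h hij] at h1 h2 h3
    rw [h1, h2, h3, if_neg hij]
    have h4 := Finset.card_filter_le h.stage.hits fun q => ∀ t, q t ≠ i ∧ q t ≠ j
    have h5 := h.binary.card_mates_le i j
    have h6 := h.binary.card_mates_le j i
    rw [cherryCount, hitCount] at ih
    have h7 := Finset.card_filter_le h.stage.cherries
      fun p => (p.1 ≠ i ∧ p.1 ≠ j) ∧ p.2 ≠ i ∧ p.2 ≠ j
    by_cases hs : i ∈ h.stage.cherryLineages ∨ j ∈ h.stage.cherryLineages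
    · have h8 : (h.stage.cherries.filter
          fun p => (p.1 ≠ i ∧ p.1 ≠ j) ∧ p.2 ≠ i ∧ p.2 ≠ j).card < h.stage.cherries.card := by
        refine Finset.card_lt_card (Finset.filter_ssubset.2 ?_)
        rcases hs with hs | hs
        all_goals
          obtain ⟨p, hp, hpi⟩ := Stage.exists_cherry_iff.2 hs
          exact ⟨p, hp, by tauto⟩
      omega
    · rw [not_or] at hs
      rw [Stage.mates_eq_empty hs.1, Stage.mates_eq_empty hs.2]
      simp only [Finset.card_empty, add_zero]
      omega

/-- The generator of the limiting Markov process of the numbers of patterns. -/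
noncomputable def generator (f : ℕ → ℕ → ℂ) (x c : ℕ) : ℂ :=
  (f x (c + 1) - f x c) + 4 * c * (f (x + 1) (c - 1) - f x c) + 8 * x * (f (x - 1) c - f x c)

theorem norm_sub_le_two {a b : ℂ} (ha : ‖a‖ ≤ 1) (hb : ‖b‖ ≤ 1) : ‖a - b‖ ≤ 2 :=
  (norm_sub_le a b).trans (by linarith)

/-- The increment of f equals `d i + d j`, plus `b` on the diagonal, unless both i and j belong to
patterns. Summing this additive expression over all pairs gives n times the generator: 2c cherry
lineages and 4x hit lineages, each as first or second entry. -/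
theorem norm_sum_step_sub_generator_le (h : Evolution n) (hd : h.doubleCount = 0)
    (f : ℕ → ℕ → ℂ) (hf : ∀ x c, ‖f x c‖ ≤ 1) :
    ‖∑ i, ∑ j, (f (h.step i j).hitCount (h.step i j).cherryCount - f h.hitCount h.cherryCount) -
      n * generator f h.hitCount h.cherryCount‖ ≤
        8 * ((2 * h.cherryCount + 4 * h.hitCount : ℕ) : ℝ) ^ 2 := by
  classical
  set x := h.hitCount with hx
  set c := h.cherryCount with hc
  let u : ℂ := f (x + 1) (c - 1) - f x c
  let v : ℂ := f (x - 1) c - f x c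
  let b : ℂ := f x (c + 1) - f x c
  have hu : ‖u‖ ≤ 2 := norm_sub_le_two (hf _ _) (hf _ _)
  have hv : ‖v‖ ≤ 2 := norm_sub_le_two (hf _ _) (hf _ _)
  have hb : ‖b‖ ≤ 2 := norm_sub_le_two (hf _ _) (hf _ _)
  let d : Fin n → ℂ := fun i =>
    (if i ∈ h.stage.cherryLineages then u else 0) + (if i ∈ h.stage.hitLineages then v else 0)
  have hdis := Finset.disjoint_left.1 h.binary.disjoint_lineages
  have hd0 : ∀ i, i ∉ h.specials → d i = 0 := fun i hi => by
    rw [notMem_specials] at hi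
    simp [d, hi.1, hi.2]
  have hd2 : ∀ i, ‖d i‖ ≤ 2 := fun i => by
    by_cases h1 : i ∈ h.stage.cherryLineages
    · simpa [d, h1, hdis h1] using hu
    · by_cases h2 : i ∈ h.stage.hitLineages
      · simpa [d, h1, h2] using hv
      · simp [d, h1, h2]
  have hstep : ∀ i j, i ∈ h.specials → j ∉ h.specials →
      f (h.step i j).hitCount (h.step i j).cherryCount - f x c = d i := by
    intro i j hi hj
    rcases Finset.mem_union.1 hi with hi | hi
    · obtain ⟨h1, h2⟩ := step_of_mem_cherryLineages hi hj
      rw [h1, h2]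
      simp [d, hi, hdis hi, u, hx, hc]
    · have hi' := Finset.disjoint_right.1 h.binary.disjoint_lineages hi
      obtain ⟨h1, h2⟩ := step_of_mem_hitLineages hd hi hj
      rw [h1, h2]
      simp [d, hi, hi', v, hx, hc]
  have hsum : (n : ℂ) * generator f x c = ∑ i, ∑ j, (d i + d j + if i = j then b else 0) := by
    have h1 : ∑ i, d i = 2 * c * u + 4 * x * v := by
      simp only [d, Finset.sum_add_distrib, Finset.sum_ite_mem, Finset.univ_inter,
        Finset.sum_const, h.binary.card_cherryLineages,
        h.binary.card_hitLineages (Finset.card_eq_zero.1 hd), nsmul_eq_mul]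
      simp [hx, hc, cherryCount, hitCount]
    simp only [Finset.sum_add_distrib, Finset.sum_const, Finset.card_univ, Fintype.card_fin,
      nsmul_eq_mul, Finset.sum_ite_eq, Finset.mem_univ, if_true, ← Finset.mul_sum, h1]
    simp only [generator, u, v, b]
    ring
  rw [hsum, ← Finset.sum_sub_distrib]
  simp only [← Finset.sum_sub_distrib]
  -- The bound 8 is 2 for the increment of f plus 2 for each of `d i`, `d j` and `b`.
  have hpt : ∀ i j, ‖f (h.step i j).hitCount (h.step i j).cherryCount - f x c -
      (d i + d j + if i = j then b else 0)‖ ≤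
      (if i ∈ h.specials then 1 else 0) * (if j ∈ h.specials then 8 else 0) := by
    intro i j
    by_cases hi : i ∈ h.specials <;> by_cases hj : j ∈ h.specials
    · rw [if_pos hi, if_pos hj, one_mul]
      have h1 : ‖(if i = j then b else 0 : ℂ)‖ ≤ 2 := by split_ifs <;> simp [hb]
      have h2 := norm_sub_le_two (hf (h.step i j).hitCount (h.step i j).cherryCount) (hf x c)
      have h3 := norm_sub_le (f (h.step i j).hitCount (h.step i j).cherryCount - f x c)
        (d i + d j + if i = j then b else 0)
      have h4 := norm_add_le (d i + d j) (if i = j then b else 0)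
      have h5 := norm_add_le (d i) (d j)
      linarith [hd2 i, hd2 j]
    · have hij : i ≠ j := fun e => hj (e ▸ hi)
      rw [hstep i j hi hj, hd0 j hj, if_neg hij]
      simp [hj]
    · have hij : i ≠ j := fun e => hi (e ▸ hj)
      rw [hitCount_step_comm, cherryCount_step_comm, hstep j i hj hi, hd0 i hi, if_neg hij]
      simp [hi]
    · rw [hd0 i hi, hd0 j hj]
      by_cases hij : i = j
      · subst hij
        obtain ⟨h1, h2⟩ := step_self_of_notMem hi
        simp [h1, h2, hi, b, hx, hc]
      · obtain ⟨h1, h2⟩ := step_of_notMem hij hi hj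
        simp [h1, h2, hi, hij, hx, hc]
  calc _ ≤ ∑ i, ∑ j, ‖f (h.step i j).hitCount (h.step i j).cherryCount - f x c -
      (d i + d j + if i = j then b else 0)‖ :=
        (norm_sum_le _ _).trans (Finset.sum_le_sum fun i _ => norm_sum_le _ _)
    _ ≤ ∑ i, ∑ j, ((if i ∈ h.specials then 1 else 0) * (if j ∈ h.specials then 8 else 0) : ℝ) :=
        Finset.sum_le_sum fun i _ => Finset.sum_le_sum fun j _ => hpt i j
    _ = 8 * (h.specials.card : ℝ) ^ 2 := by
        rw [← Finset.sum_mul_sum]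
        simp only [Finset.sum_ite_mem, Finset.univ_inter, Finset.sum_const, nsmul_eq_mul]
        ring
    _ ≤ _ := by
        gcongr
        exact h.card_specials_le

/-- A cruder bound that remains valid in the presence of double patterns: nothing changes unless i =
j or one of i, j lies in a pattern. -/
theorem norm_sum_step_sub_le (h : Evolution n) (f : ℕ → ℕ → ℂ) (hf : ∀ x c, ‖f x c‖ ≤ 1) :
    ‖∑ i, ∑ j, (f (h.step i j).hitCount (h.step i j).cherryCount - f h.hitCount h.cherryCount)‖ ≤
      2 * n * (1 + 2 * (2 * h.cherryCount + 4 * h.hitCount : ℕ)) := by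
  classical
  have hpt : ∀ i j, ‖f (h.step i j).hitCount (h.step i j).cherryCount -
      f h.hitCount h.cherryCount‖ ≤ (if i ∈ h.specials then 2 else 0) +
        (if j ∈ h.specials then 2 else 0) + if i = j then 2 else 0 := by
    intro i j
    have h1 := norm_sub_le_two (hf (h.step i j).hitCount (h.step i j).cherryCount)
      (hf h.hitCount h.cherryCount)
    by_cases hi : i ∈ h.specials
    · rw [if_pos hi]
      split_ifs <;> linarith
    by_cases hj : j ∈ h.specials
    · rw [if_pos hj]
      split_ifs <;> linarith
    by_cases hij : i = j
    · rw [if_pos hij, if_neg hi, if_neg hj]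
      linarith
    obtain ⟨h1, h2⟩ := step_of_notMem hij hi hj
    rw [h1, h2]
    simp [hi, hj, hij]
  calc _ ≤ ∑ i, ∑ j, ‖f (h.step i j).hitCount (h.step i j).cherryCount -
      f h.hitCount h.cherryCount‖ :=
        (norm_sum_le _ _).trans (Finset.sum_le_sum fun i _ => norm_sum_le _ _)
    _ ≤ ∑ i, ∑ j, ((if i ∈ h.specials then 2 else 0) + (if j ∈ h.specials then 2 else 0) +
          if i = j then 2 else 0 : ℝ) :=
        Finset.sum_le_sum fun i _ => Finset.sum_le_sum fun j _ => hpt i j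
    _ = 2 * n * (1 + 2 * h.specials.card) := by
        simp only [Finset.sum_add_distrib, Finset.sum_const, Finset.card_univ, Fintype.card_fin,
          nsmul_eq_mul, Finset.sum_ite_eq, Finset.mem_univ, if_true, ← Finset.mul_sum,
          Finset.sum_ite_mem, Finset.univ_inter]
        ring
    _ ≤ _ := by
        gcongr
        exact h.card_specials_le

end Evolution
end RTCN

namespace RTCN
namespace Evolution

variable {n : ℕ}

/-! ### Moment bounds -/

theorem sum_branchCount_step (h : Evolution n) (F : ℕ → ℝ) :
    ∑ i, ∑ j, F (h.step i j).branchCount =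
      n * F (h.branchCount + 1) + (n ^ 2 - n) * F h.branchCount := by
  have : ∀ i j : Fin n, F (h.step i j).branchCount = F h.branchCount +
      if i = j then F (h.branchCount + 1) - F h.branchCount else 0 := by
    intro i j
    rw [branchCount_step]
    split_ifs <;> simp
  simp only [this, Finset.sum_add_distrib, Finset.sum_const, Finset.card_univ, Fintype.card_fin,
    nsmul_eq_mul, Finset.sum_ite_eq, Finset.mem_univ, if_true]
  ring

/-- With probability 1/n a step multiplies the power by 3/2, so the mean is a product of factors 1 +
1/(2k), of order √n. -/
theorem mean_pow_branchCount_le (hn : 2 ≤ n) :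
    mean (fun h : Evolution n => (3 / 2 : ℝ) ^ h.branchCount) ≤ 2 * √(n - 1) := by
  induction n, hn using Nat.le_induction with
  | base =>
    rw [mean_two]
    change (3 / 2 : ℝ) ^ 1 ≤ _
    norm_num
  | succ n hn ih =>
    have hn' : (2 : ℝ) ≤ n := by exact_mod_cast hn
    rw [mean_succ hn]
    have h1 : ∀ h : Evolution n, ((n : ℝ) ^ 2)⁻¹ •
        ∑ i, ∑ j, (3 / 2 : ℝ) ^ (h.step i j).branchCount =
        (1 + 1 / (2 * n)) * (3 / 2 : ℝ) ^ h.branchCount := fun h => by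
      rw [sum_branchCount_step h fun b => (3 / 2 : ℝ) ^ b, pow_succ, smul_eq_mul]
      field_simp
      ring
    simp only [h1]
    rw [mean_mul]
    have h2 : (1 + 1 / (2 * n)) * √(n - 1) ≤ √(n : ℝ) := by
      apply Real.le_sqrt_of_sq_le
      rw [mul_pow, Real.sq_sqrt (by linarith)]
      rw [← sub_nonneg]
      have : (n : ℝ) - (1 + 1 / (2 * n)) ^ 2 * (n - 1) = (3 * n + 1) / (4 * n ^ 2) := by
        field_simp
        ring
      rw [this]
      positivity
    have h3 : (0 : ℝ) ≤ 1 + 1 / (2 * n) := by positivity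
    push_cast
    rw [add_sub_cancel_right]
    nlinarith [mul_le_mul_of_nonneg_left ih h3]

/-- Bernoulli's inequality absorbs the polynomial: 200 · 1.09^b ≥ 200 + 18b, and 1.09² · 5/4 < 3/2.
-/
theorem sq_mul_pow_le (b : ℕ) :
    (1 + 16 * b : ℝ) ^ 2 * (5 / 4) ^ b ≤ 40000 * (3 / 2) ^ b := by
  have h1 := one_add_mul_le_pow (show (-2 : ℝ) ≤ 9 / 100 by norm_num) b
  have h2 : (1 + 16 * b : ℝ) ≤ 200 * (1 + 9 / 100) ^ b := by
    have : (0 : ℝ) ≤ b := b.cast_nonneg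
    linarith
  calc (1 + 16 * b : ℝ) ^ 2 * (5 / 4) ^ b ≤ (200 * (1 + 9 / 100) ^ b) ^ 2 * (5 / 4) ^ b := by
        gcongr
    _ = 40000 * ((1 + 9 / 100) ^ 2 * (5 / 4)) ^ b := by
        rw [mul_pow, mul_pow, ← pow_mul, ← pow_mul, mul_comm 2 b]; ring
    _ ≤ 40000 * (3 / 2) ^ b := by
        gcongr
        norm_num

theorem specials_bound_le (h : Evolution n) :
    2 * h.cherryCount + 4 * h.hitCount ≤ 8 * h.branchCount := by
  have := h.two_mul_cherryCount_add_hitCount_le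
  omega

/-- For the survival of a double pattern it suffices to use that its lineage `q 3` is avoided. The
weight must be carried along because the generating function needs a bound on double patterns
jointly with the number of branching events. -/
theorem sum_doubleCount_step_le (h : Evolution n) :
    ∑ i, ∑ j, (h.step i j).doubleCount * (5 / 4 : ℝ) ^ (h.step i j).branchCount ≤
      (n * (n - 1) * h.doubleCount + 10 * h.cherryCount ^ 2) * (5 / 4) ^ h.branchCount := by
  classical
  have h1 : ∀ i j, ((h.step i j).doubleCount : ℝ) ≤
      ∑ q ∈ h.stage.doubles, (if q 3 ≠ i then 1 else 0) * (if q 3 ≠ j then 1 else 0) +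
      2 * ((if i ∈ h.stage.cherryLineages then 1 else 0) *
        (if j ∈ h.stage.cherryLineages then 1 else 0)) := by
    intro i j
    have hm : ∀ i j, ((h.stage.mates i j).card : ℝ) ≤
        if i ∈ h.stage.cherryLineages then 1 else 0 := by
      intro i j
      split_ifs with hi
      · exact_mod_cast h.binary.card_mates_le i j
      · rw [Stage.mates_eq_empty hi]; simp
    have hq : ((h.stage.doubles.filter fun q => ∀ t, q t ≠ i ∧ q t ≠ j).card : ℝ) ≤
        ∑ q ∈ h.stage.doubles, (if q 3 ≠ i then 1 else 0) * (if q 3 ≠ j then 1 else 0) := by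
      rw [Finset.card_filter]
      push_cast
      refine Finset.sum_le_sum fun q _ => ?_
      by_cases hq : ∀ t, q t ≠ i ∧ q t ≠ j
      · rw [if_pos hq, if_pos (hq 3).1, if_pos (hq 3).2]; norm_num
      · rw [if_neg hq]; positivity
    have := doubleCount_step_le h i j
    calc ((h.step i j).doubleCount : ℝ) ≤
        (h.stage.doubles.filter fun q => ∀ t, q t ≠ i ∧ q t ≠ j).card +
          2 * ((h.stage.mates i j).card * (h.stage.mates j i).card) := by exact_mod_cast this
      _ ≤ _ := by
        gcongr
        · exact hm i j
        · exact hm j i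
  have hb : ∀ i j, (5 / 4 : ℝ) ^ (h.step i j).branchCount =
      (1 + if i = j then 1 / 4 else 0) * (5 / 4) ^ h.branchCount := by
    intro i j
    rw [branchCount_step]
    split_ifs
    · rw [pow_succ]; ring
    · simp
  -- There are (n - 1)² pairs that avoid `q 3`, and the n - 1 diagonal ones weigh 5/4: (n - 1)(n - 1
  -- + 1/4) ≤ n(n - 1).
  have hs : ∀ q : Fin 5 → Fin n, ∑ i, ∑ j, ((if q 3 ≠ i then 1 else 0) *
      (if q 3 ≠ j then 1 else 0) * (1 + if i = j then 1 / 4 else 0) : ℝ) ≤ n * (n - 1) := by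
    intro q
    have hn : (1 : ℝ) ≤ n := by exact_mod_cast (q 3).pos
    have e1 : ∑ i, (if q 3 ≠ i then 1 else 0 : ℝ) = n - 1 := by
      have : ∀ i, (if q 3 ≠ i then 1 else 0 : ℝ) = 1 - if q 3 = i then 1 else 0 := by
        intro i; split_ifs <;> simp_all
      simp [this, Finset.sum_sub_distrib]
    have e2 : ∀ i, ∑ j, ((if q 3 ≠ i then 1 else 0) *
        (if q 3 ≠ j then 1 else 0) * (1 + if i = j then 1 / 4 else 0) : ℝ) =
        (if q 3 ≠ i then 1 else 0) * (n - 1 + 1 / 4) := by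
      intro i
      have : ∀ j, ((if q 3 ≠ i then 1 else 0) *
          (if q 3 ≠ j then 1 else 0) * (1 + if i = j then 1 / 4 else 0) : ℝ) =
          (if q 3 ≠ i then 1 else 0) * (if q 3 ≠ j then 1 else 0) +
          if i = j then (if q 3 ≠ i then 1 / 4 else 0) else 0 := by
        intro j; split_ifs <;> simp_all
      rw [Finset.sum_congr rfl fun j _ => this j, Finset.sum_add_distrib, ← Finset.mul_sum, e1,
        Finset.sum_ite_eq, if_pos (Finset.mem_univ _)]
      split_ifs <;> ring
    rw [Finset.sum_congr rfl fun i _ => e2 i, ← Finset.sum_mul, e1]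
    nlinarith
  -- Both entries range over the 2c cherry lineages: 2 · (2c)² · 5/4 = 10c². The factor 5/4 bounds
  -- the growth of the weight in one step.
  have hc : ∑ i, ∑ j, (2 * ((if i ∈ h.stage.cherryLineages then 1 else 0) *
        (if j ∈ h.stage.cherryLineages then 1 else 0)) * (5 / 4) : ℝ) =
        10 * h.cherryCount ^ 2 := by
    simp only [← Finset.sum_mul, ← Finset.mul_sum]
    simp only [Finset.sum_ite_mem, Finset.univ_inter, Finset.sum_const, nsmul_eq_mul,
      h.binary.card_cherryLineages, cherryCount]
    push_cast
    ring
  calc _ ≤ ∑ i, ∑ j, ((∑ q ∈ h.stage.doubles, (if q 3 ≠ i then 1 else 0) *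
          (if q 3 ≠ j then 1 else 0) * (1 + if i = j then 1 / 4 else 0)) +
        2 * ((if i ∈ h.stage.cherryLineages then 1 else 0) *
          (if j ∈ h.stage.cherryLineages then 1 else 0)) * (5 / 4)) *
          (5 / 4 : ℝ) ^ h.branchCount := by
        refine Finset.sum_le_sum fun i _ => Finset.sum_le_sum fun j _ => ?_
        rw [hb, ← mul_assoc, ← Finset.sum_mul]
        gcongr
        refine (mul_le_mul_of_nonneg_right (h1 i j) (by positivity)).trans ?_
        rw [add_mul]
        gcongr
        split_ifs <;> norm_num
    _ = ((∑ q ∈ h.stage.doubles, ∑ i, ∑ j, (if q 3 ≠ i then 1 else 0) *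
          (if q 3 ≠ j then 1 else 0) * (1 + if i = j then 1 / 4 else 0)) +
          10 * h.cherryCount ^ 2) * (5 / 4 : ℝ) ^ h.branchCount := by
        simp only [← Finset.sum_mul, Finset.sum_add_distrib]
        congr 2
        · rw [Finset.sum_comm' (t' := Finset.univ) (s' := fun _ => h.stage.doubles) (by simp)]
          refine Finset.sum_congr rfl fun i _ => ?_
          rw [Finset.sum_comm' (t' := Finset.univ) (s' := fun _ => h.stage.doubles) (by simp)]
          exact Finset.sum_congr rfl fun j _ => Finset.sum_mul _ _ _
        · rw [← hc]
          simp only [Finset.sum_mul]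
    _ ≤ (∑ q ∈ h.stage.doubles, (n * (n - 1) : ℝ) +
          10 * h.cherryCount ^ 2) * (5 / 4 : ℝ) ^ h.branchCount := by
        gcongr with q
        exact hs q
    _ = _ := by
        rw [Finset.sum_const, nsmul_eq_mul, doubleCount]
        ring

theorem doubleCount_start : doubleCount start = 0 := by
  refine Finset.card_eq_zero.2 (Finset.eq_empty_of_forall_notMem fun q hq => ?_)
  have : true = false := (Stage.mem_doubles.1 hq).1.1
  simp at this

/-- For the weighted mean E_n of double patterns, the one-step bound gives n E_{n+1} ≤ (n - 1) E_n +
O(1/√n). So (n - 1) E_n is bounded by a sum of terms 1/√k, of order √n. -/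
theorem sub_one_mul_mean_doubleCount_le (hn : 2 ≤ n) :
    (n - 1) * mean (fun h : Evolution n => h.doubleCount * (5 / 4 : ℝ) ^ h.branchCount) ≤
      2400000 * √n := by
  induction n, hn using Nat.le_induction with
  | base =>
    rw [mean_two, doubleCount_start]
    simp
  | succ n hn ih =>
    have hn' : (2 : ℝ) ≤ n := by exact_mod_cast hn
    have hs : 0 < √(n : ℝ) := Real.sqrt_pos.2 (by linarith)
    have hs2 : √(n : ℝ) * √(n : ℝ) = n := Real.mul_self_sqrt (by linarith)
    have h1 : mean (fun h : Evolution (n + 1) => h.doubleCount * (5 / 4 : ℝ) ^ h.branchCount) ≤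
        (n - 1) / n * mean (fun h : Evolution n => h.doubleCount * (5 / 4 : ℝ) ^ h.branchCount) +
        400000 / n ^ 2 * mean (fun h : Evolution n => (3 / 2 : ℝ) ^ h.branchCount) := by
      rw [mean_succ hn, ← mean_mul, ← mean_mul, ← mean_add]
      refine mean_mono fun h => ?_
      have hc : (10 * h.cherryCount ^ 2 : ℝ) * (5 / 4) ^ h.branchCount ≤
          400000 * (3 / 2) ^ h.branchCount := by
        have h1 := sq_mul_pow_le h.branchCount
        have h2 : (h.cherryCount : ℝ) ≤ 1 + 16 * h.branchCount := by
          have := h.specials_bound_le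
          have : h.cherryCount ≤ 1 + 16 * h.branchCount := by omega
          exact_mod_cast this
        calc (10 * h.cherryCount ^ 2 : ℝ) * (5 / 4) ^ h.branchCount
            ≤ (10 * (1 + 16 * h.branchCount) ^ 2 : ℝ) * (5 / 4) ^ h.branchCount := by gcongr
          _ ≤ _ := by linarith
      rw [smul_eq_mul, inv_mul_le_iff₀ (by positivity)]
      refine h.sum_doubleCount_step_le.trans ?_
      have : (n : ℝ) ^ 2 * ((n - 1) / n * (h.doubleCount * (5 / 4 : ℝ) ^ h.branchCount) +
          400000 / n ^ 2 * (3 / 2 : ℝ) ^ h.branchCount) =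
          n * (n - 1) * (h.doubleCount * (5 / 4 : ℝ) ^ h.branchCount) +
          400000 * (3 / 2 : ℝ) ^ h.branchCount := by field_simp
      rw [this]
      linarith
    have h2 := mean_pow_branchCount_le hn
    have h3 : √((n : ℝ) - 1) ≤ √n := Real.sqrt_le_sqrt (by linarith)
    -- This makes the increments telescope; it uses √(n+1) + √n ≤ 3√n.
    have h4 : 1 / (3 * √(n : ℝ)) ≤ √(n + 1 : ℝ) - √n := by
      have h5 : √(n + 1 : ℝ) ≤ 2 * √n := by
        rw [Real.sqrt_le_left (by positivity), mul_pow, Real.sq_sqrt (by linarith)]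
        linarith
      have h6 : √(n + 1 : ℝ) * √(n + 1 : ℝ) = n + 1 := Real.mul_self_sqrt (by linarith)
      have h7 : √(n : ℝ) ≤ √(n + 1 : ℝ) := Real.sqrt_le_sqrt (by linarith)
      rw [div_le_iff₀ (by positivity)]
      nlinarith
    push_cast
    rw [add_sub_cancel_right]
    have h8 : (n : ℝ) * (400000 / n ^ 2 * (2 * √n)) = 2400000 * (1 / (3 * √n)) := by
      field_simp
      rw [show √(n : ℝ) ^ 2 = n by rw [sq, hs2]]
      ring
    calc (n : ℝ) * mean (fun h : Evolution (n + 1) =>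
          h.doubleCount * (5 / 4 : ℝ) ^ h.branchCount)
        ≤ n * ((n - 1) / n * mean (fun h : Evolution n =>
            h.doubleCount * (5 / 4 : ℝ) ^ h.branchCount) + 400000 / n ^ 2 * (2 * √n)) := by
          refine mul_le_mul_of_nonneg_left (h1.trans ?_) (by linarith)
          gcongr
          linarith
      _ = (n - 1) * mean (fun h : Evolution n =>
            h.doubleCount * (5 / 4 : ℝ) ^ h.branchCount) + 2400000 * (1 / (3 * √n)) := by
          rw [mul_add, h8]
          field_simp
      _ ≤ 2400000 * √(n + 1 : ℝ) := by linarith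

theorem mean_doubleCount_le (hn : 2 ≤ n) :
    mean (fun h : Evolution n => h.doubleCount * (5 / 4 : ℝ) ^ h.branchCount) ≤
      4800000 / √n := by
  have hn' : (2 : ℝ) ≤ n := by exact_mod_cast hn
  have hs : 0 < √(n : ℝ) := Real.sqrt_pos.2 (by linarith)
  have hs2 : √(n : ℝ) * √(n : ℝ) = n := Real.mul_self_sqrt (by linarith)
  have h := sub_one_mul_mean_doubleCount_le hn
  have h0 : 0 ≤ mean (fun h : Evolution n => h.doubleCount * (5 / 4 : ℝ) ^ h.branchCount) :=
    mean_nonneg fun h => by positivity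
  rw [le_div_iff₀ hs]
  have h1 : (n / 2 : ℝ) * mean (fun h : Evolution n =>
      h.doubleCount * (5 / 4 : ℝ) ^ h.branchCount) ≤ 2400000 * √n :=
    le_trans (by gcongr; linarith) h
  have h2 : √(n : ℝ) * (mean (fun h : Evolution n =>
      h.doubleCount * (5 / 4 : ℝ) ^ h.branchCount) * √n) ≤ √n * 4800000 := by
    calc _ = √n * √n * mean (fun h : Evolution n =>
          h.doubleCount * (5 / 4 : ℝ) ^ h.branchCount) := by ring
      _ = n * mean (fun h : Evolution n => h.doubleCount * (5 / 4 : ℝ) ^ h.branchCount) := by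
          rw [hs2]
      _ ≤ _ := by linarith
  exact le_of_mul_le_mul_left h2 hs

end Evolution
end RTCN

namespace RTCN

/-! ### Generating functions -/

theorem norm_pow_sub_pow_le {a b : ℂ} (ha : ‖a‖ ≤ 1) (hb : ‖b‖ ≤ 1) (n : ℕ) :
    ‖b ^ n - a ^ n‖ ≤ n * ‖b - a‖ := by
  induction n with
  | zero => simp
  | succ n ih =>
    have h : b ^ (n + 1) - a ^ (n + 1) = b * (b ^ n - a ^ n) + a ^ n * (b - a) := by ring
    have h1 : ‖a ^ n‖ ≤ 1 := by rw [norm_pow]; exact pow_le_one₀ (norm_nonneg a) ha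
    rw [h]
    refine (norm_add_le _ _).trans ?_
    rw [norm_mul, norm_mul]
    push_cast
    nlinarith [mul_le_mul hb ih (norm_nonneg _) zero_le_one,
      mul_le_mul_of_nonneg_right h1 (norm_nonneg (b - a))]

theorem norm_pow_sub_pow_sub_le {a b : ℂ} (ha : ‖a‖ ≤ 1) (hb : ‖b‖ ≤ 1) (n : ℕ) :
    ‖b ^ n - a ^ n - n * a ^ (n - 1) * (b - a)‖ ≤ n ^ 2 * ‖b - a‖ ^ 2 := by
  induction n with
  | zero => simp
  | succ n ih =>
    -- The remainder is multiplied by b and gains n a^(n-1) (b - a)²; the bound closes since n² + n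
    -- ≤ (n + 1)².
    have h : b ^ (n + 1) - a ^ (n + 1) - (n + 1 : ℕ) * a ^ (n + 1 - 1) * (b - a) =
        b * (b ^ n - a ^ n - n * a ^ (n - 1) * (b - a)) +
          n * (a ^ (n - 1) * ((b - a) * (b - a))) := by
      rcases n with _ | n
      · simp
      · simp only [Nat.add_sub_cancel]
        push_cast
        ring
    have h1 : ‖a ^ (n - 1)‖ ≤ 1 := by rw [norm_pow]; exact pow_le_one₀ (norm_nonneg a) ha
    rw [h]
    refine (norm_add_le _ _).trans ?_
    rw [norm_mul, norm_mul, norm_mul, norm_mul, Complex.norm_natCast]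
    have h2 := mul_le_mul hb ih (norm_nonneg _) zero_le_one
    have h3 : (n : ℝ) * (‖a ^ (n - 1)‖ * (‖b - a‖ * ‖b - a‖)) ≤ n * (1 * (‖b - a‖ * ‖b - a‖)) := by
      gcongr
    push_cast
    have h4 : (0 : ℝ) ≤ (n + 1) * ‖b - a‖ ^ 2 := by positivity
    nlinarith

/-- The function whose mean is the joint probability generating function. -/
noncomputable def monomialFun (s t : ℂ) (x c : ℕ) : ℂ := s ^ x * t ^ c

theorem norm_monomialFun_le {s t : ℂ} (hs : ‖s‖ ≤ 1) (ht : ‖t‖ ≤ 1) (x c : ℕ) :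
    ‖monomialFun s t x c‖ ≤ 1 := by
  rw [monomialFun, norm_mul, norm_pow, norm_pow]
  exact mul_le_one₀ (pow_le_one₀ (norm_nonneg s) hs) (by positivity)
    (pow_le_one₀ (norm_nonneg t) ht)

theorem norm_monomialFun_sub_le {s t s' t' : ℂ} (hs : ‖s‖ ≤ 1) (ht : ‖t‖ ≤ 1) (hs' : ‖s'‖ ≤ 1)
    (ht' : ‖t'‖ ≤ 1) (x c : ℕ) :
    ‖monomialFun s' t' x c - monomialFun s t x c‖ ≤ x * ‖s' - s‖ + c * ‖t' - t‖ := by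
  have h : monomialFun s' t' x c - monomialFun s t x c =
      (s' ^ x - s ^ x) * t' ^ c + s ^ x * (t' ^ c - t ^ c) := by
    simp only [monomialFun]; ring
  have h1 : ‖t' ^ c‖ ≤ 1 := by rw [norm_pow]; exact pow_le_one₀ (norm_nonneg t') ht'
  have h2 : ‖s ^ x‖ ≤ 1 := by rw [norm_pow]; exact pow_le_one₀ (norm_nonneg s) hs
  rw [h]
  refine (norm_add_le _ _).trans ?_
  rw [norm_mul, norm_mul]
  have h3 := norm_pow_sub_pow_le hs hs' x
  have h4 := norm_pow_sub_pow_le ht ht' c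
  refine add_le_add ((mul_le_of_le_one_right (norm_nonneg _) h1).trans h3)
    ((mul_le_of_le_one_left (norm_nonneg _) h2).trans h4)

theorem norm_monomialFun_sub_sub_le {s t s' t' : ℂ} (hs : ‖s‖ ≤ 1) (ht : ‖t‖ ≤ 1)
    (hs' : ‖s'‖ ≤ 1) (ht' : ‖t'‖ ≤ 1) (x c : ℕ) :
    ‖monomialFun s' t' x c - monomialFun s t x c - (x * s ^ (x - 1) * (s' - s) * t ^ c +
      s ^ x * (c * t ^ (c - 1) * (t' - t)))‖ ≤ (x * ‖s' - s‖ + c * ‖t' - t‖) ^ 2 := by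
  have h : monomialFun s' t' x c - monomialFun s t x c - (x * s ^ (x - 1) * (s' - s) * t ^ c +
      s ^ x * (c * t ^ (c - 1) * (t' - t))) =
      (s' ^ x - s ^ x - x * s ^ (x - 1) * (s' - s)) * t ^ c +
      s ^ x * (t' ^ c - t ^ c - c * t ^ (c - 1) * (t' - t)) +
      (s' ^ x - s ^ x) * (t' ^ c - t ^ c) := by
    simp only [monomialFun]; ring
  have h1 : ‖t ^ c‖ ≤ 1 := by rw [norm_pow]; exact pow_le_one₀ (norm_nonneg t) ht
  have h2 : ‖s ^ x‖ ≤ 1 := by rw [norm_pow]; exact pow_le_one₀ (norm_nonneg s) hs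
  rw [h]
  refine (norm_add₃_le).trans ?_
  rw [norm_mul, norm_mul, norm_mul]
  have h3 := norm_pow_sub_pow_sub_le hs hs' x
  have h4 := norm_pow_sub_pow_sub_le ht ht' c
  have h5 := mul_le_mul (norm_pow_sub_pow_le hs hs' x) (norm_pow_sub_pow_le ht ht' c)
    (norm_nonneg _) (by positivity)
  have h6 := (mul_le_of_le_one_right (norm_nonneg _) h1).trans h3
  have h7 := (mul_le_of_le_one_left (norm_nonneg _) h2).trans h4
  have h8 : 0 ≤ (x * ‖s' - s‖) * (c * ‖t' - t‖) := by positivity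
  nlinarith

/-- The shift of the first argument of the generating function in one step. -/
noncomputable def shiftLeft (n : ℕ) (s : ℂ) : ℂ := s + 8 / n * (1 - s)

/-- The shift of the second argument of the generating function in one step. -/
noncomputable def shiftRight (n : ℕ) (s t : ℂ) : ℂ := t + 4 / n * (s - t)

/-- The shifts are convex combinations with weights 8/n and 4/n. For n ≥ 8 they preserve the unit
disc. -/
theorem norm_convexComb_le {a b : ℂ} {r M : ℝ} (h0 : 0 ≤ r) (h1 : r ≤ 1) (ha : ‖a‖ ≤ M)
    (hb : ‖b‖ ≤ M) : ‖a + r * (b - a)‖ ≤ M := by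
  have h : a + r * (b - a) = ((1 - r : ℝ) : ℂ) * a + r * b := by push_cast; ring
  rw [h]
  refine (norm_add_le _ _).trans ?_
  rw [norm_mul, norm_mul, Complex.norm_of_nonneg (sub_nonneg.2 h1), Complex.norm_of_nonneg h0]
  nlinarith

section

variable {n : ℕ} {s t : ℂ}

theorem norm_shiftLeft_le (hn : 8 ≤ n) (hs : ‖s‖ ≤ 1) : ‖shiftLeft n s‖ ≤ 1 := by
  have hn' : (8 : ℝ) ≤ n := by exact_mod_cast hn
  have := norm_convexComb_le (a := s) (b := 1) (r := 8 / n) (M := 1) (by positivity)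
    (by rw [div_le_one (by linarith)]; exact hn') hs (by simp)
  simpa [shiftLeft] using this

theorem norm_shiftRight_le (hn : 8 ≤ n) (hs : ‖s‖ ≤ 1) (ht : ‖t‖ ≤ 1) :
    ‖shiftRight n s t‖ ≤ 1 := by
  have hn' : (8 : ℝ) ≤ n := by exact_mod_cast hn
  have := norm_convexComb_le (a := t) (b := s) (r := 4 / n) (M := 1) (by positivity)
    (by rw [div_le_one (by linarith)]; linarith) ht hs
  simpa [shiftRight] using this

/-- The first coordinate loses 8/n of its distance to 1, of which at most one half reappears in the
second coordinate, which itself loses 4/n. -/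
theorem norm_one_sub_shift_add_le (hn : 8 ≤ n) :
    ‖1 - shiftLeft n s‖ + ‖1 - shiftRight n s t‖ ≤ (1 - 4 / n) * (‖1 - s‖ + ‖1 - t‖) := by
  have hn' : (8 : ℝ) ≤ n := by exact_mod_cast hn
  have e1 : 1 - shiftLeft n s = ((1 - 8 / n : ℝ) : ℂ) * (1 - s) := by
    simp only [shiftLeft]; push_cast; ring
  have e2 : 1 - shiftRight n s t = ((1 - 4 / n : ℝ) : ℂ) * (1 - t) +
      ((4 / n : ℝ) : ℂ) * (1 - s) := by
    simp only [shiftRight]; push_cast; ring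
  have h8 : (8 : ℝ) / n ≤ 1 := by rw [div_le_one (by linarith)]; exact hn'
  have h4 : (4 : ℝ) / n ≤ 1 := by rw [div_le_one (by linarith)]; linarith
  have h3 : ‖1 - shiftRight n s t‖ ≤ (1 - 4 / n) * ‖1 - t‖ + 4 / n * ‖1 - s‖ := by
    rw [e2]
    refine (norm_add_le _ _).trans ?_
    rw [norm_mul, norm_mul, Complex.norm_of_nonneg (sub_nonneg.2 h4),
      Complex.norm_of_nonneg (by positivity)]
  rw [e1, norm_mul, Complex.norm_of_nonneg (sub_nonneg.2 h8)]
  have : (8 : ℝ) / n = 4 / n + 4 / n := by ring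
  rw [this]
  linarith

theorem norm_shiftLeft_sub_le (hs : ‖s‖ ≤ 1) : ‖shiftLeft n s - s‖ ≤ 16 / n := by
  have h : ‖(1 : ℂ) - s‖ ≤ 2 := Evolution.norm_sub_le_two (by simp) hs
  rw [shiftLeft, add_sub_cancel_left, norm_mul, norm_div, Complex.norm_natCast, Complex.norm_ofNat]
  calc (8 : ℝ) / n * ‖1 - s‖ ≤ 8 / n * 2 := by gcongr
    _ = 16 / n := by ring

theorem norm_shiftRight_sub_le (hs : ‖s‖ ≤ 1) (ht : ‖t‖ ≤ 1) :
    ‖shiftRight n s t - t‖ ≤ 8 / n := by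
  have h : ‖s - t‖ ≤ 2 := Evolution.norm_sub_le_two hs ht
  rw [shiftRight, add_sub_cancel_left, norm_mul, norm_div, Complex.norm_natCast,
    Complex.norm_ofNat]
  calc (4 : ℝ) / n * ‖s - t‖ ≤ 4 / n * 2 := by gcongr
    _ = 8 / n := by ring

/-- On monomials the generator is (t - 1) + 8(1 - s) ∂_s + 4(s - t) ∂_t. The derivative terms are
the linear part of the shift of the arguments. -/
theorem generator_monomialFun (n : ℕ) (x c : ℕ) :
    Evolution.generator (monomialFun s t) x c / n = (t - 1) / n * monomialFun s t x c +
      (x * s ^ (x - 1) * (shiftLeft n s - s) * t ^ c +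
        s ^ x * (c * t ^ (c - 1) * (shiftRight n s t - t))) := by
  simp only [Evolution.generator, monomialFun, shiftLeft, shiftRight, add_sub_cancel_left]
  -- At 0 the truncated exponents do no harm, as their coefficients x and c vanish.
  rcases x with _ | x <;> rcases c with _ | c <;>
    simp only [Nat.add_sub_cancel, Nat.cast_zero, zero_add, mul_zero, zero_mul, add_zero] <;>
    push_cast <;> ring

variable (x c : ℕ)

theorem norm_shift_monomialFun_sub_le (hn : 8 ≤ n) (hs : ‖s‖ ≤ 1) (ht : ‖t‖ ≤ 1) :
    ‖monomialFun (shiftLeft n s) (shiftRight n s t) x c - monomialFun s t x c‖ ≤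
      16 * (x + c) / n := by
  refine (norm_monomialFun_sub_le hs ht (norm_shiftLeft_le hn hs)
    (norm_shiftRight_le hn hs ht) x c).trans ?_
  calc x * ‖shiftLeft n s - s‖ + c * ‖shiftRight n s t - t‖ ≤ x * (16 / n) + c * (8 / n) := by
        gcongr
        · exact norm_shiftLeft_sub_le hs
        · exact norm_shiftRight_sub_le hs ht
    _ ≤ x * (16 / n) + c * (16 / n) := by gcongr; norm_num
    _ = 16 * (x + c) / n := by ring

/-- What remains is the second-order Taylor remainder of the shift and the product of the two
first-order changes. -/
theorem norm_shift_monomialFun_sub_generator_le (hn : 8 ≤ n) (hs : ‖s‖ ≤ 1) (ht : ‖t‖ ≤ 1) :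
    ‖(1 + (t - 1) / n) * monomialFun (shiftLeft n s) (shiftRight n s t) x c -
      (monomialFun s t x c + Evolution.generator (monomialFun s t) x c / n)‖ ≤
      288 * (1 + x + c) ^ 2 / n ^ 2 := by
  have hn' : (8 : ℝ) ≤ n := by exact_mod_cast hn
  have h1 := norm_monomialFun_sub_sub_le hs ht (norm_shiftLeft_le hn hs)
    (norm_shiftRight_le hn hs ht) x c
  have h2 := norm_shift_monomialFun_sub_le x c hn hs ht
  have h3 : ‖(t - 1) / n‖ ≤ 2 / n := by
    rw [norm_div, Complex.norm_natCast]
    gcongr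
    exact Evolution.norm_sub_le_two ht (by simp)
  have h4 : x * ‖shiftLeft n s - s‖ + c * ‖shiftRight n s t - t‖ ≤ 16 * (x + c) / n := by
    calc x * ‖shiftLeft n s - s‖ + c * ‖shiftRight n s t - t‖ ≤ x * (16 / n) + c * (8 / n) := by
          gcongr
          · exact norm_shiftLeft_sub_le hs
          · exact norm_shiftRight_sub_le hs ht
      _ ≤ x * (16 / n) + c * (16 / n) := by gcongr; norm_num
      _ = 16 * (x + c) / n := by ring
  rw [generator_monomialFun]
  set f := monomialFun s t x c
  set g := monomialFun (shiftLeft n s) (shiftRight n s t) x c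
  set w : ℂ := x * s ^ (x - 1) * (shiftLeft n s - s) * t ^ c +
        s ^ x * (c * t ^ (c - 1) * (shiftRight n s t - t))
  have e : (1 + (t - 1) / n) * g - (f + ((t - 1) / n * f + w)) =
      (g - f - w) + (t - 1) / n * (g - f) := by ring
  rw [e]
  refine (norm_add_le _ _).trans ?_
  rw [norm_mul]
  calc ‖g - f - w‖ + ‖(t - 1) / n‖ * ‖g - f‖
      ≤ (16 * (x + c) / n) ^ 2 + 2 / n * (16 * (x + c) / n) := by
        gcongr
        exact h1.trans (by gcongr)
    _ = (256 * (x + c) ^ 2 + 32 * (x + c)) / n ^ 2 := by ring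
    _ ≤ 288 * (1 + x + c) ^ 2 / n ^ 2 := by
        gcongr
        have hx : (0 : ℝ) ≤ x := x.cast_nonneg
        have hc : (0 : ℝ) ≤ c := c.cast_nonneg
        nlinarith [mul_nonneg hx hc]

end

/-! ### The recursions of the generating function and of its limit -/

namespace Evolution

variable {n : ℕ} {s t : ℂ}

theorem sum_step_eq (h : Evolution n) (hn : 2 ≤ n) (f : ℕ → ℕ → ℂ) :
    ((n : ℝ) ^ 2)⁻¹ • ∑ i, ∑ j, f (h.step i j).hitCount (h.step i j).cherryCount =
      f h.hitCount h.cherryCount + ((n : ℂ) ^ 2)⁻¹ * ∑ i, ∑ j,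
        (f (h.step i j).hitCount (h.step i j).cherryCount - f h.hitCount h.cherryCount) := by
  have : (n : ℂ) ≠ 0 := by
    have : n ≠ 0 := by omega
    exact_mod_cast this
  simp only [Finset.sum_sub_distrib, Finset.sum_const, Finset.card_univ, Fintype.card_fin,
    nsmul_eq_mul, Complex.real_smul]
  push_cast
  field_simp
  ring

theorem norm_sum_step_monomialFun_sub_le (h : Evolution n) (hn : 8 ≤ n) (hs : ‖s‖ ≤ 1)
    (ht : ‖t‖ ≤ 1) :
    ‖((n : ℝ) ^ 2)⁻¹ • ∑ i, ∑ j, monomialFun s t (h.step i j).hitCount (h.step i j).cherryCount -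
      (1 + (t - 1) / n) *
        monomialFun (shiftLeft n s) (shiftRight n s t) h.hitCount h.cherryCount‖ ≤
      12000000 / n ^ 2 * (3 / 2) ^ h.branchCount +
        1200 / n * (h.doubleCount * (5 / 4) ^ h.branchCount) := by
  have hn' : (8 : ℝ) ≤ n := by exact_mod_cast hn
  rw [sum_step_eq h (by omega)]
  set x := h.hitCount with hx
  set c := h.cherryCount with hc
  set B := h.branchCount with hB
  have ha : 2 * c + 4 * x ≤ 8 * B := h.specials_bound_le
  have ha' : ((2 * c + 4 * x : ℕ) : ℝ) ≤ 8 * B := by exact_mod_cast ha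
  have hxB : (1 + x + c : ℝ) ≤ 1 + 16 * B := by
    have : 1 + x + c ≤ 1 + 16 * B := by omega
    exact_mod_cast this
  have hf := norm_monomialFun_le hs ht
  have hsq : (1 + 16 * B : ℝ) ^ 2 ≤ 40000 * (3 / 2) ^ B :=
    le_trans (le_mul_of_one_le_right (by positivity) (one_le_pow₀ (by norm_num)))
      (sq_mul_pow_le B)
  -- Without double patterns the generator approximation is accurate to order n⁻²: the constant is
  -- (8 + 288) · 40000 ≤ 12000000. Otherwise all terms are bounded crudely by order 1/n, and
  -- `doubleCount`, being at least 1, is inserted as a factor.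
  by_cases hd : h.doubleCount = 0
  · have h1 := h.norm_sum_step_sub_generator_le hd _ hf
    have h2 := norm_shift_monomialFun_sub_generator_le x c hn hs ht
    rw [← hx, ← hc] at h1
    set f := monomialFun s t x c
    set g := (1 + (t - 1) / n) * monomialFun (shiftLeft n s) (shiftRight n s t) x c
    set G := generator (monomialFun s t) x c
    set S := ∑ i, ∑ j, (monomialFun s t (h.step i j).hitCount (h.step i j).cherryCount - f)
    have hn0 : (n : ℂ) ≠ 0 := by
      have : n ≠ 0 := by omega
      exact_mod_cast this
    have e : f + ((n : ℂ) ^ 2)⁻¹ * S - g = ((n : ℂ) ^ 2)⁻¹ * (S - n * G) - (g - (f + G / n)) := by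
      field_simp
      ring
    rw [e, hd]
    refine (norm_sub_le _ _).trans ?_
    rw [norm_mul, norm_inv, norm_pow, Complex.norm_natCast]
    calc ((n : ℝ) ^ 2)⁻¹ * ‖S - n * G‖ + ‖g - (f + G / n)‖
        ≤ ((n : ℝ) ^ 2)⁻¹ * (8 * (1 + 16 * B) ^ 2) + 288 * (1 + 16 * B) ^ 2 / n ^ 2 := by
          gcongr
          · refine h1.trans ?_
            gcongr
            linarith [(B.cast_nonneg : (0 : ℝ) ≤ B)]
          · refine h2.trans ?_
            gcongr
      _ = 296 / n ^ 2 * (1 + 16 * B) ^ 2 := by ring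
      _ ≤ 296 / n ^ 2 * (40000 * (3 / 2) ^ B) := by gcongr
      _ ≤ 12000000 / n ^ 2 * (3 / 2) ^ B + 1200 / n * ((0 : ℕ) * (5 / 4) ^ B) := by
          rw [Nat.cast_zero, zero_mul, mul_zero, add_zero, ← mul_assoc]
          gcongr ?_ * _
          rw [div_mul_eq_mul_div]
          gcongr
          norm_num
  · have h1 := h.norm_sum_step_sub_le _ hf
    have h2 := norm_shift_monomialFun_sub_le x c hn hs ht
    have hg := norm_monomialFun_le (norm_shiftLeft_le hn hs) (norm_shiftRight_le hn hs ht) x c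
    rw [← hx, ← hc] at h1
    set f := monomialFun s t x c
    set g := monomialFun (shiftLeft n s) (shiftRight n s t) x c
    set S := ∑ i, ∑ j, (monomialFun s t (h.step i j).hitCount (h.step i j).cherryCount - f)
    have e : f + ((n : ℂ) ^ 2)⁻¹ * S - (1 + (t - 1) / n) * g =
        ((n : ℂ) ^ 2)⁻¹ * S - (g - f) - (t - 1) / n * g := by ring
    have h3 : ‖(t - 1) / n * g‖ ≤ 2 / n := by
      rw [norm_mul, norm_div, Complex.norm_natCast]
      refine (mul_le_of_le_one_right (by positivity) hg).trans ?_
      gcongr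
      exact norm_sub_le_two ht (by simp)
    have hb : (1 + 16 * B : ℝ) ≤ 64 * (5 / 4) ^ B := by
      have := one_add_mul_le_pow (show (-2 : ℝ) ≤ 1 / 4 by norm_num) B
      rw [show (1 + 1 / 4 : ℝ) = 5 / 4 by norm_num] at this
      linarith
    have hd1 : (1 : ℝ) ≤ h.doubleCount := by exact_mod_cast Nat.one_le_iff_ne_zero.2 hd
    have hn0 : (n : ℝ) ≠ 0 := by linarith
    rw [e]
    refine (norm_sub_le _ _).trans ((add_le_add_left (norm_sub_le _ _) _).trans ?_)
    rw [norm_mul, norm_inv, norm_pow, Complex.norm_natCast]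
    calc ((n : ℝ) ^ 2)⁻¹ * ‖S‖ + ‖g - f‖ + ‖(t - 1) / n * g‖
        ≤ ((n : ℝ) ^ 2)⁻¹ * (2 * n * (1 + 2 * (8 * B))) + 16 * (x + c) / n + 2 / n := by
          gcongr
          exact h1.trans (by gcongr)
      _ = (2 * (1 + 16 * B) + 16 * (x + c) + 2) / n := by
          field_simp
          ring
      _ ≤ (18 * (1 + 16 * B)) / n := by
          gcongr
          linarith [(B.cast_nonneg : (0 : ℝ) ≤ B)]
      _ ≤ 1200 * (5 / 4) ^ B / n := by
          refine div_le_div_of_nonneg_right ?_ (by linarith)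
          have : (0 : ℝ) < (5 / 4) ^ B := by positivity
          linarith
      _ = 1200 / n * (1 * (5 / 4) ^ B) := by ring
      _ ≤ 1200 / n * (h.doubleCount * (5 / 4) ^ B) := by gcongr
      _ ≤ _ := by
          have : (0 : ℝ) ≤ 12000000 / n ^ 2 * (3 / 2) ^ B := by positivity
          linarith

/-- The joint probability generating function of the numbers of patterns. -/
noncomputable def genFun (n : ℕ) (s t : ℂ) : ℂ :=
  mean fun h : Evolution n => monomialFun s t h.hitCount h.cherryCount

theorem norm_genFun_succ_sub_le (hn : 8 ≤ n) (hs : ‖s‖ ≤ 1) (ht : ‖t‖ ≤ 1) :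
    ‖genFun (n + 1) s t - (1 + (t - 1) / n) * genFun n (shiftLeft n s) (shiftRight n s t)‖ ≤
      10 ^ 10 / (n * √n) := by
  have hn' : (8 : ℝ) ≤ n := by exact_mod_cast hn
  have hsn : 0 < √(n : ℝ) := Real.sqrt_pos.2 (by linarith)
  have hs2 : √(n : ℝ) * √(n : ℝ) = n := Real.mul_self_sqrt (by linarith)
  rw [genFun, genFun, mean_succ (by omega), ← mean_mul_complex, ← mean_sub]
  refine (norm_mean_le _).trans
    ((mean_mono fun h => h.norm_sum_step_monomialFun_sub_le hn hs ht).trans ?_)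
  rw [mean_add, mean_mul, mean_mul]
  have h1 := mean_pow_branchCount_le (n := n) (by omega)
  have h2 := mean_doubleCount_le (n := n) (by omega)
  have h3 : √((n : ℝ) - 1) ≤ √n := Real.sqrt_le_sqrt (by linarith)
  calc _ ≤ 12000000 / (n : ℝ) ^ 2 * (2 * √n) + 1200 / n * (4800000 / √n) := by
        gcongr
        linarith
    _ = 5784000000 / (n * √n) := by
        have : 12000000 / (n : ℝ) ^ 2 * (2 * √n) = 24000000 / (n * √n) := by
          rw [div_mul_eq_mul_div, div_eq_div_iff (by positivity) (by positivity)]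
          calc 12000000 * (2 * √n) * (n * √n) = 24000000 * n * (√(n : ℝ) * √n) := by ring
            _ = 24000000 * n ^ 2 := by rw [hs2]; ring
        rw [this]
        field_simp
        norm_num
    _ ≤ _ := by
        gcongr
        norm_num

/-- The joint probability generating function of the limit. -/
noncomputable def limitGenFun (s t : ℂ) : ℂ := Complex.exp ((s - 1) / 8 + (t - 1) / 4)

/-- Stationarity of the Poisson law: the shift multiplies the limit exactly by exp(w) with w = (1 -
t)/n, and (1 - w) exp(w) = 1 + O(w²). -/
theorem norm_limitGenFun_sub_le (hn : 8 ≤ n) (hs : ‖s‖ ≤ 1) (ht : ‖t‖ ≤ 1) :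
    ‖limitGenFun s t - (1 + (t - 1) / n) * limitGenFun (shiftLeft n s) (shiftRight n s t)‖ ≤
      12 / (n * √n) := by
  have hn' : (8 : ℝ) ≤ n := by exact_mod_cast hn
  have hsn : 0 < √(n : ℝ) := Real.sqrt_pos.2 (by linarith)
  have hs2 : √(n : ℝ) * √(n : ℝ) = n := Real.mul_self_sqrt (by linarith)
  have hn0 : (n : ℂ) ≠ 0 := by
    have : n ≠ 0 := by omega
    exact_mod_cast this
  set w : ℂ := (1 - t) / n with hw
  have h1 : limitGenFun (shiftLeft n s) (shiftRight n s t) = limitGenFun s t * Complex.exp w := by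
    rw [limitGenFun, limitGenFun, ← Complex.exp_add]
    congr 1
    simp only [shiftLeft, shiftRight, hw]
    field_simp
    ring
  have h2 : ‖limitGenFun s t‖ ≤ 1 := by
    rw [limitGenFun, Complex.norm_exp, Real.exp_le_one_iff]
    have e : ((s - 1) / 8 + (t - 1) / 4 : ℂ).re = (s.re - 1) / 8 + (t.re - 1) / 4 := by
      rw [show ((s - 1) / 8 + (t - 1) / 4 : ℂ) = (((1 / 8 : ℝ) : ℂ) * (s - 1) +
        ((1 / 4 : ℝ) : ℂ) * (t - 1)) by push_cast; ring]
      rw [Complex.add_re, Complex.re_ofReal_mul, Complex.re_ofReal_mul]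
      simp
      ring
    rw [e]
    linarith [(Complex.re_le_norm s).trans hs, (Complex.re_le_norm t).trans ht]
  have hw2 : ‖w‖ ≤ 2 / n := by
    rw [hw, norm_div, Complex.norm_natCast]
    gcongr
    exact norm_sub_le_two (by simp) ht
  have hw1 : ‖w‖ ≤ 1 := hw2.trans (by rw [div_le_one (by linarith)]; linarith)
  have h3 := Complex.norm_exp_sub_one_sub_id_le hw1
  have e : limitGenFun s t - (1 + (t - 1) / n) * (limitGenFun s t * Complex.exp w) =
      limitGenFun s t * (w * w - (1 - w) * (Complex.exp w - 1 - w)) := by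
    rw [show (t - 1) / (n : ℂ) = -w by rw [hw]; ring]
    ring
  rw [h1, e, norm_mul]
  calc ‖limitGenFun s t‖ * ‖w * w - (1 - w) * (Complex.exp w - 1 - w)‖
      ≤ 1 * (‖w‖ * ‖w‖ + 2 * ‖w‖ ^ 2) := by
        gcongr
        refine (norm_sub_le _ _).trans ?_
        rw [norm_mul, norm_mul]
        gcongr
        exact norm_sub_le_two (by simp) hw1
    _ = 3 * ‖w‖ ^ 2 := by ring
    _ ≤ 3 * (2 / n) ^ 2 := by gcongr
    _ = 12 / (n * n) := by ring
    _ ≤ 12 / (n * √n) := by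
        gcongr
        rw [Real.sqrt_le_left (by linarith)]
        nlinarith

end Evolution
end RTCN

namespace RTCN

/-! ### Convergence of the generating functions -/

/-- Iterate the recursion from a fixed m to n. The accumulated contraction is at most m/n, and the
accumulated error is part of the tail of a convergent series. As m is fixed before n tends to
infinity, `K` may depend on its index arbitrarily. -/
theorem tendsto_zero_of_contraction {D : ℕ → ℂ → ℂ → ℝ} {ε K : ℕ → ℝ} (hε : Summable ε)
    (hε0 : ∀ n, 0 ≤ ε n) (hK0 : ∀ n, 0 ≤ K n) (hD0 : ∀ n s t, 0 ≤ D n s t)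
    (hK : ∀ n ≥ 8, ∀ s t : ℂ, ‖s‖ ≤ 1 → ‖t‖ ≤ 1 → D n s t ≤ K n * (‖1 - s‖ + ‖1 - t‖))
    (hD : ∀ n ≥ 8, ∀ s t : ℂ, ‖s‖ ≤ 1 → ‖t‖ ≤ 1 →
      D (n + 1) s t ≤ D n (shiftLeft n s) (shiftRight n s t) + ε n)
    {s t : ℂ} (hs : ‖s‖ ≤ 1) (ht : ‖t‖ ≤ 1) : Tendsto (fun n => D n s t) atTop (𝓝 0) := by
  have key : ∀ m ≥ 8, ∀ n ≥ m, ∀ s t : ℂ, ‖s‖ ≤ 1 → ‖t‖ ≤ 1 →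
      D n s t ≤ K m * (m / n) * (‖1 - s‖ + ‖1 - t‖) + ∑ j ∈ Finset.Ico m n, ε j := by
    intro m hm n hn
    induction n, hn using Nat.le_induction with
    | base =>
      intro s t hs ht
      have : (m : ℝ) ≠ 0 := by
        have : m ≠ 0 := by omega
        exact_mod_cast this
      simpa [div_self this] using hK m hm s t hs ht
    | succ n hn ih =>
      intro s t hs ht
      have hn8 : 8 ≤ n := hm.le.trans hn
      have hn' : (8 : ℝ) ≤ n := by exact_mod_cast hn8
      have h1 := ih _ _ (norm_shiftLeft_le hn8 hs) (norm_shiftRight_le hn8 hs ht)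
      have h2 : K m * (m / n) * (‖1 - shiftLeft n s‖ + ‖1 - shiftRight n s t‖) ≤
          K m * (m / (n + 1 : ℕ)) * (‖1 - s‖ + ‖1 - t‖) := by
        calc _ ≤ K m * (m / n) * ((1 - 4 / n) * (‖1 - s‖ + ‖1 - t‖)) := by
              have := hK0 m
              gcongr
              exact norm_one_sub_shift_add_le hn8
          _ = K m * (m * ((n - 4) / n ^ 2)) * (‖1 - s‖ + ‖1 - t‖) := by
              field_simp
          _ ≤ K m * (m * (1 / (n + 1))) * (‖1 - s‖ + ‖1 - t‖) := by
              have := hK0 m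
              gcongr ?_ * (_ * ?_) * _
              · rw [div_le_div_iff₀ (by positivity) (by positivity)]
                nlinarith
          _ = _ := by push_cast; ring
      rw [Finset.sum_Ico_succ_top hn]
      linarith [hD n hn8 s t hs ht]
  rw [Metric.tendsto_atTop]
  intro η hη
  have htail := tendsto_sum_nat_add ε
  -- Choose m to make the tail of the errors small; then n to make m/n small.
  obtain ⟨m, hm8, hm⟩ : ∃ m ≥ 8, ∑' j, ε (j + m) < η / 2 :=
    ((eventually_ge_atTop 8).and (htail.eventually (gt_mem_nhds (half_pos hη)))).exists
  have h0 : Tendsto (fun n : ℕ => K m * m * (‖1 - s‖ + ‖1 - t‖) / n) atTop (𝓝 0) :=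
    tendsto_const_div_atTop_nhds_zero_nat _
  obtain ⟨N, hN⟩ := eventually_atTop.1 (h0.eventually (gt_mem_nhds (half_pos hη)))
  refine ⟨max N m, fun n hn => ?_⟩
  have h1 := key m hm8 n ((le_max_right _ _).trans hn) s t hs ht
  have h2 := hN n ((le_max_left _ _).trans hn)
  have h3 : ∑ j ∈ Finset.Ico m n, ε j ≤ ∑' j, ε (j + m) := by
    rw [Finset.sum_Ico_eq_sum_range]
    simp only [add_comm m]
    exact ((summable_nat_add_iff m).2 hε).sum_le_tsum _ fun j _ => hε0 _
  rw [Real.dist_eq, sub_zero, abs_of_nonneg (hD0 _ _ _)]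
  have h4 : K m * (m / n) * (‖1 - s‖ + ‖1 - t‖) = K m * m * (‖1 - s‖ + ‖1 - t‖) / n := by ring
  linarith

namespace Evolution

variable {s t : ℂ}

theorem norm_genFun_sub_one_le {n : ℕ} (hn : 2 ≤ n) (hs : ‖s‖ ≤ 1) (ht : ‖t‖ ≤ 1) :
    ‖genFun n s t - 1‖ ≤ mean (fun h : Evolution n => (h.hitCount + h.cherryCount : ℝ)) *
      (‖1 - s‖ + ‖1 - t‖) := by
  have h0 : genFun n s t - 1 =
      mean fun h : Evolution n => monomialFun s t h.hitCount h.cherryCount - 1 := by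
    rw [mean_sub, mean_const hn]; rfl
  rw [h0, mul_comm, ← mean_mul]
  refine (norm_mean_le _).trans (mean_mono fun h => ?_)
  have h1 := norm_monomialFun_sub_le (s := 1) (t := 1) (by simp) (by simp) hs ht h.hitCount
    h.cherryCount
  have h2 : monomialFun 1 1 h.hitCount h.cherryCount = 1 := by simp [monomialFun]
  rw [h2, norm_sub_rev s, norm_sub_rev t] at h1
  refine h1.trans ?_
  have h3 : 0 ≤ h.hitCount * ‖1 - t‖ + h.cherryCount * ‖1 - s‖ := by positivity
  linarith

theorem norm_limitGenFun_sub_one_le (hs : ‖s‖ ≤ 1) (ht : ‖t‖ ≤ 1) :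
    ‖limitGenFun s t - 1‖ ≤ ‖1 - s‖ + ‖1 - t‖ := by
  have h : ‖(s - 1) / 8 + (t - 1) / 4‖ ≤ ‖1 - s‖ / 8 + ‖1 - t‖ / 4 := by
    refine (norm_add_le _ _).trans ?_
    rw [norm_div, norm_div, norm_sub_rev s, norm_sub_rev t]
    simp
  have h1 : ‖1 - s‖ ≤ 2 := norm_sub_le_two (by simp) hs
  have h2 : ‖1 - t‖ ≤ 2 := norm_sub_le_two (by simp) ht
  have h3 := Complex.norm_exp_sub_one_le (x := (s - 1) / 8 + (t - 1) / 4) (by linarith)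
  rw [limitGenFun]
  linarith [norm_nonneg (1 - s), norm_nonneg (1 - t)]

theorem summable_div_mul_sqrt (C : ℝ) : Summable fun n : ℕ => C / (n * √n) := by
  have h := (Real.summable_one_div_nat_rpow (p := 3 / 2)).2 (by norm_num)
  refine (h.mul_left C).congr fun n => ?_
  rw [mul_one_div]
  congr 1
  rcases Nat.eq_zero_or_pos n with rfl | hn
  · simp
  · have hn : (0 : ℝ) < n := by exact_mod_cast hn
    rw [Real.sqrt_eq_rpow, show (3 / 2 : ℝ) = 1 + 1 / 2 by norm_num, Real.rpow_add hn,
      Real.rpow_one]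

theorem tendsto_genFun (hs : ‖s‖ ≤ 1) (ht : ‖t‖ ≤ 1) :
    Tendsto (fun n => genFun n s t) atTop (𝓝 (limitGenFun s t)) := by
  rw [tendsto_iff_norm_sub_tendsto_zero]
  -- `K` is a Lipschitz constant at (1, 1): the mean of X + C for the generating function, and 1 for
  -- the limit.
  refine tendsto_zero_of_contraction (D := fun n s t => ‖genFun n s t - limitGenFun s t‖)
    (K := fun n => mean (fun h : Evolution n => (h.hitCount + h.cherryCount : ℝ)) + 1)
    (summable_div_mul_sqrt (10 ^ 10 + 12)) (fun n => by positivity) (fun n => ?_)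
    (fun n s t => norm_nonneg _) (fun n hn s t hs ht => ?_) (fun n hn s t hs ht => ?_) hs ht
  · have := mean_nonneg fun h : Evolution n =>
      (by positivity : (0 : ℝ) ≤ h.hitCount + h.cherryCount)
    linarith
  · have h1 := norm_genFun_sub_one_le (n := n) (by omega) hs ht
    have h2 := norm_limitGenFun_sub_one_le hs ht
    have h3 := norm_sub_le (genFun n s t - 1) (limitGenFun s t - 1)
    rw [sub_sub_sub_cancel_right] at h3
    linarith
  · have hn' : (8 : ℝ) ≤ n := by exact_mod_cast hn
    have h1 := norm_genFun_succ_sub_le hn hs ht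
    have h2 := norm_limitGenFun_sub_le hn hs ht
    set g := genFun n (shiftLeft n s) (shiftRight n s t)
    set l := limitGenFun (shiftLeft n s) (shiftRight n s t)
    have h3 : ‖1 + (t - 1) / n‖ ≤ 1 := by
      have := norm_convexComb_le (a := 1) (b := t) (r := 1 / n) (M := 1) (by positivity)
        (by rw [div_le_one (by linarith)]; linarith) (by simp) ht
      have e : (1 : ℂ) + ((1 / n : ℝ) : ℂ) * (t - 1) = 1 + (t - 1) / n := by push_cast; ring
      rwa [e] at this
    have e : genFun (n + 1) s t - limitGenFun s t =
        (genFun (n + 1) s t - (1 + (t - 1) / n) * g) -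
          (limitGenFun s t - (1 + (t - 1) / n) * l) + (1 + (t - 1) / n) * (g - l) := by ring
    have h4 : ‖(1 + (t - 1) / n) * (g - l)‖ ≤ ‖g - l‖ := by
      rw [norm_mul]
      exact mul_le_of_le_one_left (norm_nonneg _) h3
    change ‖genFun (n + 1) s t - limitGenFun s t‖ ≤ ‖g - l‖ + _
    rw [e, add_div]
    refine (norm_add_le _ _).trans ?_
    have h5 := norm_sub_le (genFun (n + 1) s t - (1 + (t - 1) / n) * g)
      (limitGenFun s t - (1 + (t - 1) / n) * l)
    linarith

end Evolution

/-! ### Convergence in distribution of pairs of natural numbers -/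

/-- The embedding of the lattice of pairs of natural numbers into the complex plane. -/
noncomputable def latticePoint (x : ℕ × ℕ) : ℂ := x.1 + x.2 * Complex.I

theorem one_le_dist_latticePoint {x y : ℕ × ℕ} (h : x ≠ y) :
    1 ≤ dist (latticePoint x) (latticePoint y) := by
  have hnat : ∀ {a b : ℕ}, a ≠ b → (1 : ℝ) ≤ |(a : ℝ) - b| := fun {a b} hab => by
    have : (1 : ℤ) ≤ |(a : ℤ) - b| := Int.one_le_abs (sub_ne_zero.2 (by exact_mod_cast hab))
    exact_mod_cast this
  rw [Complex.dist_eq]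
  by_cases h1 : x.1 = y.1
  · have h2 : x.2 ≠ y.2 := fun h2 => h (Prod.ext h1 h2)
    refine (hnat h2).trans (le_trans (le_of_eq ?_) (Complex.abs_im_le_norm _))
    simp [latticePoint]
  · refine (hnat h1).trans (le_trans (le_of_eq ?_) (Complex.abs_re_le_norm _))
    simp [latticePoint]

/-- The characteristic function is the generating function on the torus, which is why complex s and
t of norm up to 1 are needed throughout. -/
theorem charFun_map_latticePoint (μ : Measure (ℕ × ℕ)) (z : ℂ) :
    charFun (μ.map latticePoint) z =
      ∫ x, monomialFun (Complex.exp (z.re * Complex.I)) (Complex.exp (z.im * Complex.I)) x.1 x.2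
        ∂μ := by
  rw [charFun_apply, integral_map Measurable.of_discrete.aemeasurable
    (by fun_prop)]
  congr 1
  ext x
  rw [monomialFun, ← Complex.exp_nat_mul, ← Complex.exp_nat_mul, ← Complex.exp_add,
    Complex.inner]
  congr 1
  have : (z * (starRingEnd ℂ) (latticePoint x)).re = x.1 * z.re + x.2 * z.im := by
    simp [latticePoint]
    ring
  rw [this]
  push_cast
  ring

/-- Lévy's continuity theorem applies to the image measures on the plane. The convergence is pulled
back by the portmanteau theorem. -/
theorem tendsto_of_tendsto_integral_monomialFun {μs : ℕ → ProbabilityMeasure (ℕ × ℕ)}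
    {μ : ProbabilityMeasure (ℕ × ℕ)}
    (h : ∀ s t : ℂ, ‖s‖ ≤ 1 → ‖t‖ ≤ 1 →
      Tendsto (fun n => ∫ x, monomialFun s t x.1 x.2 ∂(μs n : Measure (ℕ × ℕ))) atTop
        (𝓝 (∫ x, monomialFun s t x.1 x.2 ∂(μ : Measure (ℕ × ℕ))))) :
    Tendsto μs atTop (𝓝 μ) := by
  have hm : ∀ ν : ProbabilityMeasure (ℕ × ℕ), AEMeasurable latticePoint (ν : Measure (ℕ × ℕ)) :=
    fun ν => Measurable.of_discrete.aemeasurable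
  have hlim : Tendsto (fun n => (μs n).map (hm _)) atTop (𝓝 (μ.map (hm μ))) := by
    refine ProbabilityMeasure.tendsto_of_tendsto_charFun fun z => ?_
    simp only [ProbabilityMeasure.toMeasure_map, charFun_map_latticePoint]
    exact h _ _ (Complex.norm_exp_ofReal_mul_I _).le (Complex.norm_exp_ofReal_mul_I _).le
  refine tendsto_of_forall_isOpen_le_liminf' fun G _ => ?_
  have hU : IsOpen (⋃ g ∈ G, Metric.ball (latticePoint g) 1) :=
    isOpen_biUnion fun _ _ => Metric.isOpen_ball
  -- Distinct lattice points have distance at least 1, so any set of pairs is the preimage of an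
  -- open set.
  have hpre : latticePoint ⁻¹' (⋃ g ∈ G, Metric.ball (latticePoint g) 1) = G := by
    ext x
    simp only [Set.mem_preimage, Set.mem_iUnion, Metric.mem_ball, exists_prop]
    constructor
    · rintro ⟨g, hg, hx⟩
      by_contra hxG
      have : x ≠ g := fun e => hxG (e ▸ hg)
      exact hx.not_ge (one_le_dist_latticePoint this)
    · exact fun hx => ⟨x, hx, by simp⟩
  have := ProbabilityMeasure.le_liminf_measure_open_of_tendsto hlim hU
  simpa only [ProbabilityMeasure.map_apply' _ _ hU.measurableSet, hpre] using this

theorem integral_pow_poissonMeasure (r : NNReal) (s : ℂ) :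
    ∫ x, s ^ x ∂poissonMeasure r = Complex.exp (r * (s - 1)) := by
  rw [integral_poissonMeasure]
  calc ∑' x : ℕ, (Real.exp (-r) * r ^ x / x.factorial : ℝ) • s ^ x
      = ∑' x : ℕ, (Real.exp (-r) : ℂ) * ((r * s) ^ x / x.factorial) := by
        congr with x
        rw [Complex.real_smul]
        push_cast
        rw [mul_pow]
        ring
    _ = Complex.exp (r * (s - 1)) := by
        rw [tsum_mul_left, (NormedSpace.expSeries_div_hasSum_exp (r * s : ℂ)).tsum_eq,
          ← Complex.exp_eq_exp_ℂ, Complex.ofReal_exp, ← Complex.exp_add]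
        push_cast
        ring_nf

theorem integral_monomialFun_poissonMeasure (s t : ℂ) :
    ∫ x, monomialFun s t x.1 x.2 ∂((poissonMeasure (1 / 8)).prod (poissonMeasure (1 / 4))) =
      Evolution.limitGenFun s t := by
  have h := integral_prod_mul (μ := poissonMeasure (1 / 8)) (ν := poissonMeasure (1 / 4))
    (fun x => s ^ x) (fun c => t ^ c)
  simp only [monomialFun]
  rw [h, integral_pow_poissonMeasure, integral_pow_poissonMeasure, ← Complex.exp_add,
    Evolution.limitGenFun]
  congr 1
  push_cast
  ring

/-! ### Transfer to random networks and the two limits -/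

namespace RankedTreeChildNetwork

theorem integral_numDoubleHits_le {n : ℕ} (hn : 2 ≤ n) :
    ∫ N : RankedTreeChildNetwork n, (N.numDoubleHits : ℝ) ∂uniform n ≤ 4800000 / √n := by
  rw [integral_uniform _ (fun h => (((fun q => (.inl (h.stage.source (q 3)) : h.Node ⊕ Fin n)) ''
      (h.stage.doubles : Set (Fin 5 → Fin n))).ncard : ℝ))
    fun x => by rw [numDoubleHits_ofEvolution]]
  refine (Evolution.mean_mono fun h => ?_).trans (Evolution.mean_doubleCount_le hn)
  -- The weight (5/4)^B is at least 1 and can be dropped here.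
  refine le_trans (b := (h.doubleCount : ℝ)) ?_ ?_
  · exact_mod_cast Stage.ncard_image_doubles_le
  · exact le_mul_of_one_le_right (Nat.cast_nonneg _) (one_le_pow₀ (by norm_num))

theorem integral_monomialFun_uniform (n : ℕ) (s t : ℂ) :
    ∫ N : RankedTreeChildNetwork n, monomialFun s t N.numHitCherries N.numCherries ∂uniform n =
      Evolution.genFun n s t :=
  integral_uniform _ _ fun x => by
    rw [numHitCherries_ofEvolution, numCherries_ofEvolution]; rfl

end RankedTreeChildNetwork

end RTCN

theorem proposition2 :
    Tendsto (fun n : ℕ =>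
        eLpNorm (fun N : RTCN.RankedTreeChildNetwork (n + 2) => (N.numDoubleHits : ℝ)) 1
          (RTCN.RankedTreeChildNetwork.uniform (n + 2)))
      atTop (𝓝 0) ∧
    TendstoInDistribution
      (fun (n : ℕ) (N : RTCN.RankedTreeChildNetwork (n + 2)) =>
        (N.numHitCherries, N.numCherries))
      atTop
      (fun XC : ℕ × ℕ => (XC.1, XC.2))
      (fun n : ℕ => RTCN.RankedTreeChildNetwork.uniform (n + 2))
      ((poissonMeasure (1 / 8)).prod (poissonMeasure (1 / 4))) := by
  constructor
  · have h : ∀ n : ℕ,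
        eLpNorm (fun N : RTCN.RankedTreeChildNetwork (n + 2) => (N.numDoubleHits : ℝ)) 1
          (RTCN.RankedTreeChildNetwork.uniform (n + 2)) ≤
          ENNReal.ofReal (4800000 / √((n + 2 : ℕ) : ℝ)) := by
      intro n
      rw [eLpNorm_one_eq_lintegral_enorm, ← ofReal_integral_norm_eq_lintegral_enorm .of_finite]
      refine ENNReal.ofReal_le_ofReal ?_
      simp only [Real.norm_natCast]
      exact RTCN.RankedTreeChildNetwork.integral_numDoubleHits_le (Nat.le_add_left 2 n)
    have h0 : Tendsto (fun n : ℕ => ENNReal.ofReal (4800000 / √((n + 2 : ℕ) : ℝ))) atTop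
        (𝓝 0) := by
      rw [← ENNReal.ofReal_zero]
      refine ENNReal.tendsto_ofReal ((tendsto_const_nhds (x := (4800000 : ℝ))).div_atTop ?_)
      exact Real.tendsto_sqrt_atTop.comp
        (tendsto_natCast_atTop_atTop.comp (tendsto_add_atTop_nat 2))
    exact tendsto_of_tendsto_of_tendsto_of_le_of_le tendsto_const_nhds h0
      (fun _ => zero_le) h
  · refine ⟨fun n => Measurable.of_discrete.aemeasurable, Measurable.of_discrete.aemeasurable,
      RTCN.tendsto_of_tendsto_integral_monomialFun fun s t hs ht => ?_⟩
    have h1 := (RTCN.Evolution.tendsto_genFun hs ht).comp (tendsto_add_atTop_nat 2)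
    rw [← RTCN.integral_monomialFun_poissonMeasure] at h1
    convert h1 using 2 with n
    · simp only [ProbabilityMeasure.coe_mk]
      rw [integral_map Measurable.of_discrete.aemeasurable
        Measurable.of_discrete.aestronglyMeasurable]
      exact RTCN.RankedTreeChildNetwork.integral_monomialFun_uniform (n + 2) s t
    · simp
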